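/- **Birkhoff's theorem.** All manifolds, metrics and functions are $C^\infty$. Let $m\ge 2$, $n=2+m$, $\Lambda\in\mathbb R$, and let $(\bar{\mathcal M},\bar g)$ be an $n$-dimensional pseudo-Riemannian manifold which near a point $\bar x$ is isometric to an open part of a warped product $(\mathcal M,g)\times_r(\mathcal S,\Omega)$, i.e. $\bar g=g+r^2\Omega$, where $(\mathcal M,g)$ is a $2$-dimensional Lorentzian manifold, $(\mathcal S,\Omega)$ is an $m$-dimensional pseudo-Riemannian manifold, and $r$ is a nowhere vanishing function on $\mathcal M$. Let $\bar x$ correspond to $(x,y)\in\mathcal M\times\mathcal S$. Assume that $r$ is not constant on any neighbourhood of $x$, that $\bar g$ satisfies $\mathrm{Ric}[\bar g]=\frac{2\Lambda}{n-2}\bar g$, and that $\bar g$ is not of constant curvature on any neighbourhood of $\bar x$. Then there are real constants $\alpha$ and $M$ such that, with $$f(r)=\alpha-\frac{2M}{r^{n-3}}-\frac{2\Lambda}{(n-1)(n-2)}\,r^2 ,$$ the following hold. Here $X_{(a}Y_{b)}=\frac12(X_aY_b+X_bY_a)$. (a) If $\nabla r\neq0$ and $(\nabla r)^2\ne0$ at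 $x$, there are local coordinates $(t,r)$ near $x$ in which $g_{ab}=-f\,dt_adt_b+\frac1f\,dr_adr_b$. (b) If $\nabla r\ne0$ and $(\nabla r)^2=0$ at $x$, then $f(r_H)=0$ for $r_H=r(x)$, and there are local coordinates $(v,r)$ near $x$ in which $g_{ab}=-f\,dv_adv_b+2\,dv_{(a}dr_{b)}$. (c) If $\nabla r=0$ at $x$, then $r_H=r(x)$ is a simple root of $f$ (that is, $f(r_H)=0\neq f'(r_H)$), and there are local coordinates $(U,V)$ near $x$, vanishing at $x$, in which $r=r(UV)=r_H+r_H\,UV+O^3(U,V)$ for a smooth function $r(z)$ of one variable with $z\,r'(z)=f(r(z))/f'(r_H)$, and $$g_{ab}=\frac{-4f\,e^{-h}}{f'(r_H)^2\,(1-r/r_H)}\,dU_{(a}dV_{b)},\qquad h(r)=\int_{r_H}^r\Big(\frac{f'(r_H)}{f(s)}-\frac1{s-r_H}\Big)ds ,$$ where the coefficient of $dU_{(a}dV_{b)}$ at $r=r_H$ is understood as its limit $4r_H/f'(r_H)$. Moreover, $M\neq0$ if $m\le3$, or if $\Omega$ is of constant curvature on a neighbourhood of $y$. Finally, for a real number $M'\neq0$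 let the *gST base* with parameters $(n,\alpha,M',\Lambda)$ be the analytic extension of the $2$-dimensional geometry $-\tilde f\,dt^2+\tilde f^{-1}dr^2$ together with its function $r\ne0$, where $\tilde f$ is $f$ with $M$ replaced by $M'$, except that on the component $r<0$ one replaces $M$ by $-M'$ when $n$ is odd. If $M\ne0$, then for $M'=M$ or $M'=-M$ the surface $(\mathcal M,g)$ is locally isometric at $x$, by an isometry preserving $r$, to the gST base with parameters $(n,\alpha,M',\Lambda)$ at a point which is, in the cases (a), (b), (c) respectively, a generic point ($(\nabla r)^2\ne0$), a horizon point ($\nabla r\ne0$, $(\nabla r)^2=0$), or a horizon bifurcation point ($\nabla r=0$). -/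

import Mathlib

open Set Filter Topology
open scoped Manifold ContDiff

noncomputable section

/-! ### Pseudo-Riemannian metrics and their curvature -/

/-- Smooth local coordinates on a manifold `N` modelled on `ℝ^ι`: a diffeomorphism from an open
subset of `N` onto an open subset of `ℝ^ι`. -/
abbrev LocalCoords (ι N : Type*) [Fintype ι] [TopologicalSpace N] [ChartedSpace (ι → ℝ) N] :=
  PartialDiffeomorph 𝓘(ℝ, ι → ℝ) 𝓘(ℝ, ι → ℝ) N (ι → ℝ) ∞

/-- The components `b(∂_i, ∂_j)`, in the local coordinates `e` and at the coordinate point `p`, of a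
field `b` of bilinear forms on the tangent spaces. -/
def bilinComponents {ι N : Type*} [Fintype ι] [DecidableEq ι] [TopologicalSpace N]
    [ChartedSpace (ι → ℝ) N]
    (b : ∀ x : N, LinearMap.BilinForm ℝ (TangentSpace 𝓘(ℝ, ι → ℝ) x))
    (e : LocalCoords ι N) (p : ι → ℝ) : Matrix ι ι ℝ :=
  Matrix.of fun i j =>
    b (e.symm p)
      (mfderiv 𝓘(ℝ, ι → ℝ) 𝓘(ℝ, ι → ℝ) e.symm p (Pi.single i (1 : ℝ) : ι → ℝ))
      (mfderiv 𝓘(ℝ, ι → ℝ) 𝓘(ℝ, ι → ℝ) e.symm p (Pi.single j (1 : ℝ) : ι → ℝ))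

/-- A smooth pseudo-Riemannian metric (of arbitrary signature) on a manifold modelled on `ℝ^ι`. -/
structure PseudoRiemannianMetric (ι N : Type*) [Fintype ι] [DecidableEq ι] [TopologicalSpace N]
    [ChartedSpace (ι → ℝ) N] where
  /-- the bilinear form on each tangent space -/
  form : ∀ x : N, LinearMap.BilinForm ℝ (TangentSpace 𝓘(ℝ, ι → ℝ) x)
  symm : ∀ x, (form x).IsSymm
  nondegenerate : ∀ x, (form x).Nondegenerate
  /-- the components are smooth in all local coordinates -/
  smooth : ∀ (e : LocalCoords ι N) (i j : ι),
    ContDiffOn ℝ ∞ (fun p => bilinComponents form e p i j) e.target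

/-- Partial derivative of a function on `ℝ^ι`. -/
def partialD {ι : Type*} [Fintype ι] [DecidableEq ι] (i : ι) (F : (ι → ℝ) → ℝ) (p : ι → ℝ) : ℝ :=
  fderiv ℝ F p (Pi.single i 1)

/-- Christoffel symbols `Γ^k_{ij}` of a metric given by its components `G` in coordinates. -/
def christoffel {ι : Type*} [Fintype ι] [DecidableEq ι] (G : (ι → ℝ) → Matrix ι ι ℝ)
    (k i j : ι) (p : ι → ℝ) : ℝ :=
  1 / 2 * ∑ l, (G p)⁻¹ k l *
    (partialD i (fun q => G q l j) p + partialD j (fun q => G q l i) p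
      - partialD l (fun q => G q i j) p)

/-- The Riemann tensor `R^k_{lij}`, where `R(∂_i, ∂_j) ∂_l = R^k_{lij} ∂_k`. -/
def riemannUp {ι : Type*} [Fintype ι] [DecidableEq ι] (G : (ι → ℝ) → Matrix ι ι ℝ)
    (k l i j : ι) (p : ι → ℝ) : ℝ :=
  partialD i (christoffel G k j l) p - partialD j (christoffel G k i l) p
    + ∑ s, (christoffel G k i s p * christoffel G s j l p
      - christoffel G k j s p * christoffel G s i l p)

/-- The Riemann tensor with all indices down, `R_{klij} = g_{ks} R^s_{lij}`. -/
def riemannDown {ι : Type*} [Fintype ι] [DecidableEq ι] (G : (ι → ℝ) → Matrix ι ι ℝ)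
    (k l i j : ι) (p : ι → ℝ) : ℝ :=
  ∑ s, G p k s * riemannUp G s l i j p

/-- The Ricci tensor `R_{lj} = R^k_{lkj}` (positive on round spheres). -/
def ricci {ι : Type*} [Fintype ι] [DecidableEq ι] (G : (ι → ℝ) → Matrix ι ι ℝ)
    (l j : ι) (p : ι → ℝ) : ℝ :=
  ∑ k, riemannUp G k l k j p

namespace PseudoRiemannianMetric

variable {ι N : Type*} [Fintype ι] [DecidableEq ι] [TopologicalSpace N] [ChartedSpace (ι → ℝ) N]

/-- The components of the metric in local coordinates. -/
def components (g : PseudoRiemannianMetric ι N) (e : LocalCoords ι N) : (ι → ℝ) → Matrix ι ι ℝ :=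
  bilinComponents g.form e

/-- Lorentzian signature `(-,+,…,+)`: at every point there is a timelike vector whose orthogonal
complement is spacelike. -/
def IsLorentzian (g : PseudoRiemannianMetric ι N) : Prop :=
  ∀ x, ∃ v, g.form x v v < 0 ∧ ∀ w, w ≠ 0 → g.form x v w = 0 → 0 < g.form x w w

/-- The gradient of a function. -/
def gradient (g : PseudoRiemannianMetric ι N) (r : N → ℝ) (x : N) : TangentSpace 𝓘(ℝ, ι → ℝ) x :=
  haveI : FiniteDimensional ℝ (TangentSpace 𝓘(ℝ, ι → ℝ) x) :=
    inferInstanceAs (FiniteDimensional ℝ (ι → ℝ))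
  ((g.form x).toDual (g.nondegenerate x)).symm
    (show TangentSpace 𝓘(ℝ, ι → ℝ) x →L[ℝ] ℝ from
      mfderiv 𝓘(ℝ, ι → ℝ) 𝓘(ℝ, ℝ) r x).toLinearMap

/-- The gradient is the vector dual to the differential. -/
theorem form_gradient (g : PseudoRiemannianMetric ι N) (r : N → ℝ) (x : N)
    (v : TangentSpace 𝓘(ℝ, ι → ℝ) x) :
    g.form x (g.gradient r x) v = (mfderiv 𝓘(ℝ, ι → ℝ) 𝓘(ℝ, ℝ) r x v : ℝ) := by
  have : FiniteDimensional ℝ (TangentSpace 𝓘(ℝ, ι → ℝ) x) :=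
    inferInstanceAs (FiniteDimensional ℝ (ι → ℝ))
  unfold gradient
  rw [LinearMap.BilinForm.apply_toDual_symm_apply]
  rfl

/-- `(∇r)² = r_a r^a`. -/
def gradSq (g : PseudoRiemannianMetric ι N) (r : N → ℝ) (x : N) : ℝ :=
  g.form x (g.gradient r x) (g.gradient r x)

/-- The source-free Einstein equations with cosmological constant `Λ`, in the form
`R_{μν} = 2Λ/(n-2) g_{μν}` with `n` the dimension, in all local coordinates. -/
def IsLambdaVacuum (g : PseudoRiemannianMetric ι N) (Λ : ℝ) : Prop :=
  ∀ (e : LocalCoords ι N), ∀ p ∈ e.target, ∀ i j,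
    ricci (g.components e) i j p = 2 * Λ / ((Fintype.card ι : ℝ) - 2) * g.components e p i j

/-- `g` is of constant curvature on a neighbourhood of `x`:
`R_{klij} = K (g_{ki} g_{lj} - g_{kj} g_{li})` there, for some constant `K`. -/
def LocallyConstantCurvatureAt (g : PseudoRiemannianMetric ι N) (x : N) : Prop :=
  ∃ (K : ℝ) (e : LocalCoords ι N), x ∈ e.source ∧ ∀ p ∈ e.target, ∀ k l i j,
    riemannDown (g.components e) k l i j p =
      K * (g.components e p k i * g.components e p l j
        - g.components e p k j * g.components e p l i)

end PseudoRiemannianMetric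

/-! ### Warped products -/

/-- The diffeomorphism `Φ` from an open subset of `N` onto an open subset of `B × S` identifies the
metric `gbar` with the warped product metric `g + r² Ω`. -/
def IsWarpedProductVia {ι κ τ N B S : Type*}
    [Fintype ι] [DecidableEq ι] [Fintype κ] [DecidableEq κ] [Fintype τ] [DecidableEq τ]
    [TopologicalSpace N] [ChartedSpace (τ → ℝ) N]
    [TopologicalSpace B] [ChartedSpace (ι → ℝ) B]
    [TopologicalSpace S] [ChartedSpace (κ → ℝ) S]
    (gbar : PseudoRiemannianMetric τ N) (g : PseudoRiemannianMetric ι B) (r : B → ℝ) (Ω : PseudoRiemannianMetric κ S)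
    (Φ : PartialDiffeomorph 𝓘(ℝ, τ → ℝ) (𝓘(ℝ, ι → ℝ).prod 𝓘(ℝ, κ → ℝ)) N (B × S) ∞) : Prop :=
  ∀ q ∈ Φ.source, ∀ u v : TangentSpace 𝓘(ℝ, τ → ℝ) q,
    gbar.form q u v =
      g.form (Φ q).1
          (mfderiv 𝓘(ℝ, τ → ℝ) 𝓘(ℝ, ι → ℝ) (fun q' => (Φ q').1) q u)
          (mfderiv 𝓘(ℝ, τ → ℝ) 𝓘(ℝ, ι → ℝ) (fun q' => (Φ q').1) q v)
        + r (Φ q).1 ^ 2 *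
          Ω.form (Φ q).2
            (mfderiv 𝓘(ℝ, τ → ℝ) 𝓘(ℝ, κ → ℝ) (fun q' => (Φ q').2) q u)
            (mfderiv 𝓘(ℝ, τ → ℝ) 𝓘(ℝ, κ → ℝ) (fun q' => (Φ q').2) q v)

/-! ### The three normal forms of the base metric -/

/-- `f(r) = α - 2M / r^{n-3} - 2Λ / ((n-1)(n-2)) r²` (used for `n ≥ 4`). -/
def profile (n : ℕ) (α M Λ r : ℝ) : ℝ :=
  α - 2 * M / r ^ (n - 3) - 2 * Λ / (((n : ℝ) - 1) * ((n : ℝ) - 2)) * r ^ 2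

section NormalForms

variable {B : Type*} [TopologicalSpace B] [ChartedSpace (Fin 2 → ℝ) B]

/-- Components in coordinates `(t, r)` of `-f dt dt + (1/f) dr dr`. -/
def schwarzschildMatrix (f : ℝ → ℝ) (r : ℝ) : Matrix (Fin 2) (Fin 2) ℝ :=
  !![-f r, 0; 0, 1 / f r]

/-- Near `x` there are coordinates `(t, r)` in which `g = -f dt dt + (1/f) dr dr`. -/
def HasSchwarzschildForm (f : ℝ → ℝ) (g : PseudoRiemannianMetric (Fin 2) B) (r : B → ℝ) (x : B) : Prop :=
  ∃ e : LocalCoords (Fin 2) B, x ∈ e.source ∧ (∀ q ∈ e.source, e q 1 = r q ∧ f (r q) ≠ 0) ∧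
    ∀ p ∈ e.target, g.components e p = schwarzschildMatrix f (p 1)

/-- Near `x` there are coordinates `(v, r)` in which `g = -f dv dv + (dv dr + dr dv)`. -/
def HasEddingtonFinkelsteinForm (f : ℝ → ℝ) (g : PseudoRiemannianMetric (Fin 2) B) (r : B → ℝ) (x : B) :
    Prop :=
  ∃ e : LocalCoords (Fin 2) B, x ∈ e.source ∧ (∀ q ∈ e.source, e q 1 = r q) ∧
    ∀ p ∈ e.target, g.components e p = !![-f (p 1), 1; 1, 0]

/-- The integrand `f'(r_H)/f(s) - 1/(s - r_H)`. -/
def kruskalIntegrand (f : ℝ → ℝ) (rH s : ℝ) : ℝ := deriv f rH / f s - 1 / (s - rH)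

/-- `h(r) = ∫_{r_H}^r (f'(r_H)/f(s) - 1/(s - r_H)) ds`. -/
def kruskalH (f : ℝ → ℝ) (rH r : ℝ) : ℝ := ∫ s in rH..r, kruskalIntegrand f rH s

open Classical in
/-- The factor `-4 f e^{-h} / (f'(r_H)² (1 - r/r_H))`, with its limit `4 r_H / f'(r_H)` as the value
at `r = r_H`. -/
def kruskalFactor (f : ℝ → ℝ) (rH r : ℝ) : ℝ :=
  if r = rH then 4 * rH / deriv f rH
  else -4 * f r * Real.exp (-kruskalH f rH r) / (deriv f rH ^ 2 * (1 - r / rH))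

/-- With `r_H = r(x)`, there are coordinates `(U, V)` near `x`, vanishing at `x`, in which
`r = ϱ(UV) = r_H + r_H UV + O³(U,V)` for a smooth `ϱ` with `z ϱ'(z) = f(ϱ(z)) / f'(r_H)`, and
`g = kruskalFactor f r_H r · (dU dV + dV dU)/2`. -/
def HasKruskalForm (f : ℝ → ℝ) (g : PseudoRiemannianMetric (Fin 2) B) (r : B → ℝ) (x : B) : Prop :=
  ∃ e : LocalCoords (Fin 2) B, x ∈ e.source ∧ e x = 0 ∧
    (∃ δ > 0, ∃ ϱ : ℝ → ℝ, ContDiffOn ℝ ∞ ϱ (Ioo (-δ) δ) ∧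
      (∀ p ∈ e.target, p 0 * p 1 ∈ Ioo (-δ) δ ∧ r (e.symm p) = ϱ (p 0 * p 1)) ∧
      ∀ z ∈ Ioo (-δ) δ, z * deriv ϱ z = f (ϱ z) / deriv f (r x)) ∧
    (fun p : Fin 2 → ℝ => r (e.symm p) - (r x + r x * (p 0 * p 1)))
      =O[𝓝 0] (fun p : Fin 2 → ℝ => ‖p‖ ^ 3) ∧
    ∀ p ∈ e.target,
      IntervalIntegrable (kruskalIntegrand f (r x)) MeasureTheory.volume (r x) (r (e.symm p)) ∧
      g.components e p =
        !![0, kruskalFactor f (r x) (r (e.symm p)) / 2;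
           kruskalFactor f (r x) (r (e.symm p)) / 2, 0]

end NormalForms

/-! ### Generalized Schwarzschild-Tangherlini geometries -/

open Classical in
/-- The function `f` of the generalized Schwarzschild-Tangherlini geometry with parameters
`(α, M, Λ)`, on its component with `r > 0` and on its component with `r < 0`: on the latter the
parameter `M` is by convention replaced by `-M` when `n` is odd. -/
def gSTProfile (n : ℕ) (α M Λ r : ℝ) : ℝ :=
  profile n α (if r < 0 ∧ Odd n then -M else M) Λ r

/-- A coordinate domain of the analytic extension of the 2-dimensional geometry
`-f dt dt + (1/f) dr dr`, `f = gSTProfile n α M Λ`, which is the base of the generalized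
Schwarzschild-Tangherlini geometry with parameters `(α, M, Λ)`: an open connected subset of `ℝ²`
with a real-analytic Lorentzian metric and a real-analytic nowhere vanishing function `r`, such that
some nonempty open part of it is identified with a part of the `(t, r)` chart, by an isometry that
preserves `r`. Being analytic on a connected domain, the metric and `r` are determined by the
`(t, r)` chart; every point of the extended geometry lies in such a domain. -/
structure GSTBaseDomain (n : ℕ) (α M Λ : ℝ) where
  /-- the coordinate domain -/
  domain : Set (Fin 2 → ℝ)
  /-- the components of the metric -/
  metric : (Fin 2 → ℝ) → Matrix (Fin 2) (Fin 2) ℝ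
  /-- the warping function -/
  r : (Fin 2 → ℝ) → ℝ
  isOpen_domain : IsOpen domain
  isConnected_domain : IsConnected domain
  analytic_metric : ∀ i j, AnalyticOnNhd ℝ (fun p => metric p i j) domain
  symm_metric : ∀ p ∈ domain, (metric p).IsSymm
  /-- in dimension two, this is Lorentzian signature -/
  lorentzian_metric : ∀ p ∈ domain, (metric p).det < 0
  analytic_r : AnalyticOnNhd ℝ r domain
  r_ne_zero : ∀ p ∈ domain, r p ≠ 0
  extends_chart :
    ∃ Ψ : PartialDiffeomorph 𝓘(ℝ, Fin 2 → ℝ) 𝓘(ℝ, Fin 2 → ℝ) (Fin 2 → ℝ) (Fin 2 → ℝ) ∞,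
      Ψ.source.Nonempty ∧ Ψ.source ⊆ domain ∧
      ∀ p ∈ Ψ.source, Ψ p 1 = r p ∧ gSTProfile n α M Λ (r p) ≠ 0 ∧
        ∀ i j, metric p i j = ∑ a, ∑ b,
          schwarzschildMatrix (gSTProfile n α M Λ) (r p) a b *
            partialD i (fun q => Ψ q a) p * partialD j (fun q => Ψ q b) p

namespace GSTBaseDomain

variable {n : ℕ} {α M Λ : ℝ}

/-- `(∇r)²` on the domain. -/
def gradSq (E : GSTBaseDomain n α M Λ) (p : Fin 2 → ℝ) : ℝ :=
  ∑ i, ∑ j, (E.metric p)⁻¹ i j * partialD i E.r p * partialD j E.r p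

/-- Generic points: `(∇r)² ≠ 0`. -/
def IsGeneric (E : GSTBaseDomain n α M Λ) (p : Fin 2 → ℝ) : Prop := E.gradSq p ≠ 0

/-- Horizon points: `∇r ≠ 0` is null. -/
def IsHorizon (E : GSTBaseDomain n α M Λ) (p : Fin 2 → ℝ) : Prop :=
  fderiv ℝ E.r p ≠ 0 ∧ E.gradSq p = 0

/-- Horizon bifurcation points: `∇r = 0`. -/
def IsBifurcation (E : GSTBaseDomain n α M Λ) (p : Fin 2 → ℝ) : Prop := fderiv ℝ E.r p = 0

/-- The surface `(B, g)` with the function `r` is locally isometric at `x` to the domain `E` at `p`,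
by an isometry that takes `r` to the warping function of `E`. -/
def LocallyIsometricAt {B : Type*} [TopologicalSpace B] [ChartedSpace (Fin 2 → ℝ) B]
    (g : PseudoRiemannianMetric (Fin 2) B) (r : B → ℝ) (x : B)
    (E : GSTBaseDomain n α M Λ) (p : Fin 2 → ℝ) : Prop :=
  ∃ χ : LocalCoords (Fin 2) B, x ∈ χ.source ∧ χ x = p ∧ χ.target ⊆ E.domain ∧
    (∀ q ∈ χ.target, g.components χ q = E.metric q) ∧ ∀ q ∈ χ.source, E.r (χ q) = r q

end GSTBaseDomain

end

/-!
# Birkhoff's theorem for vacuum warped products with a two-dimensional base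

The argument is local, so it takes place in coordinates: a chart of the base and a chart of the
fibre give product coordinates in which the metric is the block matrix `warp G ρ H`
(`IsWarpedProductVia.exists_coords`), whose curvature is computed from that of `G` and `H` and
from the Hessian of `ρ`.

**The equations on the base.** The fibre part of `Ric = 2Λ/m g` says that the Ricci tensor of `H`
is a function on the base times `H`; that function is therefore a constant, called `(m - 1) α`.
The base part, together with the fact that the Ricci tensor of a surface is proportional to its
metric, says that `∇∇ρ = φ G` for some function `φ`. Then `d(∇ρ)² = 2φ dρ`, and the fibre equation
can be integrated: `(∇ρ)² = f(ρ)` and `∇∇ρ = ½ f'(ρ) G`, where `f` is the profile and `M` is the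
constant of integration (`IsWarpVacuum.exists_profile`). These two equations (`IsBirkhoffBase`)
are all that is used in deriving the normal forms.

**Regular points of `r`.** Let `G = L K + K L` with null covectors `L`, `K`, and `dρ = a L + b K`.
If `b ≠ 0`, the equation `∇∇ρ = ½ f' G` makes the form `L / b` closed, so it is `dv` for some `v`,
and `f = (∇ρ)² = 2ab` gives `G = -f dv² + 2 dv dρ` (`IsBirkhoffBase.exists_eddington`). Where
`f ≠ 0`, `t = v - ∫ dρ / f` gives the static form.

**Critical points of `r`.** There `f = 0`. If also `f' = 0`, then `dρ` and `ρ - r₀` satisfy a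
linear homogeneous differential inequality and vanish identically
(`IsBirkhoffBase.eventually_eq_of_deriv_eq_zero`), against the hypothesis. If `f' = 2κ ≠ 0`, write
`f = (r - r₀) E(r)` and `E = 2κ + (r - r₀) D(r)`. The frame components of `dρ` give functions `X`,
`Y` with `ρ = r₀ + X Y` and `G = (2 dX dY - κ⁻¹ Y² D(ρ) dX²) / κ`
(`IsBirkhoffBase.exists_israel`). Since `h' = -D / E`, the substitution `V = X`, `U = Y e^h / r₀`
gives the Kruskal form (`IsIsraelOn.kruskal`).

**The mass.** If `M = 0`, the base has the constant curvature `2Λ/(m(m+1))`, and the warping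
function is that of a space form with fibres of curvature `α`. An Einstein fibre of dimension at
most three, or of constant curvature, has curvature `α`, so that the whole metric would be of
constant curvature (`IsWarpedProductVia.locallyConstantCurvatureAt`).

**The analytic extension.** In the static, Eddington-Finkelstein and Israel forms the metric and
`ρ` are analytic, and near each point there are points with `f ≠ 0`, where `t` identifies the
metric with a part of the static chart (`exists_gSTBaseDomain`). At a bifurcation point the Israel
coordinates serve, with `v = log |X| / κ`. The sign of `M'` is the one that the convention for
`r < 0` requires.
-/

noncomputable section

set_option linter.unusedSectionVars false

/-! ### Partial derivatives -/

section PartialDerivatives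

variable {ι : Type*} [Fintype ι] [DecidableEq ι] {F H : (ι → ℝ) → ℝ} {p : ι → ℝ} {U : Set (ι → ℝ)}

theorem partialD_congr (i : ι) (h : F =ᶠ[𝓝 p] H) : partialD i F p = partialD i H p := by
  simp only [partialD, h.fderiv_eq]

theorem partialD_congr_of_eqOn (i : ι) (hU : IsOpen U) (h : EqOn F H U) (hp : p ∈ U) :
    partialD i F p = partialD i H p :=
  partialD_congr i (h.eventuallyEq_of_mem (hU.mem_nhds hp))

theorem partialD_const (i : ι) (c : ℝ) : partialD i (fun _ => c) p = 0 := by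
  simp [partialD]

theorem partialD_add (i : ι) (hF : DifferentiableAt ℝ F p) (hH : DifferentiableAt ℝ H p) :
    partialD i (fun q => F q + H q) p = partialD i F p + partialD i H p := by
  simp only [partialD]
  rw [fderiv_fun_add hF hH]
  rfl

theorem partialD_sub (i : ι) (hF : DifferentiableAt ℝ F p) (hH : DifferentiableAt ℝ H p) :
    partialD i (fun q => F q - H q) p = partialD i F p - partialD i H p := by
  simp only [partialD]
  rw [fderiv_fun_sub hF hH]
  rfl

theorem partialD_mul (i : ι) (hF : DifferentiableAt ℝ F p) (hH : DifferentiableAt ℝ H p) :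
    partialD i (fun q => F q * H q) p = partialD i F p * H p + F p * partialD i H p := by
  simp only [partialD]
  rw [fderiv_fun_mul hF hH]
  simp
  ring

theorem partialD_const_mul (i : ι) (c : ℝ) (hF : DifferentiableAt ℝ F p) :
    partialD i (fun q => c * F q) p = c * partialD i F p := by
  rw [partialD_mul i (differentiableAt_const c) hF, partialD_const]
  ring

theorem partialD_sum {σ : Type*} (s : Finset σ) (i : ι) {F : σ → (ι → ℝ) → ℝ}
    (hF : ∀ a ∈ s, DifferentiableAt ℝ (F a) p) :
    partialD i (fun q => ∑ a ∈ s, F a q) p = ∑ a ∈ s, partialD i (F a) p := by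
  simp only [partialD]
  rw [fderiv_fun_sum hF]
  simp

theorem partialD_comp (i : ι) {f : ℝ → ℝ} (hf : DifferentiableAt ℝ f (F p))
    (hF : DifferentiableAt ℝ F p) :
    partialD i (fun q => f (F q)) p = deriv f (F p) * partialD i F p := by
  have := (hf.hasDerivAt.comp_hasFDerivAt p hF.hasFDerivAt).fderiv
  simp only [partialD]
  rw [show (fun q => f (F q)) = f ∘ F from rfl, this]
  simp

theorem partialD_proj (i j : ι) : partialD i (fun q : ι → ℝ => q j) p = if i = j then 1 else 0 := by
  simp only [partialD]
  rw [(hasFDerivAt_apply j p).fderiv]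
  simp [Pi.single_apply, eq_comm]

theorem fderiv_apply_eq_sum_partialD (F : (ι → ℝ) → ℝ) (p v : ι → ℝ) :
    fderiv ℝ F p v = ∑ i, v i * partialD i F p := by
  conv_lhs => rw [← Finset.univ_sum_single v, map_sum]
  refine Finset.sum_congr rfl fun i _ => ?_
  rw [partialD, ← smul_eq_mul, ← map_smul, ← Pi.single_smul]
  simp

theorem fderiv_eq_zero_iff_partialD : fderiv ℝ F p = 0 ↔ ∀ i, partialD i F p = 0 := by
  constructor
  · intro h i
    simp [partialD, h]
  · intro h
    ext v
    simp [fderiv_apply_eq_sum_partialD, h]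

theorem ContDiffOn.differentiableAt_of_isOpen (hF : ContDiffOn ℝ ∞ F U) (hU : IsOpen U)
    (hp : p ∈ U) : DifferentiableAt ℝ F p :=
  (hF.contDiffAt (hU.mem_nhds hp)).differentiableAt (by simp)

theorem ContDiffOn.partialD (i : ι) (hF : ContDiffOn ℝ ∞ F U) (hU : IsOpen U) :
    ContDiffOn ℝ ∞ (partialD i F) U := by
  have : ContDiffOn ℝ ∞ (fderiv ℝ F) U := hF.fderiv_of_isOpen hU (by simp)
  exact this.clm_apply contDiffOn_const

theorem partialD_comm (i j : ι) (hF : ContDiffOn ℝ ∞ F U) (hU : IsOpen U) (hp : p ∈ U) :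
    partialD i (partialD j F) p = partialD j (partialD i F) p := by
  have h1 : ContDiffAt ℝ ∞ F p := hF.contDiffAt (hU.mem_nhds hp)
  have hs : IsSymmSndFDerivAt ℝ F p := h1.isSymmSndFDerivAt (by
    simp [minSmoothness_of_isRCLikeNormedField]
    exact WithTop.coe_le_coe.2 le_top)
  have hd : DifferentiableAt ℝ (fderiv ℝ F) p :=
    (h1.fderiv_right (m := ∞) (by simp)).differentiableAt (by simp)
  have key : ∀ i j : ι, partialD i (partialD j F) p
      = fderiv ℝ (fderiv ℝ F) p (Pi.single i 1) (Pi.single j 1) := by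
    intro i j
    change fderiv ℝ (fun q => fderiv ℝ F q (Pi.single j 1)) p (Pi.single i 1) = _
    rw [fderiv_clm_apply hd (differentiableAt_const _)]
    simp
  rw [key, key]
  exact hs _ _

end PartialDerivatives

/-! ### Curvature of a metric in coordinates -/

section CoordinateCurvature

variable {ι : Type*} [Fintype ι] [DecidableEq ι]

/-- The components `G` define a smooth pseudo-Riemannian metric on the open set `U`. -/
structure IsMetricOn (G : (ι → ℝ) → Matrix ι ι ℝ) (U : Set (ι → ℝ)) : Prop where
  isOpen : IsOpen U
  smooth : ∀ i j, ContDiffOn ℝ ∞ (fun p => G p i j) U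
  symm : ∀ p ∈ U, ∀ i j, G p i j = G p j i
  det_ne_zero : ∀ p ∈ U, (G p).det ≠ 0

/-- Christoffel symbols of the first kind, `Γ_{lij} = g_{lk} Γ^k_{ij}`. -/
def christoffelDown (G : (ι → ℝ) → Matrix ι ι ℝ) (l i j : ι) (p : ι → ℝ) : ℝ :=
  1 / 2 * (partialD i (fun q => G q l j) p + partialD j (fun q => G q l i) p
      - partialD l (fun q => G q i j) p)

/-- The Hessian `∇_i ∂_j ρ` of a function, in coordinates. -/
def hessian (G : (ι → ℝ) → Matrix ι ι ℝ) (ρ : (ι → ℝ) → ℝ) (i j : ι) (p : ι → ℝ) : ℝ :=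
  partialD i (partialD j ρ) p - ∑ k, christoffel G k i j p * partialD k ρ p

/-- The components `ρ^k` of the gradient of a function, in coordinates. -/
def gradUp (G : (ι → ℝ) → Matrix ι ι ℝ) (ρ : (ι → ℝ) → ℝ) (k : ι) (p : ι → ℝ) : ℝ :=
  ∑ l, (G p)⁻¹ k l * partialD l ρ p

/-- The squared norm `(∇ρ)²` of the gradient of a function, in coordinates. -/
def gradNormSq (G : (ι → ℝ) → Matrix ι ι ℝ) (ρ : (ι → ℝ) → ℝ) (p : ι → ℝ) : ℝ :=
  ∑ i, partialD i ρ p * gradUp G ρ i p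

/-- The covariant derivative `∇_j ρ^k` of the gradient of a function, in coordinates. -/
def hessianUp (G : (ι → ℝ) → Matrix ι ι ℝ) (ρ : (ι → ℝ) → ℝ) (j k : ι) (p : ι → ℝ) : ℝ :=
  partialD j (gradUp G ρ k) p + ∑ s, christoffel G k j s p * gradUp G ρ s p

theorem contDiffOn_det {σ : Type*} [Fintype σ] [DecidableEq σ] {A : (ι → ℝ) → Matrix σ σ ℝ}
    {U : Set (ι → ℝ)} (hA : ∀ i j, ContDiffOn ℝ ∞ (fun p => A p i j) U) :
    ContDiffOn ℝ ∞ (fun p => (A p).det) U := by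
  simp only [Matrix.det_apply]
  refine ContDiffOn.sum fun s _ => ?_
  refine ContDiffOn.const_smul _ ?_
  exact contDiffOn_prod fun i _ => hA _ _

namespace IsMetricOn

variable {G : (ι → ℝ) → Matrix ι ι ℝ} {U : Set (ι → ℝ)} {p : ι → ℝ}

theorem mono (h : IsMetricOn G U) {V : Set (ι → ℝ)} (hV : IsOpen V) (hVU : V ⊆ U) :
    IsMetricOn G V :=
  ⟨hV, fun i j => (h.smooth i j).mono hVU, fun p hp => h.symm p (hVU hp),
    fun p hp => h.det_ne_zero p (hVU hp)⟩

theorem smooth_inv (h : IsMetricOn G U) (i j : ι) : ContDiffOn ℝ ∞ (fun p => (G p)⁻¹ i j) U := by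
  have h1 : ContDiffOn ℝ ∞ (fun p => (G p).det) U := contDiffOn_det h.smooth
  have h2 : ContDiffOn ℝ ∞ (fun p => (G p).adjugate i j) U := by
    simp only [Matrix.adjugate_apply]
    refine contDiffOn_det fun k l => ?_
    by_cases hk : k = j
    · subst hk
      simpa using contDiffOn_const
    · simpa [Matrix.updateRow_apply, hk] using h.smooth k l
  refine ((h1.inv h.det_ne_zero).mul h2).congr fun p hp => ?_
  simp [Matrix.inv_def]

theorem smooth_christoffelDown (h : IsMetricOn G U) (l i j : ι) :
    ContDiffOn ℝ ∞ (christoffelDown G l i j) U :=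
  contDiffOn_const.mul ((((h.smooth l j).partialD i h.isOpen).add
    ((h.smooth l i).partialD j h.isOpen)).sub ((h.smooth i j).partialD l h.isOpen))

theorem _root_.christoffel_eq (G : (ι → ℝ) → Matrix ι ι ℝ) (k i j : ι) (p : ι → ℝ) :
    christoffel G k i j p = ∑ l, (G p)⁻¹ k l * christoffelDown G l i j p := by
  simp only [christoffel, christoffelDown, Finset.mul_sum]
  exact Finset.sum_congr rfl fun l _ => by ring

theorem smooth_christoffel (h : IsMetricOn G U) (k i j : ι) :
    ContDiffOn ℝ ∞ (christoffel G k i j) U := by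
  simp only [funext (christoffel_eq G k i j)]
  exact ContDiffOn.sum fun l _ => (h.smooth_inv k l).mul (h.smooth_christoffelDown l i j)

theorem smooth_gradUp (h : IsMetricOn G U) {ρ : (ι → ℝ) → ℝ} (hρ : ContDiffOn ℝ ∞ ρ U) (k : ι) :
    ContDiffOn ℝ ∞ (gradUp G ρ k) U :=
  ContDiffOn.sum fun l _ => (h.smooth_inv k l).mul (hρ.partialD l h.isOpen)

theorem sum_mul_inv (h : IsMetricOn G U) (hp : p ∈ U) (i j : ι) :
    ∑ k, G p i k * (G p)⁻¹ k j = if i = j then 1 else 0 := by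
  have := congrFun (congrFun (Matrix.mul_nonsing_inv (G p) (h.det_ne_zero p hp).isUnit) i) j
  rwa [Matrix.mul_apply, Matrix.one_apply] at this

theorem sum_inv_mul (h : IsMetricOn G U) (hp : p ∈ U) (i j : ι) :
    ∑ k, (G p)⁻¹ i k * G p k j = if i = j then 1 else 0 := by
  have := congrFun (congrFun (Matrix.nonsing_inv_mul (G p) (h.det_ne_zero p hp).isUnit) i) j
  rwa [Matrix.mul_apply, Matrix.one_apply] at this

theorem inv_symm (h : IsMetricOn G U) (hp : p ∈ U) (i j : ι) : (G p)⁻¹ i j = (G p)⁻¹ j i := by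
  have h1 : (G p).transpose = G p := Matrix.ext fun i j => h.symm p hp j i
  have := Matrix.transpose_nonsing_inv (G p)
  rw [h1] at this
  exact congrFun (congrFun this j) i

/-- Lowering an index that was raised. -/
theorem sum_lower_raise (h : IsMetricOn G U) (hp : p ∈ U) (X : ι → ℝ) (k : ι) :
    ∑ s, G p k s * ∑ l, (G p)⁻¹ s l * X l = X k := by
  simp only [Finset.mul_sum, ← mul_assoc]
  rw [Finset.sum_comm]
  simp only [← Finset.sum_mul, h.sum_mul_inv hp]
  simp

/-- Raising an index that was lowered. -/
theorem sum_raise_lower (h : IsMetricOn G U) (hp : p ∈ U) (X : ι → ℝ) (k : ι) :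
    ∑ s, (G p)⁻¹ k s * ∑ l, G p s l * X l = X k := by
  simp only [Finset.mul_sum, ← mul_assoc]
  rw [Finset.sum_comm]
  simp only [← Finset.sum_mul, h.sum_inv_mul hp]
  simp

theorem eq_of_lower_eq (h : IsMetricOn G U) (hp : p ∈ U) {X Y : ι → ℝ}
    (hXY : ∀ k, ∑ s, G p k s * X s = ∑ s, G p k s * Y s) (k : ι) : X k = Y k := by
  rw [← h.sum_raise_lower hp X, ← h.sum_raise_lower hp Y]
  simp only [hXY]

theorem sum_lower_christoffel (h : IsMetricOn G U) (hp : p ∈ U) (k i j : ι) :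
    ∑ s, G p k s * christoffel G s i j p = christoffelDown G k i j p := by
  simp only [christoffel_eq]
  exact h.sum_lower_raise hp _ k

theorem partialD_symm (h : IsMetricOn G U) (hp : p ∈ U) (i j k : ι) :
    partialD i (fun q => G q j k) p = partialD i (fun q => G q k j) p :=
  partialD_congr_of_eqOn i h.isOpen (fun q hq => h.symm q hq j k) hp

theorem christoffelDown_symm (h : IsMetricOn G U) (hp : p ∈ U) (l i j : ι) :
    christoffelDown G l i j p = christoffelDown G l j i p := by
  simp only [christoffelDown]
  rw [h.partialD_symm hp l i j]
  ring

theorem christoffel_symm (h : IsMetricOn G U) (hp : p ∈ U) (l i j : ι) :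
    christoffel G l i j p = christoffel G l j i p := by
  simp only [christoffel_eq, fun l => h.christoffelDown_symm hp l i j]

/-- The metric is parallel. -/
theorem partialD_metric (h : IsMetricOn G U) (hp : p ∈ U) (i k l : ι) :
    partialD i (fun q => G q k l) p = christoffelDown G k i l p + christoffelDown G l i k p := by
  simp only [christoffelDown]
  rw [h.partialD_symm hp i l k, h.partialD_symm hp l i k, h.partialD_symm hp k i l]
  ring

theorem sum_christoffelDown_mul_symm (h : IsMetricOn G U) (hp : p ∈ U) (i k j l : ι) :
    ∑ s, christoffelDown G s i k p * christoffel G s j l p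
      = ∑ s, christoffelDown G s j l p * christoffel G s i k p := by
  simp only [christoffel_eq, Finset.mul_sum]
  rw [Finset.sum_comm]
  refine Finset.sum_congr rfl fun s _ => Finset.sum_congr rfl fun t _ => ?_
  rw [h.inv_symm hp s t]
  ring

theorem sum_lower_partialD_christoffel (h : IsMetricOn G U) (hp : p ∈ U) (k i j l : ι) :
    ∑ s, G p k s * partialD i (christoffel G s j l) p
      = partialD i (christoffelDown G k j l) p
        - ∑ s, (christoffelDown G k i s p + christoffelDown G s i k p) * christoffel G s j l p := by
  have hd : ∀ s, DifferentiableAt ℝ (fun q => G q k s) p :=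
    fun s => (h.smooth k s).differentiableAt_of_isOpen h.isOpen hp
  have hd' : ∀ s, DifferentiableAt ℝ (christoffel G s j l) p :=
    fun s => (h.smooth_christoffel s j l).differentiableAt_of_isOpen h.isOpen hp
  rw [← partialD_congr_of_eqOn i h.isOpen (fun q hq => h.sum_lower_christoffel hq k j l) hp,
    partialD_sum (F := fun s q => G q k s * christoffel G s j l q) _ _
      fun s _ => (hd s).fun_mul (hd' s)]
  simp only [fun s => partialD_mul i (hd s) (hd' s), h.partialD_metric hp, Finset.sum_add_distrib]
  ring

/-- The curvature tensor in terms of Christoffel symbols of the first kind, from which its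
symmetries can be read off. -/
theorem riemannDown_eq (h : IsMetricOn G U) (hp : p ∈ U) (k l i j : ι) :
    riemannDown G k l i j p = partialD i (christoffelDown G k j l) p
      - partialD j (christoffelDown G k i l) p
      - ∑ s, christoffelDown G s i k p * christoffel G s j l p
      + ∑ s, christoffelDown G s j k p * christoffel G s i l p := by
  have hL : ∀ a b c : ι, ∑ s, G p k s * ∑ t, christoffel G s a t p * christoffel G t b c p
      = ∑ t, christoffelDown G k a t p * christoffel G t b c p := by
    intro a b c
    simp only [Finset.mul_sum, ← mul_assoc]
    rw [Finset.sum_comm]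
    simp only [← Finset.sum_mul, h.sum_lower_christoffel hp]
  simp only [riemannDown, riemannUp, mul_add, mul_sub, Finset.sum_add_distrib,
    Finset.sum_sub_distrib, hL, h.sum_lower_partialD_christoffel hp, add_mul]
  ring

theorem partialD_christoffelDown (h : IsMetricOn G U) (hp : p ∈ U) (m l i j : ι) :
    partialD m (christoffelDown G l i j) p
      = 1 / 2 * (partialD m (partialD i fun q => G q l j) p
        + partialD m (partialD j fun q => G q l i) p
        - partialD m (partialD l fun q => G q i j) p) := by
  have hd : ∀ a b c, DifferentiableAt ℝ (partialD a fun q => G q b c) p := fun a b c =>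
    ((h.smooth b c).partialD a h.isOpen).differentiableAt_of_isOpen h.isOpen hp
  unfold christoffelDown
  rw [partialD_const_mul m _ (((hd _ _ _).fun_add (hd _ _ _)).fun_sub (hd _ _ _)),
    partialD_sub m ((hd _ _ _).fun_add (hd _ _ _)) (hd _ _ _),
    partialD_add m (hd _ _ _) (hd _ _ _)]

theorem partialD_partialD_symm (h : IsMetricOn G U) (hp : p ∈ U) (i j k l : ι) :
    partialD i (partialD j fun q => G q k l) p = partialD i (partialD j fun q => G q l k) p :=
  partialD_congr_of_eqOn i h.isOpen (fun _ hq => h.partialD_symm hq j k l) hp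

theorem riemannDown_antisymm_right (G : (ι → ℝ) → Matrix ι ι ℝ) (p : ι → ℝ) (k l i j : ι) :
    riemannDown G k l i j p = -riemannDown G k l j i p := by
  simp only [riemannDown, riemannUp, ← Finset.sum_neg_distrib, Finset.sum_sub_distrib]
  exact Finset.sum_congr rfl fun s _ => by ring

theorem riemannDown_antisymm_left (h : IsMetricOn G U) (hp : p ∈ U) (k l i j : ι) :
    riemannDown G k l i j p = -riemannDown G l k i j p := by
  rw [h.riemannDown_eq hp, h.riemannDown_eq hp, h.sum_christoffelDown_mul_symm hp i l j k,
    h.sum_christoffelDown_mul_symm hp j l i k]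
  simp only [h.partialD_christoffelDown hp]
  rw [partialD_comm i j (h.smooth k l) h.isOpen hp, partialD_comm i j (h.smooth l k) h.isOpen hp,
    h.partialD_partialD_symm hp j i k l, h.partialD_partialD_symm hp i l k j,
    h.partialD_partialD_symm hp i k l j, h.partialD_partialD_symm hp j l i k,
    h.partialD_partialD_symm hp j k i l]
  ring

theorem riemannDown_pair_symm (h : IsMetricOn G U) (hp : p ∈ U) (k l i j : ι) :
    riemannDown G k l i j p = riemannDown G i j k l p := by
  have hc : ∀ a b c d, partialD a (partialD b fun q => G q c d) p
      = partialD b (partialD a fun q => G q c d) p :=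
    fun a b c d => partialD_comm a b (h.smooth c d) h.isOpen hp
  have hs := h.partialD_partialD_symm hp
  rw [h.riemannDown_eq hp, h.riemannDown_eq hp, h.sum_christoffelDown_mul_symm hp l i k j]
  simp only [h.partialD_christoffelDown hp, fun s => h.christoffelDown_symm hp s k i,
    fun s => h.christoffelDown_symm hp s k j, fun s => h.christoffel_symm hp s l j,
    fun s => h.christoffel_symm hp s l i]
  rw [hc i j k l, hs i l k j, hs i k j l, hs j l k i, hc k l i j, hc i l j k, hc k j i l,
    hs l i k j, hc l j i k, hc i k l j]
  ring

theorem sum_lower_gradUp (h : IsMetricOn G U) (hp : p ∈ U) (ρ : (ι → ℝ) → ℝ) (k : ι) :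
    ∑ s, G p k s * gradUp G ρ s p = partialD k ρ p :=
  h.sum_lower_raise hp _ k

theorem hessian_eq (h : IsMetricOn G U) (hp : p ∈ U) (ρ : (ι → ℝ) → ℝ) (i j : ι) :
    hessian G ρ i j p = partialD i (partialD j ρ) p
      - ∑ s, christoffelDown G s i j p * gradUp G ρ s p := by
  rw [hessian]
  congr 1
  simp only [christoffel_eq, gradUp, Finset.sum_mul, Finset.mul_sum]
  rw [Finset.sum_comm]
  refine Finset.sum_congr rfl fun s _ => Finset.sum_congr rfl fun t _ => ?_
  rw [h.inv_symm hp s t]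
  ring

theorem sum_lower_hessianUp (h : IsMetricOn G U) (hp : p ∈ U) {ρ : (ι → ℝ) → ℝ}
    (hρ : ContDiffOn ℝ ∞ ρ U) (j k : ι) :
    ∑ s, G p k s * hessianUp G ρ j s p = hessian G ρ j k p := by
  have hd : ∀ s, DifferentiableAt ℝ (fun q => G q k s) p :=
    fun s => (h.smooth k s).differentiableAt_of_isOpen h.isOpen hp
  have hd' : ∀ s, DifferentiableAt ℝ (gradUp G ρ s) p :=
    fun s => (h.smooth_gradUp hρ s).differentiableAt_of_isOpen h.isOpen hp
  have h1 : ∑ s, G p k s * ∑ t, christoffel G s j t p * gradUp G ρ t p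
      = ∑ t, christoffelDown G k j t p * gradUp G ρ t p := by
    simp only [Finset.mul_sum, ← mul_assoc]
    rw [Finset.sum_comm]
    simp only [← Finset.sum_mul, h.sum_lower_christoffel hp]
  rw [h.hessian_eq hp,
    ← partialD_congr_of_eqOn j h.isOpen (fun q hq => h.sum_lower_gradUp hq ρ k) hp,
    partialD_sum (F := fun s q => G q k s * gradUp G ρ s q) _ _
      fun s _ => (hd s).fun_mul (hd' s)]
  simp only [hessianUp, fun s => partialD_mul j (hd s) (hd' s), h.partialD_metric hp, mul_add,
    Finset.sum_add_distrib, h1, add_mul]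
  ring

/-- If the Hessian is a multiple of the metric, so is the derivative of the gradient. -/
theorem hessianUp_of_hessian (h : IsMetricOn G U) (hp : p ∈ U) {ρ : (ι → ℝ) → ℝ}
    (hρ : ContDiffOn ℝ ∞ ρ U) {φ : ℝ} (hφ : ∀ i j, hessian G ρ i j p = φ * G p i j) (j k : ι) :
    hessianUp G ρ j k p = if j = k then φ else 0 := by
  refine h.eq_of_lower_eq hp (X := fun k => hessianUp G ρ j k p)
    (Y := fun k => if j = k then φ else 0) (fun k => ?_) k
  rw [h.sum_lower_hessianUp hp hρ, hφ]
  simp [h.symm p hp j k, mul_comm]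

end IsMetricOn

end CoordinateCurvature

/-! ### Curvature of a warped product in coordinates -/

section WarpedCurvature

variable {ι κ : Type*} [Fintype ι] [DecidableEq ι] [Fintype κ] [DecidableEq κ]

/-- The components of the warped product metric `G + ρ² H` in product coordinates. -/
def warp (G : (ι → ℝ) → Matrix ι ι ℝ) (ρ : (ι → ℝ) → ℝ) (H : (κ → ℝ) → Matrix κ κ ℝ)
    (q : ι ⊕ κ → ℝ) : Matrix (ι ⊕ κ) (ι ⊕ κ) ℝ :=
  Matrix.fromBlocks (G (q ∘ Sum.inl)) 0 0 (ρ (q ∘ Sum.inl) ^ 2 • H (q ∘ Sum.inr))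

/-- The product of subsets of two coordinate spaces. -/
def sumSet (U : Set (ι → ℝ)) (V : Set (κ → ℝ)) : Set (ι ⊕ κ → ℝ) :=
  {q | q ∘ Sum.inl ∈ U ∧ q ∘ Sum.inr ∈ V}

theorem continuous_comp_inl : Continuous fun q : ι ⊕ κ → ℝ => q ∘ Sum.inl :=
  continuous_pi fun i => continuous_apply (Sum.inl i)

theorem continuous_comp_inr : Continuous fun q : ι ⊕ κ → ℝ => q ∘ Sum.inr :=
  continuous_pi fun i => continuous_apply (Sum.inr i)

theorem isOpen_sumSet {U : Set (ι → ℝ)} {V : Set (κ → ℝ)} (hU : IsOpen U) (hV : IsOpen V) :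
    IsOpen (sumSet U V) :=
  (hU.preimage continuous_comp_inl).inter (hV.preimage continuous_comp_inr)

theorem contDiff_comp_inl : ContDiff ℝ ∞ fun q : ι ⊕ κ → ℝ => q ∘ Sum.inl :=
  contDiff_pi.2 fun i => contDiff_apply ℝ ℝ (Sum.inl i)

theorem contDiff_comp_inr : ContDiff ℝ ∞ fun q : ι ⊕ κ → ℝ => q ∘ Sum.inr :=
  contDiff_pi.2 fun i => contDiff_apply ℝ ℝ (Sum.inr i)

section PartialD

variable {F : (ι → ℝ) → ℝ} {F' : (κ → ℝ) → ℝ} {q : ι ⊕ κ → ℝ}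

theorem hasFDerivAt_comp_inl (hF : DifferentiableAt ℝ F (q ∘ Sum.inl)) :
    HasFDerivAt (fun q : ι ⊕ κ → ℝ => F (q ∘ Sum.inl))
      ((fderiv ℝ F (q ∘ Sum.inl)).comp
        (ContinuousLinearMap.pi fun i => ContinuousLinearMap.proj (Sum.inl i))) q :=
  HasFDerivAt.comp q hF.hasFDerivAt
    (hasFDerivAt_pi.2 fun i => hasFDerivAt_apply (𝕜 := ℝ) (Sum.inl i) q)

theorem hasFDerivAt_comp_inr (hF : DifferentiableAt ℝ F' (q ∘ Sum.inr)) :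
    HasFDerivAt (fun q : ι ⊕ κ → ℝ => F' (q ∘ Sum.inr))
      ((fderiv ℝ F' (q ∘ Sum.inr)).comp
        (ContinuousLinearMap.pi fun i => ContinuousLinearMap.proj (Sum.inr i))) q :=
  HasFDerivAt.comp q hF.hasFDerivAt
    (hasFDerivAt_pi.2 fun i => hasFDerivAt_apply (𝕜 := ℝ) (Sum.inr i) q)

theorem partialD_inl_comp_inl (i : ι) (hF : DifferentiableAt ℝ F (q ∘ Sum.inl)) :
    partialD (Sum.inl i) (fun q : ι ⊕ κ → ℝ => F (q ∘ Sum.inl)) q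
      = partialD i F (q ∘ Sum.inl) := by
  simp only [partialD, (hasFDerivAt_comp_inl hF).fderiv, ContinuousLinearMap.comp_apply]
  congr 1
  ext j
  simp [Pi.single_apply]

theorem partialD_inr_comp_inl (i : κ) (hF : DifferentiableAt ℝ F (q ∘ Sum.inl)) :
    partialD (Sum.inr i) (fun q : ι ⊕ κ → ℝ => F (q ∘ Sum.inl)) q = 0 := by
  simp only [partialD, (hasFDerivAt_comp_inl hF).fderiv, ContinuousLinearMap.comp_apply]
  convert map_zero (fderiv ℝ F (q ∘ Sum.inl))
  ext j
  simp

theorem partialD_inr_comp_inr (i : κ) (hF : DifferentiableAt ℝ F' (q ∘ Sum.inr)) :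
    partialD (Sum.inr i) (fun q : ι ⊕ κ → ℝ => F' (q ∘ Sum.inr)) q
      = partialD i F' (q ∘ Sum.inr) := by
  simp only [partialD, (hasFDerivAt_comp_inr hF).fderiv, ContinuousLinearMap.comp_apply]
  congr 1
  ext j
  simp [Pi.single_apply]

theorem partialD_inl_comp_inr (i : ι) (hF : DifferentiableAt ℝ F' (q ∘ Sum.inr)) :
    partialD (Sum.inl i) (fun q : ι ⊕ κ → ℝ => F' (q ∘ Sum.inr)) q = 0 := by
  simp only [partialD, (hasFDerivAt_comp_inr hF).fderiv, ContinuousLinearMap.comp_apply]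
  convert map_zero (fderiv ℝ F' (q ∘ Sum.inr))
  ext j
  simp

theorem partialD_inl_mul (i : ι) (hF : DifferentiableAt ℝ F (q ∘ Sum.inl))
    (hF' : DifferentiableAt ℝ F' (q ∘ Sum.inr)) :
    partialD (Sum.inl i) (fun q : ι ⊕ κ → ℝ => F (q ∘ Sum.inl) * F' (q ∘ Sum.inr)) q
      = partialD i F (q ∘ Sum.inl) * F' (q ∘ Sum.inr) := by
  rw [partialD_mul _ (hasFDerivAt_comp_inl hF).differentiableAt
    (hasFDerivAt_comp_inr hF').differentiableAt, partialD_inl_comp_inl i hF,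
    partialD_inl_comp_inr i hF']
  ring

theorem partialD_inr_mul (i : κ) (hF : DifferentiableAt ℝ F (q ∘ Sum.inl))
    (hF' : DifferentiableAt ℝ F' (q ∘ Sum.inr)) :
    partialD (Sum.inr i) (fun q : ι ⊕ κ → ℝ => F (q ∘ Sum.inl) * F' (q ∘ Sum.inr)) q
      = F (q ∘ Sum.inl) * partialD i F' (q ∘ Sum.inr) := by
  rw [partialD_mul _ (hasFDerivAt_comp_inl hF).differentiableAt
    (hasFDerivAt_comp_inr hF').differentiableAt, partialD_inr_comp_inl i hF,
    partialD_inr_comp_inr i hF']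
  ring

end PartialD

variable {G : (ι → ℝ) → Matrix ι ι ℝ} {ρ : (ι → ℝ) → ℝ} {H : (κ → ℝ) → Matrix κ κ ℝ}
  {U : Set (ι → ℝ)} {V : Set (κ → ℝ)} {q : ι ⊕ κ → ℝ}

/-- The Christoffel symbols of a warped product. -/
def warpChristoffel (G : (ι → ℝ) → Matrix ι ι ℝ) (ρ : (ι → ℝ) → ℝ) (H : (κ → ℝ) → Matrix κ κ ℝ) :
    ι ⊕ κ → ι ⊕ κ → ι ⊕ κ → (ι ⊕ κ → ℝ) → ℝ
  | .inl k, .inl i, .inl j, q => christoffel G k i j (q ∘ Sum.inl)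
  | .inl _, .inl _, .inr _, _ => 0
  | .inl _, .inr _, .inl _, _ => 0
  | .inl k, .inr a, .inr b, q =>
      -(ρ (q ∘ Sum.inl) * gradUp G ρ k (q ∘ Sum.inl)) * H (q ∘ Sum.inr) a b
  | .inr _, .inl _, .inl _, _ => 0
  | .inr c, .inl i, .inr b, q =>
      if c = b then partialD i ρ (q ∘ Sum.inl) / ρ (q ∘ Sum.inl) else 0
  | .inr c, .inr a, .inl j, q =>
      if c = a then partialD j ρ (q ∘ Sum.inl) / ρ (q ∘ Sum.inl) else 0
  | .inr c, .inr a, .inr b, q => christoffel H c a b (q ∘ Sum.inr)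

/-- The hypotheses on the data of a warped product in coordinates. -/
structure IsWarpOn (G : (ι → ℝ) → Matrix ι ι ℝ) (ρ : (ι → ℝ) → ℝ) (H : (κ → ℝ) → Matrix κ κ ℝ)
    (U : Set (ι → ℝ)) (V : Set (κ → ℝ)) : Prop where
  base : IsMetricOn G U
  fiber : IsMetricOn H V
  smooth : ContDiffOn ℝ ∞ ρ U
  ne_zero : ∀ p ∈ U, ρ p ≠ 0

namespace IsWarpOn

theorem isMetricOn (h : IsWarpOn G ρ H U V) : IsMetricOn (warp G ρ H) (sumSet U V) where
  isOpen := isOpen_sumSet h.base.isOpen h.fiber.isOpen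
  smooth := by
    have hl : MapsTo (fun q : ι ⊕ κ → ℝ => q ∘ Sum.inl) (sumSet U V) U := fun q hq => hq.1
    have hr : MapsTo (fun q : ι ⊕ κ → ℝ => q ∘ Sum.inr) (sumSet U V) V := fun q hq => hq.2
    rintro (i | a) (j | b)
    · exact (h.base.smooth i j).comp contDiff_comp_inl.contDiffOn hl
    · exact contDiffOn_const
    · exact contDiffOn_const
    · exact ((h.smooth.comp contDiff_comp_inl.contDiffOn hl).pow 2).mul
        ((h.fiber.smooth a b).comp contDiff_comp_inr.contDiffOn hr)
  symm := by
    rintro q hq (i | a) (j | b)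
    · exact h.base.symm _ hq.1 i j
    · rfl
    · rfl
    · simp [warp, h.fiber.symm _ hq.2 a b]
  det_ne_zero := by
    intro q hq
    rw [warp, Matrix.det_fromBlocks_zero₂₁, Matrix.det_smul]
    exact mul_ne_zero (h.base.det_ne_zero _ hq.1)
      (mul_ne_zero (pow_ne_zero _ (pow_ne_zero _ (h.ne_zero _ hq.1))) (h.fiber.det_ne_zero _ hq.2))

theorem diff_base (h : IsWarpOn G ρ H U V) (hq : q ∈ sumSet U V) {F : (ι → ℝ) → ℝ}
    (hF : ContDiffOn ℝ ∞ F U) : DifferentiableAt ℝ F (q ∘ Sum.inl) :=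
  hF.differentiableAt_of_isOpen h.base.isOpen hq.1

theorem diff_fiber (h : IsWarpOn G ρ H U V) (hq : q ∈ sumSet U V) {F : (κ → ℝ) → ℝ}
    (hF : ContDiffOn ℝ ∞ F V) : DifferentiableAt ℝ F (q ∘ Sum.inr) :=
  hF.differentiableAt_of_isOpen h.fiber.isOpen hq.2

theorem partialD_sq (h : IsWarpOn G ρ H U V) (hq : q ∈ sumSet U V) (i : ι) :
    partialD i (fun p => ρ p ^ 2) (q ∘ Sum.inl)
      = 2 * ρ (q ∘ Sum.inl) * partialD i ρ (q ∘ Sum.inl) := by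
  simp only [pow_two]
  rw [partialD_mul i (h.diff_base hq h.smooth) (h.diff_base hq h.smooth)]
  ring

theorem christoffel_warp (h : IsWarpOn G ρ H U V) (hq : q ∈ sumSet U V) (k i j : ι ⊕ κ) :
    christoffel (warp G ρ H) k i j q = warpChristoffel G ρ H k i j q := by
  have hG : ∀ i j, DifferentiableAt ℝ (fun p => G p i j) (q ∘ Sum.inl) :=
    fun i j => h.diff_base hq (h.base.smooth i j)
  have hH : ∀ a b, DifferentiableAt ℝ (fun p => H p a b) (q ∘ Sum.inr) :=
    fun a b => h.diff_fiber hq (h.fiber.smooth a b)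
  have hρ : DifferentiableAt ℝ (fun p => ρ p ^ 2) (q ∘ Sum.inl) :=
    h.diff_base hq (h.smooth.pow 2)
  have hρ0 := h.ne_zero _ hq.1
  have e1 : ∀ i j, (fun q : ι ⊕ κ → ℝ => warp G ρ H q (Sum.inl i) (Sum.inl j))
      = fun q => (fun p => G p i j) (q ∘ Sum.inl) := fun i j => rfl
  have e2 : ∀ i b, (fun q : ι ⊕ κ → ℝ => warp G ρ H q (Sum.inl i) (Sum.inr b)) = fun q => 0 :=
    fun i j => rfl
  have e3 : ∀ i b, (fun q : ι ⊕ κ → ℝ => warp G ρ H q (Sum.inr b) (Sum.inl i)) = fun q => 0 :=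
    fun i j => rfl
  have e4 : ∀ a b, (fun q : ι ⊕ κ → ℝ => warp G ρ H q (Sum.inr a) (Sum.inr b))
      = fun q => (fun p => ρ p ^ 2) (q ∘ Sum.inl) * (fun p => H p a b) (q ∘ Sum.inr) :=
    fun i j => rfl
  refine h.isMetricOn.eq_of_lower_eq hq (X := fun k => christoffel (warp G ρ H) k i j q)
    (Y := fun k => warpChristoffel G ρ H k i j q) (fun k => ?_) k
  rw [h.isMetricOn.sum_lower_christoffel hq, Fintype.sum_sum_type]
  have w1 : ∀ i j, warp G ρ H q (Sum.inl i) (Sum.inl j) = G (q ∘ Sum.inl) i j := fun _ _ => rfl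
  have w2 : ∀ i j, warp G ρ H q (Sum.inl i) (Sum.inr j) = 0 := fun _ _ => rfl
  have w3 : ∀ i j, warp G ρ H q (Sum.inr i) (Sum.inl j) = 0 := fun _ _ => rfl
  have w4 : ∀ i j, warp G ρ H q (Sum.inr i) (Sum.inr j)
    = ρ (q ∘ Sum.inl) ^ 2 * H (q ∘ Sum.inr) i j := fun _ _ => rfl
  have key : ∀ k a b, ∑ s, G (q ∘ Sum.inl) k s
      * (-(ρ (q ∘ Sum.inl) * gradUp G ρ s (q ∘ Sum.inl)) * H (q ∘ Sum.inr) a b)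
      = -(ρ (q ∘ Sum.inl) * partialD k ρ (q ∘ Sum.inl)) * H (q ∘ Sum.inr) a b := by
    intro k a b
    rw [← h.base.sum_lower_gradUp hq.1 ρ k, Finset.mul_sum, ← Finset.sum_neg_distrib,
      Finset.sum_mul]
    exact Finset.sum_congr rfl fun s _ => by ring
  rcases k with k | k <;> rcases i with i | i <;> rcases j with j | j <;>
    simp only [christoffelDown, e1, e2, e3, e4, w1, w2, w3, w4, warpChristoffel, zero_mul,
      mul_zero, Finset.sum_const_zero, add_zero, zero_add, partialD_const, sub_zero, zero_sub,
      partialD_inl_comp_inl _ (hG _ _), partialD_inr_comp_inl _ (hG _ _),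
      partialD_inl_mul _ hρ (hH _ _), partialD_inr_mul _ hρ (hH _ _), h.partialD_sq hq,
      mul_ite, Finset.sum_ite_eq', Finset.mem_univ, if_true, key]
  · exact (h.base.sum_lower_christoffel hq.1 k i j).symm
  · ring
  · field_simp
  · field_simp
  · simp only [mul_assoc, ← Finset.mul_sum]
    rw [h.fiber.sum_lower_christoffel hq.2, christoffelDown]
    ring

theorem partialD_christoffel_warp (h : IsWarpOn G ρ H U V) (hq : q ∈ sumSet U V)
    (m k i j : ι ⊕ κ) :
    partialD m (christoffel (warp G ρ H) k i j) q = partialD m (warpChristoffel G ρ H k i j) q :=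
  partialD_congr_of_eqOn m h.isMetricOn.isOpen (fun _ hq => h.christoffel_warp hq k i j) hq

theorem riemannUp_warp (h : IsWarpOn G ρ H U V) (hq : q ∈ sumSet U V) (k l i j : ι ⊕ κ) :
    riemannUp (warp G ρ H) k l i j q =
      partialD i (warpChristoffel G ρ H k j l) q - partialD j (warpChristoffel G ρ H k i l) q
      + ((∑ s, (warpChristoffel G ρ H k i (.inl s) q * warpChristoffel G ρ H (.inl s) j l q
        - warpChristoffel G ρ H k j (.inl s) q * warpChristoffel G ρ H (.inl s) i l q))
        + ∑ s, (warpChristoffel G ρ H k i (.inr s) q * warpChristoffel G ρ H (.inr s) j l q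
        - warpChristoffel G ρ H k j (.inr s) q * warpChristoffel G ρ H (.inr s) i l q)) := by
  simp only [riemannUp, Fintype.sum_sum_type, h.partialD_christoffel_warp hq,
    h.christoffel_warp hq]

theorem riemannUp_base (h : IsWarpOn G ρ H U V) (hq : q ∈ sumSet U V) (k l i j : ι) :
    riemannUp (warp G ρ H) (.inl k) (.inl l) (.inl i) (.inl j) q
      = riemannUp G k l i j (q ∘ Sum.inl) := by
  rw [h.riemannUp_warp hq]
  have hd : ∀ k i j, DifferentiableAt ℝ (christoffel G k i j) (q ∘ Sum.inl) :=
    fun k i j => h.diff_base hq (h.base.smooth_christoffel k i j)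
  have e : ∀ k i j, warpChristoffel G ρ H (.inl k) (.inl i) (.inl j)
    = fun q => christoffel G k i j (q ∘ Sum.inl) := fun _ _ _ => rfl
  simp only [e, partialD_inl_comp_inl _ (hd _ _ _), warpChristoffel, riemannUp, mul_zero,
    sub_zero, Finset.sum_const_zero, add_zero]

theorem riemannUp_base_base_base_fiber (h : IsWarpOn G ρ H U V) (hq : q ∈ sumSet U V)
    (k l i : ι) (b : κ) :
    riemannUp (warp G ρ H) (.inl k) (.inl l) (.inl i) (.inr b) q = 0 := by
  rw [h.riemannUp_warp hq]
  have hd : ∀ k i j, DifferentiableAt ℝ (christoffel G k i j) (q ∘ Sum.inl) :=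
    fun k i j => h.diff_base hq (h.base.smooth_christoffel k i j)
  have e : ∀ k i j, warpChristoffel G ρ H (.inl k) (.inl i) (.inl j)
    = fun q => christoffel G k i j (q ∘ Sum.inl) := fun _ _ _ => rfl
  have e' : ∀ k i b, warpChristoffel G ρ H (.inl k) (.inr b) (.inl i) = fun _ => 0 :=
    fun _ _ _ => rfl
  simp only [e, e', partialD_inr_comp_inl _ (hd _ _ _), partialD_const]
  simp [warpChristoffel]

theorem riemannUp_base_base_fiber_fiber (h : IsWarpOn G ρ H U V) (hq : q ∈ sumSet U V)
    (k l : ι) (a b : κ) :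
    riemannUp (warp G ρ H) (.inl k) (.inl l) (.inr a) (.inr b) q = 0 := by
  rw [h.riemannUp_warp hq]
  have e' : ∀ k i b, warpChristoffel G ρ H (.inl k) (.inr b) (.inl i) = fun _ => 0 :=
    fun _ _ _ => rfl
  simp only [e', partialD_const]
  simp [warpChristoffel, h.fiber.symm _ hq.2 a b]

theorem riemannUp_fiber_base_fiber_base (h : IsWarpOn G ρ H U V) (hq : q ∈ sumSet U V)
    (l j : ι) (a b : κ) :
    riemannUp (warp G ρ H) (.inr a) (.inl l) (.inr b) (.inl j) q
      = if a = b then -(hessian G ρ j l (q ∘ Sum.inl) / ρ (q ∘ Sum.inl)) else 0 := by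
  rw [h.riemannUp_warp hq]
  have hρ0 := h.ne_zero _ hq.1
  have e' : ∀ i j b, warpChristoffel G ρ H (.inr b) (.inl i) (.inl j) = fun _ => 0 :=
    fun _ _ _ => rfl
  by_cases hab : a = b
  · subst hab
    have e : warpChristoffel G ρ H (.inr a) (.inr a) (.inl l)
        = fun q => (fun p => partialD l ρ p * (ρ p)⁻¹) (q ∘ Sum.inl) := by
      funext q
      simp [warpChristoffel, div_eq_mul_inv]
    have hd1 : DifferentiableAt ℝ (partialD l ρ) (q ∘ Sum.inl) :=
      h.diff_base hq (h.smooth.partialD l h.base.isOpen)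
    have hd2 : DifferentiableAt ℝ ρ (q ∘ Sum.inl) := h.diff_base hq h.smooth
    have hinv : partialD j (fun p => (ρ p)⁻¹) (q ∘ Sum.inl)
        = -(ρ (q ∘ Sum.inl) ^ 2)⁻¹ * partialD j ρ (q ∘ Sum.inl) := by
      rw [partialD_comp j (f := fun x => x⁻¹) (differentiableAt_inv hρ0) hd2, deriv_inv]
    rw [e, e', partialD_const, partialD_inl_comp_inl j (hd1.fun_mul (hd2.fun_inv hρ0)),
      partialD_mul j hd1 (hd2.fun_inv hρ0), hinv]
    simp only [warpChristoffel, hessian, if_true, mul_zero, zero_mul, zero_sub, sub_zero,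
      ite_mul, mul_ite, Finset.sum_neg_distrib]
    have : ∑ s, partialD s ρ (q ∘ Sum.inl) / ρ (q ∘ Sum.inl) * christoffel G s j l (q ∘ Sum.inl)
        = (∑ s, christoffel G s j l (q ∘ Sum.inl) * partialD s ρ (q ∘ Sum.inl))
          / ρ (q ∘ Sum.inl) := by
      rw [Finset.sum_div]
      exact Finset.sum_congr rfl fun s _ => by ring
    simp only [this, Finset.sum_ite_eq', Finset.mem_univ, if_true]
    field_simp
    ring
  · have e : warpChristoffel G ρ H (.inr a) (.inr b) (.inl l) = fun q => 0 := by
      funext q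
      simp [warpChristoffel, hab]
    rw [e, e', partialD_const, partialD_const]
    simp [warpChristoffel, hab]

theorem riemannUp_fiber_fiber_base_fiber (h : IsWarpOn G ρ H U V) (hq : q ∈ sumSet U V)
    (i : ι) (a b c : κ) :
    riemannUp (warp G ρ H) (.inr a) (.inr b) (.inl i) (.inr c) q = 0 := by
  rw [h.riemannUp_warp hq]
  have hρ0 := h.ne_zero _ hq.1
  have hd : DifferentiableAt ℝ (fun p => if a = b then partialD i ρ p / ρ p else 0)
      (q ∘ Sum.inl) := by
    by_cases hab : a = b
    · simp only [hab, if_true]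
      simp only [div_eq_mul_inv]
      exact (h.diff_base hq (h.smooth.partialD i h.base.isOpen)).fun_mul
        ((h.diff_base hq h.smooth).fun_inv hρ0)
    · simp [hab]
  have hd' : DifferentiableAt ℝ (christoffel H a c b) (q ∘ Sum.inr) :=
    h.diff_fiber hq (h.fiber.smooth_christoffel a c b)
  have e : warpChristoffel G ρ H (.inr a) (.inl i) (.inr b)
      = fun q => (fun p => if a = b then partialD i ρ p / ρ p else 0) (q ∘ Sum.inl) := rfl
  have e' : warpChristoffel G ρ H (.inr a) (.inr c) (.inr b)
      = fun q => christoffel H a c b (q ∘ Sum.inr) := rfl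
  rw [e, e', partialD_inr_comp_inl c hd, partialD_inl_comp_inr i hd']
  simp [warpChristoffel, Finset.sum_sub_distrib]
  ring

theorem riemannUp_fiber (h : IsWarpOn G ρ H U V) (hq : q ∈ sumSet U V) (a b c d : κ) :
    riemannUp (warp G ρ H) (.inr a) (.inr b) (.inr c) (.inr d) q
      = riemannUp H a b c d (q ∘ Sum.inr) - gradNormSq G ρ (q ∘ Sum.inl)
        * ((if a = c then H (q ∘ Sum.inr) d b else 0)
          - if a = d then H (q ∘ Sum.inr) c b else 0) := by
  rw [h.riemannUp_warp hq]
  have hρ0 := h.ne_zero _ hq.1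
  have hd : ∀ k i j, DifferentiableAt ℝ (christoffel H k i j) (q ∘ Sum.inr) :=
    fun k i j => h.diff_fiber hq (h.fiber.smooth_christoffel k i j)
  have e : ∀ k i j, warpChristoffel G ρ H (.inr k) (.inr i) (.inr j)
    = fun q => christoffel H k i j (q ∘ Sum.inr) := fun _ _ _ => rfl
  have hN : ∀ x : ℝ, ∑ s, partialD s ρ (q ∘ Sum.inl) / ρ (q ∘ Sum.inl)
      * (-(ρ (q ∘ Sum.inl) * gradUp G ρ s (q ∘ Sum.inl)) * x)
      = -(gradNormSq G ρ (q ∘ Sum.inl) * x) := by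
    intro x
    rw [gradNormSq, Finset.sum_mul, ← Finset.sum_neg_distrib]
    refine Finset.sum_congr rfl fun s _ => ?_
    field_simp
  simp only [e, partialD_inr_comp_inr _ (hd _ _ _), warpChristoffel, riemannUp, ite_mul, zero_mul,
    Finset.sum_sub_distrib]
  rcases eq_or_ne a c with rfl | h1 <;> rcases eq_or_ne a d with rfl | h2 <;>
    simp only [*, if_true, if_false, Finset.sum_const_zero] <;> ring

theorem riemannUp_base_fiber_base_fiber (h : IsWarpOn G ρ H U V) (hq : q ∈ sumSet U V)
    (k j : ι) (a b : κ) :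
    riemannUp (warp G ρ H) (.inl k) (.inr a) (.inl j) (.inr b) q
      = -(ρ (q ∘ Sum.inl) * hessianUp G ρ j k (q ∘ Sum.inl) * H (q ∘ Sum.inr) a b) := by
  rw [h.riemannUp_warp hq]
  have hρ0 := h.ne_zero _ hq.1
  have hd1 : DifferentiableAt ℝ ρ (q ∘ Sum.inl) := h.diff_base hq h.smooth
  have hd2 : DifferentiableAt ℝ (gradUp G ρ k) (q ∘ Sum.inl) :=
    h.diff_base hq (h.base.smooth_gradUp h.smooth k)
  have hd3 : DifferentiableAt ℝ (fun p => H p b a) (q ∘ Sum.inr) :=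
    h.diff_fiber hq (h.fiber.smooth b a)
  have e : warpChristoffel G ρ H (.inl k) (.inr b) (.inr a)
      = fun q => (fun p => (-1) * (ρ p * gradUp G ρ k p)) (q ∘ Sum.inl)
        * (fun p => H p b a) (q ∘ Sum.inr) := by
    funext q
    simp [warpChristoffel]
  have e' : warpChristoffel G ρ H (.inl k) (.inl j) (.inr a) = fun _ => 0 := rfl
  rw [e, e', partialD_const, partialD_inl_mul j ((hd1.fun_mul hd2).const_mul (-1)) hd3,
    partialD_const_mul j _ (hd1.fun_mul hd2), partialD_mul j hd1 hd2]
  have hs : ∑ s, christoffel G k j s (q ∘ Sum.inl)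
      * (-(ρ (q ∘ Sum.inl) * gradUp G ρ s (q ∘ Sum.inl)) * H (q ∘ Sum.inr) b a)
      = -(ρ (q ∘ Sum.inl) * H (q ∘ Sum.inr) b a)
        * ∑ s, christoffel G k j s (q ∘ Sum.inl) * gradUp G ρ s (q ∘ Sum.inl) := by
    rw [Finset.mul_sum]
    exact Finset.sum_congr rfl fun s _ => by ring
  simp only [warpChristoffel, zero_mul, mul_zero, sub_zero, zero_sub, hs]
  simp only [hessianUp, mul_ite, mul_zero, Finset.sum_neg_distrib, Finset.sum_ite_eq',
    Finset.mem_univ, if_true, h.fiber.symm _ hq.2 b a]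
  field_simp
  ring

theorem ricci_base (h : IsWarpOn G ρ H U V) (hq : q ∈ sumSet U V) (l j : ι) :
    ricci (warp G ρ H) (.inl l) (.inl j) q = ricci G l j (q ∘ Sum.inl)
      - Fintype.card κ * (hessian G ρ j l (q ∘ Sum.inl) / ρ (q ∘ Sum.inl)) := by
  simp only [ricci, Fintype.sum_sum_type, h.riemannUp_base hq,
    h.riemannUp_fiber_base_fiber_base hq, if_true]
  simp
  ring

theorem ricci_fiber (h : IsWarpOn G ρ H U V) (hq : q ∈ sumSet U V) (a b : κ) :
    ricci (warp G ρ H) (.inr a) (.inr b) q = ricci H a b (q ∘ Sum.inr)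
      - (((Fintype.card κ : ℝ) - 1) * gradNormSq G ρ (q ∘ Sum.inl)
        + ρ (q ∘ Sum.inl) * ∑ k, hessianUp G ρ k k (q ∘ Sum.inl)) * H (q ∘ Sum.inr) a b := by
  simp only [ricci, Fintype.sum_sum_type, h.riemannUp_fiber hq,
    h.riemannUp_base_fiber_base_fiber hq, if_true, Finset.sum_sub_distrib, mul_sub,
    Finset.sum_neg_distrib, mul_ite, mul_zero, Finset.sum_ite_eq', Finset.mem_univ,
    h.fiber.symm _ hq.2 b a]
  simp [← Finset.sum_mul, ← Finset.mul_sum]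
  ring

/-- A warped product is of constant curvature `K` if its base and its fibre have the curvature, and
the warping function has the Hessian, that they have in the models. -/
theorem constantCurvature (h : IsWarpOn G ρ H U V) (hq : q ∈ sumSet U V) {K α : ℝ}
    (hbase : ∀ k l i j, riemannDown G k l i j (q ∘ Sum.inl)
      = K * (G (q ∘ Sum.inl) k i * G (q ∘ Sum.inl) l j - G (q ∘ Sum.inl) k j * G (q ∘ Sum.inl) l i))
    (hfiber : ∀ k l i j, riemannDown H k l i j (q ∘ Sum.inr)
      = α * (H (q ∘ Sum.inr) k i * H (q ∘ Sum.inr) l j - H (q ∘ Sum.inr) k j * H (q ∘ Sum.inr) l i))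
    (hhess : ∀ i j, hessian G ρ i j (q ∘ Sum.inl)
      = -(K * ρ (q ∘ Sum.inl)) * G (q ∘ Sum.inl) i j)
    (hgrad : gradNormSq G ρ (q ∘ Sum.inl) = α - K * ρ (q ∘ Sum.inl) ^ 2) (k l i j : ι ⊕ κ) :
    riemannDown (warp G ρ H) k l i j q
      = K * (warp G ρ H q k i * warp G ρ H q l j - warp G ρ H q k j * warp G ρ H q l i) := by
  have hM := h.isMetricOn
  have hρ0 := h.ne_zero _ hq.1
  have w1 : ∀ i j, warp G ρ H q (Sum.inl i) (Sum.inl j) = G (q ∘ Sum.inl) i j := fun _ _ => rfl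
  have w2 : ∀ i j, warp G ρ H q (Sum.inl i) (Sum.inr j) = 0 := fun _ _ => rfl
  have w3 : ∀ i j, warp G ρ H q (Sum.inr i) (Sum.inl j) = 0 := fun _ _ => rfl
  have w4 : ∀ i j, warp G ρ H q (Sum.inr i) (Sum.inr j)
    = ρ (q ∘ Sum.inl) ^ 2 * H (q ∘ Sum.inr) i j := fun _ _ => rfl
  have bbbb : ∀ k l i j, riemannDown (warp G ρ H) (.inl k) (.inl l) (.inl i) (.inl j) q
      = K * (G (q ∘ Sum.inl) k i * G (q ∘ Sum.inl) l j
        - G (q ∘ Sum.inl) k j * G (q ∘ Sum.inl) l i) := by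
    intro k l i j
    rw [← hbase]
    simp [riemannDown, Fintype.sum_sum_type, w1, w2, h.riemannUp_base hq]
  have bbbf : ∀ k l i b, riemannDown (warp G ρ H) (.inl k) (.inl l) (.inl i) (.inr b) q = 0 := by
    intro k l i b
    simp [riemannDown, Fintype.sum_sum_type, w2, h.riemannUp_base_base_base_fiber hq]
  have bbff : ∀ k l a b, riemannDown (warp G ρ H) (.inl k) (.inl l) (.inr a) (.inr b) q = 0 := by
    intro k l i b
    simp [riemannDown, Fintype.sum_sum_type, w2, h.riemannUp_base_base_fiber_fiber hq]
  have fbfb : ∀ a l b j, riemannDown (warp G ρ H) (.inr a) (.inl l) (.inr b) (.inl j) q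
      = K * (ρ (q ∘ Sum.inl) ^ 2 * H (q ∘ Sum.inr) a b * G (q ∘ Sum.inl) l j) := by
    intro a l b j
    simp [riemannDown, Fintype.sum_sum_type, w3, w4, h.riemannUp_fiber_base_fiber_base hq, hhess,
      h.base.symm _ hq.1 j l]
    field_simp
  have ffbf : ∀ a b i c, riemannDown (warp G ρ H) (.inr a) (.inr b) (.inl i) (.inr c) q = 0 := by
    intro a b i c
    simp [riemannDown, Fintype.sum_sum_type, w3, h.riemannUp_fiber_fiber_base_fiber hq]
  have ffff : ∀ a b c d, riemannDown (warp G ρ H) (.inr a) (.inr b) (.inr c) (.inr d) q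
      = K * (ρ (q ∘ Sum.inl) ^ 2 * H (q ∘ Sum.inr) a c * (ρ (q ∘ Sum.inl) ^ 2 * H (q ∘ Sum.inr) b d)
        - ρ (q ∘ Sum.inl) ^ 2 * H (q ∘ Sum.inr) a d
          * (ρ (q ∘ Sum.inl) ^ 2 * H (q ∘ Sum.inr) b c)) := by
    intro a b c d
    have := hfiber a b c d
    simp only [riemannDown] at this
    simp only [riemannDown, Fintype.sum_sum_type, w3, w4, h.riemannUp_fiber hq, zero_mul,
      Finset.sum_const_zero, zero_add, mul_assoc, ← Finset.mul_sum, mul_sub,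
      Finset.sum_sub_distrib, this, hgrad, mul_ite, mul_zero, Finset.sum_ite_eq', Finset.mem_univ,
      if_true, h.fiber.symm _ hq.2 d b, h.fiber.symm _ hq.2 c b]
    ring
  have anti_l := hM.riemannDown_antisymm_left hq
  have anti_r := IsMetricOn.riemannDown_antisymm_right (warp G ρ H) q
  have pair := hM.riemannDown_pair_symm hq
  rcases k with k | k <;> rcases l with l | l <;> rcases i with i | i <;> rcases j with j | j <;>
    simp only [w1, w2, w3, w4, zero_mul, mul_zero, sub_self, zero_sub, sub_zero]
  · exact bbbb k l i j
  · exact bbbf k l i j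
  · rw [anti_r, bbbf, neg_zero]
  · exact bbff k l i j
  · rw [pair, bbbf]
  · rw [anti_l, anti_r, neg_neg, fbfb]
    ring
  · rw [anti_l, fbfb]
    ring
  · rw [pair, ffbf]
  · rw [pair, anti_r, bbbf, neg_zero]
  · rw [anti_r, fbfb]
    ring
  · rw [fbfb]
  · rw [pair, anti_r, ffbf, neg_zero]
  · rw [pair, bbff]
  · exact ffbf k l i j
  · rw [anti_r, ffbf, neg_zero]
  · rw [ffff]

end IsWarpOn

end WarpedCurvature

/-! ### Curvature in dimensions two and three -/

section LowDimension

variable {ι : Type*} [Fintype ι] [DecidableEq ι] {G : (ι → ℝ) → Matrix ι ι ℝ} {U : Set (ι → ℝ)}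
  {p : ι → ℝ}

/-- A curvature-like tensor in dimension three whose Ricci contraction vanishes is zero. -/
theorem curvatureLike_eq_zero_of_ricci_eq_zero {C : Matrix (Fin 3) (Fin 3) ℝ} (hC : C.det ≠ 0)
    (hCs : ∀ i j, C i j = C j i) {T : Fin 3 → Fin 3 → Fin 3 → Fin 3 → ℝ}
    (hl : ∀ k l i j, T k l i j = -T l k i j) (hr : ∀ k l i j, T k l i j = -T k l j i)
    (hp : ∀ k l i j, T k l i j = T i j k l)
    (hric : ∀ l j, ∑ k, ∑ s, C k s * T s l k j = 0) (k l i j : Fin 3) : T k l i j = 0 := by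
  have l0 : ∀ k i j, T k k i j = 0 := fun k i j => by linarith [hl k k i j]
  have r0 : ∀ k l i, T k l i i = 0 := fun k l i => by linarith [hr k l i i]
  have l1 := hl 1 0
  have l2 := hl 2 0
  have l3 := hl 2 1
  have r1 := fun k l => hr k l 1 0
  have r2 := fun k l => hr k l 2 0
  have r3 := fun k l => hr k l 2 1
  have p1 := hp 0 2 0 1
  have p2 := hp 1 2 0 1
  have p3 := hp 1 2 0 2
  have c1 := hCs 1 0
  have c2 := hCs 2 0
  have c3 := hCs 2 1
  have e00 := hric 0 0
  have e11 := hric 1 1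
  have e22 := hric 2 2
  have e01 := hric 0 1
  have e02 := hric 0 2
  have e12 := hric 1 2
  simp only [Fin.sum_univ_three, l0, r0, l1, l2, l3, r1, r2, r3, p1, p2, p3, c1, c2, c3]
    at e00 e11 e22 e01 e02 e12
  rw [Matrix.det_fin_three] at hC
  simp only [c1, c2, c3] at hC
  -- With `S` the symmetric matrix of `T` on bivectors, the Ricci contraction is the polarization
  -- `C × S` of the adjugate, and `adj C × (C × S) = det C • S + tr (adj C * S) • C`, where
  -- `tr (C * (C × S)) = 2 tr (adj C * S)`.
  set D := C 0 0 * C 1 1 * C 2 2 - C 0 0 * C 1 2 * C 1 2 - C 0 1 * C 0 1 * C 2 2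
    + C 0 1 * C 1 2 * C 0 2 + C 0 2 * C 0 1 * C 1 2 - C 0 2 * C 1 1 * C 0 2 with hD
  have key : ∀ x : ℝ, D * x = 0 → x = 0 := fun x hx => (mul_eq_zero.1 hx).resolve_left hC
  have x3 : T 1 2 1 2 = 0 := key _ (by
    rw [hD]
    linear_combination (C 0 0 * C 2 2 - C 0 2 ^ 2) * e22 + (C 0 0 * C 1 1 - C 0 1 ^ 2) * e11
      - 2 * (C 0 1 * C 0 2 - C 0 0 * C 1 2) * e12
      - C 0 0 / 2 * (C 0 0 * e00 + C 1 1 * e11 + C 2 2 * e22 + 2 * C 0 1 * e01 + 2 * C 0 2 * e02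
        + 2 * C 1 2 * e12))
  have x2 : T 0 2 0 2 = 0 := key _ (by
    rw [hD]
    linear_combination (C 1 1 * C 2 2 - C 1 2 ^ 2) * e22 + (C 0 0 * C 1 1 - C 0 1 ^ 2) * e00
      - 2 * (C 0 1 * C 1 2 - C 1 1 * C 0 2) * e02
      - C 1 1 / 2 * (C 0 0 * e00 + C 1 1 * e11 + C 2 2 * e22 + 2 * C 0 1 * e01 + 2 * C 0 2 * e02
        + 2 * C 1 2 * e12))
  have x1 : T 0 1 0 1 = 0 := key _ (by
    rw [hD]
    linear_combination (C 1 1 * C 2 2 - C 1 2 ^ 2) * e11 + (C 0 0 * C 2 2 - C 0 2 ^ 2) * e00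
      - 2 * (C 0 2 * C 1 2 - C 2 2 * C 0 1) * e01
      - C 2 2 / 2 * (C 0 0 * e00 + C 1 1 * e11 + C 2 2 * e22 + 2 * C 0 1 * e01 + 2 * C 0 2 * e02
        + 2 * C 1 2 * e12))
  have x4 : T 0 1 0 2 = 0 := key _ (by
    rw [hD]
    linear_combination -(-((C 1 1 * C 2 2 - C 1 2 ^ 2) * e12 + (C 0 1 * C 0 2 - C 0 0 * C 1 2) * e00
      - (C 0 2 * C 1 2 - C 2 2 * C 0 1) * e02 - (C 0 1 * C 1 2 - C 1 1 * C 0 2) * e01)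
      - C 1 2 / 2 * (C 0 0 * e00 + C 1 1 * e11 + C 2 2 * e22 + 2 * C 0 1 * e01 + 2 * C 0 2 * e02
        + 2 * C 1 2 * e12)))
  have x5 : T 0 1 1 2 = 0 := key _ (by
    rw [hD]
    linear_combination (-((C 0 0 * C 2 2 - C 0 2 ^ 2) * e02 + (C 0 1 * C 1 2 - C 1 1 * C 0 2) * e11
      - (C 0 2 * C 1 2 - C 2 2 * C 0 1) * e12 - (C 0 1 * C 0 2 - C 0 0 * C 1 2) * e01)
      - C 0 2 / 2 * (C 0 0 * e00 + C 1 1 * e11 + C 2 2 * e22 + 2 * C 0 1 * e01 + 2 * C 0 2 * e02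
        + 2 * C 1 2 * e12)))
  have x6 : T 0 2 1 2 = 0 := key _ (by
    rw [hD]
    linear_combination -(-((C 0 0 * C 1 1 - C 0 1 ^ 2) * e01 + (C 0 2 * C 1 2 - C 2 2 * C 0 1) * e22
      - (C 0 1 * C 1 2 - C 1 1 * C 0 2) * e12 - (C 0 1 * C 0 2 - C 0 0 * C 1 2) * e02)
      - C 0 1 / 2 * (C 0 0 * e00 + C 1 1 * e11 + C 2 2 * e22 + 2 * C 0 1 * e01 + 2 * C 0 2 * e02
        + 2 * C 1 2 * e12)))
  have hz : ∀ l i j, T 0 l i j = 0 ∧ T 1 l i j = 0 ∧ T 2 l i j = 0 := by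
    intro l i j
    fin_cases l <;> fin_cases i <;> fin_cases j <;>
      simp [l0, r0, l1, l2, l3, r1, r2, r3, p1, p2, p3, x1, x2, x3, x4, x5, x6]
  fin_cases k
  exacts [(hz l i j).1, (hz l i j).2.1, (hz l i j).2.2]

namespace IsMetricOn

theorem ricci_eq_sum_riemannDown (h : IsMetricOn G U) (hp : p ∈ U) (l j : ι) :
    ricci G l j p = ∑ k, ∑ s, (G p)⁻¹ k s * riemannDown G s l k j p :=
  Finset.sum_congr rfl fun k _ => (h.sum_raise_lower hp (fun s => riemannUp G s l k j p) k).symm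

theorem sum_inv_mul_constantCurvature (h : IsMetricOn G U) (hp : p ∈ U) (K : ℝ) (l j : ι) :
    ∑ k, ∑ s, (G p)⁻¹ k s * (K * (G p s k * G p l j - G p s j * G p l k))
      = ((Fintype.card ι : ℝ) - 1) * K * G p l j := by
  have e : ∀ k, ∑ s, (G p)⁻¹ k s * (K * (G p s k * G p l j - G p s j * G p l k))
      = K * (G p l j * ∑ s, (G p)⁻¹ k s * G p s k - G p l k * ∑ s, (G p)⁻¹ k s * G p s j) := by
    intro k
    simp only [mul_sub, Finset.mul_sum, ← Finset.sum_sub_distrib]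
    exact Finset.sum_congr rfl fun s _ => by ring
  simp only [e, h.sum_inv_mul hp, ← Finset.mul_sum, Finset.sum_sub_distrib]
  simp
  ring

theorem ricci_of_constantCurvature (h : IsMetricOn G U) (hp : p ∈ U) {K : ℝ}
    (hK : ∀ k l i j, riemannDown G k l i j p = K * (G p k i * G p l j - G p k j * G p l i))
    (l j : ι) : ricci G l j p = ((Fintype.card ι : ℝ) - 1) * K * G p l j := by
  simp only [h.ricci_eq_sum_riemannDown hp, hK, h.sum_inv_mul_constantCurvature hp]

/-- In dimension two the curvature tensor is determined by the Gauss curvature. -/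
theorem exists_gaussCurvature {G : (Fin 2 → ℝ) → Matrix (Fin 2) (Fin 2) ℝ} {U : Set (Fin 2 → ℝ)}
    {p : Fin 2 → ℝ} (h : IsMetricOn G U) (hp : p ∈ U) :
    ∃ K : ℝ, ∀ k l i j, riemannDown G k l i j p = K * (G p k i * G p l j - G p k j * G p l i) := by
  have hd := h.det_ne_zero p hp
  refine ⟨riemannDown G 0 1 0 1 p / (G p).det, fun k l i j => ?_⟩
  have hl := h.riemannDown_antisymm_left hp
  have hr := riemannDown_antisymm_right G p
  have l0 : ∀ k i j, riemannDown G k k i j p = 0 := fun k i j => by linarith [hl k k i j]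
  have r0 : ∀ k l i, riemannDown G k l i i p = 0 := fun k l i => by linarith [hr k l i i]
  have hs := h.symm p hp 1 0
  rw [Matrix.det_fin_two, hs] at hd ⊢
  fin_cases k <;> fin_cases l <;> fin_cases i <;> fin_cases j <;>
    simp only [Fin.zero_eta, Fin.mk_one, l0, r0, hl 1 0, hr _ _ 1 0, hs] <;>
    first
    | ring1
    | (rw [div_mul_eq_mul_div, eq_div_iff hd]; done)
    | (rw [div_mul_eq_mul_div, eq_div_iff hd]; ring1)

/-- An Einstein metric in dimension three is of constant curvature. -/
theorem constantCurvature_of_einstein_three {G : (Fin 3 → ℝ) → Matrix (Fin 3) (Fin 3) ℝ}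
    {U : Set (Fin 3 → ℝ)} {p : Fin 3 → ℝ} (h : IsMetricOn G U) (hp : p ∈ U) {K : ℝ}
    (hK : ∀ l j, ricci G l j p = 2 * K * G p l j) (k l i j : Fin 3) :
    riemannDown G k l i j p = K * (G p k i * G p l j - G p k j * G p l i) := by
  rw [← sub_eq_zero]
  have hs := h.symm p hp
  refine curvatureLike_eq_zero_of_ricci_eq_zero (C := (G p)⁻¹)
    (T := fun k l i j => riemannDown G k l i j p - K * (G p k i * G p l j - G p k j * G p l i))
    ?_ (h.inv_symm hp) ?_ ?_ ?_ ?_ k l i j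
  · exact (Matrix.isUnit_nonsing_inv_det _ (h.det_ne_zero p hp).isUnit).ne_zero
  · intro k l i j
    simp only [h.riemannDown_antisymm_left hp k l i j]
    ring
  · intro k l i j
    simp only [riemannDown_antisymm_right G p k l i j]
    ring
  · intro k l i j
    simp only [h.riemannDown_pair_symm hp k l i j, hs i k, hs j l, hs i l, hs j k]
    ring
  · intro l j
    rw [show ∑ k, ∑ s, (G p)⁻¹ k s * (riemannDown G s l k j p
          - K * (G p s k * G p l j - G p s j * G p l k))
        = ∑ k, ∑ s, (G p)⁻¹ k s * riemannDown G s l k j p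
          - ∑ k, ∑ s, (G p)⁻¹ k s * (K * (G p s k * G p l j - G p s j * G p l k)) by
      simp only [← Finset.sum_sub_distrib, ← mul_sub]]
    have e := h.sum_inv_mul_constantCurvature hp K l j
    rw [Fintype.card_fin] at e
    rw [← h.ricci_eq_sum_riemannDown hp, hK]
    simp only [e]
    push_cast
    ring

end IsMetricOn

/-- An Einstein metric in dimension two or three, with constant scalar curvature, is of constant
curvature. -/
theorem constantCurvature_of_einstein {m : ℕ} (hm : 2 ≤ m) (hm3 : m ≤ 3)
    {G : (Fin m → ℝ) → Matrix (Fin m) (Fin m) ℝ} {U : Set (Fin m → ℝ)} {p : Fin m → ℝ}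
    (h : IsMetricOn G U) (hp : p ∈ U) {K : ℝ}
    (hK : ∀ l j, ricci G l j p = ((m : ℝ) - 1) * K * G p l j) (k l i j : Fin m) :
    riemannDown G k l i j p = K * (G p k i * G p l j - G p k j * G p l i) := by
  obtain rfl | rfl : m = 2 ∨ m = 3 := by omega
  · obtain ⟨K', hK'⟩ := h.exists_gaussCurvature hp
    have hr := h.ricci_of_constantCurvature hp hK'
    have : K' = K := by
      by_contra hne
      refine h.det_ne_zero p hp ?_
      have : ∀ l j, G p l j = 0 := by
        intro l j
        have := (hr l j).symm.trans (hK l j)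
        rw [Fintype.card_fin] at this
        have h2 : (K' - K) * G p l j = 0 := by push_cast at this; linear_combination this
        exact (mul_eq_zero.1 h2).resolve_left (sub_ne_zero.2 hne)
      rw [Matrix.det_fin_two]
      simp [this]
    rw [← this]
    exact hK' k l i j
  · refine h.constantCurvature_of_einstein_three hp (fun l j => ?_) k l i j
    rw [hK]
    norm_num

end LowDimension

/-! ### The vacuum equations of a warped product with a two-dimensional base -/

section Profile

variable {m : ℕ} {α M Λ x : ℝ}

theorem profile_two_add (m : ℕ) (α M Λ x : ℝ) :
    profile (2 + m) α M Λ x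
      = α - 2 * M / x ^ (m - 1) - 2 * Λ / (((m : ℝ) + 1) * m) * x ^ 2 := by
  have h1 : 2 + m - 3 = m - 1 := by omega
  have h2 : (((2 + m : ℕ) : ℝ) - 1) * (((2 + m : ℕ) : ℝ) - 2) = ((m : ℝ) + 1) * m := by
    push_cast
    ring
  rw [profile, h1, h2]

theorem analyticAt_profile (n : ℕ) (α M Λ : ℝ) (hx : x ≠ 0) :
    AnalyticAt ℝ (profile n α M Λ) x := by
  have : AnalyticAt ℝ (fun x : ℝ => α - 2 * M / x ^ (n - 3)
      - 2 * Λ / (((n : ℝ) - 1) * ((n : ℝ) - 2)) * x ^ 2) x :=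
    (analyticAt_const.sub (analyticAt_const.div (analyticAt_id.pow _) (pow_ne_zero _ hx))).sub
      (analyticAt_const.mul (analyticAt_id.pow _))
  exact this

theorem hasDerivAt_profile (hm : 2 ≤ m) (hx : x ≠ 0) :
    HasDerivAt (profile (2 + m) α M Λ)
      (2 * M * ((m : ℝ) - 1) / x ^ m - 4 * Λ / (((m : ℝ) + 1) * m) * x) x := by
  obtain ⟨n, rfl⟩ : ∃ n, m = n + 2 := ⟨m - 2, by omega⟩
  have h1 : HasDerivAt (fun x : ℝ => x ^ (n + 1)) (((n + 1 : ℕ) : ℝ) * x ^ n) x :=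
    hasDerivAt_pow (n + 1) x
  have h2 : HasDerivAt (fun x : ℝ => x ^ 2) (((2 : ℕ) : ℝ) * x ^ 1) x := hasDerivAt_pow 2 x
  have h3 := ((hasDerivAt_const x (2 * M)).fun_div h1 (pow_ne_zero _ hx))
  have h4 := ((hasDerivAt_const x α).fun_sub h3).fun_sub
    (h2.const_mul (2 * Λ / ((((n + 2 : ℕ) : ℝ) + 1) * ((n + 2 : ℕ) : ℝ))))
  rw [funext (profile_two_add (n + 2) α M Λ)]
  refine h4.congr_deriv ?_
  push_cast
  field_simp
  ring

end Profile

section Vacuum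

/-- The equations `∇∇ρ = ½ f'(ρ) G` and `(∇ρ)² = f(ρ)` on an open set `U` of the plane, for a
metric `G` and a nowhere vanishing function `ρ`. -/
structure IsBirkhoffBase (f : ℝ → ℝ) (G : (Fin 2 → ℝ) → Matrix (Fin 2) (Fin 2) ℝ)
    (ρ : (Fin 2 → ℝ) → ℝ) (U : Set (Fin 2 → ℝ)) : Prop where
  metric : IsMetricOn G U
  smooth : ContDiffOn ℝ ∞ ρ U
  ne_zero : ∀ p ∈ U, ρ p ≠ 0
  hessian_eq : ∀ p ∈ U, ∀ i j, hessian G ρ i j p = 1 / 2 * deriv f (ρ p) * G p i j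
  gradNormSq_eq : ∀ p ∈ U, gradNormSq G ρ p = f (ρ p)

theorem IsBirkhoffBase.mono {f : ℝ → ℝ} {G : (Fin 2 → ℝ) → Matrix (Fin 2) (Fin 2) ℝ}
    {ρ : (Fin 2 → ℝ) → ℝ} {U V : Set (Fin 2 → ℝ)} (h : IsBirkhoffBase f G ρ U) (hV : IsOpen V)
    (hVU : V ⊆ U) : IsBirkhoffBase f G ρ V :=
  ⟨h.metric.mono hV hVU, h.smooth.mono hVU, fun p hp => h.ne_zero p (hVU hp),
    fun p hp => h.hessian_eq p (hVU hp), fun p hp => h.gradNormSq_eq p (hVU hp)⟩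

/-- If `∇∇ρ = φ G` at a point, then `d(∇ρ)² = 2 φ dρ` there. -/
theorem partialD_gradNormSq {ι : Type*} [Fintype ι] [DecidableEq ι]
    {G : (ι → ℝ) → Matrix ι ι ℝ} {ρ : (ι → ℝ) → ℝ} {U : Set (ι → ℝ)} {p : ι → ℝ}
    (h : IsMetricOn G U) (hρ : ContDiffOn ℝ ∞ ρ U) (hp : p ∈ U) {φ : ℝ}
    (hφ : ∀ i j, hessian G ρ i j p = φ * G p i j) (j : ι) :
    partialD j (gradNormSq G ρ) p = 2 * φ * partialD j ρ p := by
  have hd1 : ∀ i, DifferentiableAt ℝ (partialD i ρ) p := fun i =>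
    (hρ.partialD i h.isOpen).differentiableAt_of_isOpen h.isOpen hp
  have hd2 : ∀ i, DifferentiableAt ℝ (gradUp G ρ i) p := fun i =>
    (h.smooth_gradUp hρ i).differentiableAt_of_isOpen h.isOpen hp
  have e1 : ∀ i, partialD j (partialD i ρ) p
      = φ * G p j i + ∑ k, christoffel G k j i p * partialD k ρ p := by
    intro i
    rw [← hφ, hessian]
    ring
  have e2 : ∀ i, partialD j (gradUp G ρ i) p
      = (if j = i then φ else 0) - ∑ s, christoffel G i j s p * gradUp G ρ s p := by
    intro i
    rw [← h.hessianUp_of_hessian hp hρ hφ, hessianUp]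
    ring
  have e3 : ∑ i, (∑ k, christoffel G k j i p * partialD k ρ p) * gradUp G ρ i p
      = ∑ i, partialD i ρ p * ∑ s, christoffel G i j s p * gradUp G ρ s p := by
    simp only [Finset.sum_mul, Finset.mul_sum]
    rw [Finset.sum_comm]
    exact Finset.sum_congr rfl fun i _ => Finset.sum_congr rfl fun s _ => by ring
  have e4 : ∑ i, φ * G p j i * gradUp G ρ i p = φ * partialD j ρ p := by
    rw [← h.sum_lower_gradUp hp ρ j, Finset.mul_sum]
    exact Finset.sum_congr rfl fun i _ => by ring
  unfold gradNormSq
  rw [partialD_sum (F := fun i q => partialD i ρ q * gradUp G ρ i q) _ _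
    fun i _ => (hd1 i).fun_mul (hd2 i)]
  simp only [fun i => partialD_mul j (hd1 i) (hd2 i), e1, e2, add_mul, mul_sub,
    Finset.sum_add_distrib, Finset.sum_sub_distrib, e3, e4, mul_ite, mul_zero, Finset.sum_ite_eq,
    Finset.mem_univ, if_true]
  ring

theorem IsMetricOn.exists_ne_zero {ι : Type*} [Fintype ι] [DecidableEq ι] [Nonempty ι]
    {G : (ι → ℝ) → Matrix ι ι ℝ} {U : Set (ι → ℝ)} {p : ι → ℝ} (h : IsMetricOn G U) (hp : p ∈ U) :
    ∃ i j, G p i j ≠ 0 := by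
  by_contra! hne
  refine h.det_ne_zero p hp ?_
  rw [show G p = 0 from Matrix.ext hne]
  exact Matrix.det_zero

/-- In dimension `2 + m`, the coordinate form of `Ric = 2Λ/m · g` for a warped product. -/
def IsWarpVacuum {m : ℕ} (Λ : ℝ) (G : (Fin 2 → ℝ) → Matrix (Fin 2) (Fin 2) ℝ)
    (ρ : (Fin 2 → ℝ) → ℝ) (H : (Fin m → ℝ) → Matrix (Fin m) (Fin m) ℝ)
    (U : Set (Fin 2 → ℝ)) (V : Set (Fin m → ℝ)) : Prop :=
  ∀ q ∈ sumSet U V, ∀ i j, ricci (warp G ρ H) i j q = 2 * Λ / m * warp G ρ H q i j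

/-- The function on the base that is the Einstein constant of the fibre. -/
def fiberEinstein (m : ℕ) (Λ : ℝ) (G : (Fin 2 → ℝ) → Matrix (Fin 2) (Fin 2) ℝ)
    (ρ : (Fin 2 → ℝ) → ℝ) (p : Fin 2 → ℝ) : ℝ :=
  ((m : ℝ) - 1) * gradNormSq G ρ p + ρ p * ∑ k, hessianUp G ρ k k p + 2 * Λ / m * ρ p ^ 2

variable {m : ℕ} {Λ : ℝ} {G : (Fin 2 → ℝ) → Matrix (Fin 2) (Fin 2) ℝ}
  {ρ : (Fin 2 → ℝ) → ℝ} {H : (Fin m → ℝ) → Matrix (Fin m) (Fin m) ℝ}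
  {U : Set (Fin 2 → ℝ)} {V : Set (Fin m → ℝ)} {p : Fin 2 → ℝ} {y : Fin m → ℝ}

namespace IsWarpVacuum

/-- The point of the product with given components. -/
theorem mem_sumSet (hp : p ∈ U) (hy : y ∈ V) :
    Sum.elim p y ∈ sumSet U V := by
  constructor
  · simpa using hp
  · simpa using hy

theorem ricci_fiber (hv : IsWarpVacuum Λ G ρ H U V) (h : IsWarpOn G ρ H U V) (hp : p ∈ U)
    (hy : y ∈ V) (a b : Fin m) : ricci H a b y = fiberEinstein m Λ G ρ p * H y a b := by
  have e1 := hv _ (mem_sumSet hp hy) (.inr a) (.inr b)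
  rw [h.ricci_fiber (mem_sumSet hp hy), Fintype.card_fin] at e1
  simp only [Sum.elim_comp_inl, Sum.elim_comp_inr, warp, Matrix.fromBlocks_apply₂₂,
    Matrix.smul_apply, smul_eq_mul] at e1
  rw [fiberEinstein]
  linear_combination e1

theorem fiberEinstein_eq [Nonempty (Fin m)] (hv : IsWarpVacuum Λ G ρ H U V)
    (h : IsWarpOn G ρ H U V) (hy : y ∈ V)
    {p p' : Fin 2 → ℝ} (hp : p ∈ U) (hp' : p' ∈ U) :
    fiberEinstein m Λ G ρ p = fiberEinstein m Λ G ρ p' := by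
  obtain ⟨a, b, hab⟩ := h.fiber.exists_ne_zero hy
  exact mul_right_cancel₀ hab
    ((hv.ricci_fiber h hp hy a b).symm.trans (hv.ricci_fiber h hp' hy a b))

/-- The base part of the vacuum equations makes the Hessian of the warping function a multiple of
the metric, because the Ricci tensor of a surface is one. -/
theorem exists_hessian_eq (hm : m ≠ 0) (hv : IsWarpVacuum Λ G ρ H U V) (h : IsWarpOn G ρ H U V)
    (hy : y ∈ V) (hp : p ∈ U) :
    ∃ φ : ℝ, (∀ i j, hessian G ρ i j p = φ * G p i j) ∧
      ∀ k l i j, riemannDown G k l i j p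
        = (m * φ / ρ p + 2 * Λ / m) * (G p k i * G p l j - G p k j * G p l i) := by
  obtain ⟨K, hK⟩ := h.base.exists_gaussCurvature hp
  have hm' : (m : ℝ) ≠ 0 := Nat.cast_ne_zero.2 hm
  have hρ := h.ne_zero p hp
  have hr := h.base.ricci_of_constantCurvature hp hK
  refine ⟨ρ p / m * (K - 2 * Λ / m), fun i j => ?_, fun k l i j => ?_⟩
  · have e1 := hv _ (mem_sumSet hp hy) (.inl j) (.inl i)
    rw [h.ricci_base (mem_sumSet hp hy)] at e1
    simp only [Sum.elim_comp_inl, warp, Matrix.fromBlocks_apply₁₁, Fintype.card_fin, hr] at e1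
    rw [h.base.symm p hp j i] at e1
    have e2 : hessian G ρ i j p = (ρ p / m) * (m * (hessian G ρ i j p / ρ p)) := by
      field_simp
    rw [e2]
    push_cast at e1
    linear_combination -(ρ p / m) * e1
  · rw [hK]
    congr 1
    field_simp
    ring

/-- The solution of the vacuum equations on the base. The Einstein constant of the fibre is
`(m - 1) α`, and `-2M` is the constant value of
`ρ^(m-1) ((∇ρ)² - α) + 2Λ/(m(m+1)) ρ^(m+1)`. -/
theorem exists_profile (hm : 2 ≤ m) (hv : IsWarpVacuum Λ G ρ H U V) (h : IsWarpOn G ρ H U V)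
    (hUc : IsPreconnected U) (hy : y ∈ V) {p₀ : Fin 2 → ℝ} (hp₀ : p₀ ∈ U) :
    ∃ α M : ℝ, IsBirkhoffBase (profile (2 + m) α M Λ) G ρ U ∧
      ∀ p ∈ U, fiberEinstein m Λ G ρ p = ((m : ℝ) - 1) * α := by
  obtain ⟨n, rfl⟩ : ∃ n, m = n + 2 := ⟨m - 2, by omega⟩
  have hm1 : ((n + 2 : ℕ) : ℝ) - 1 ≠ 0 := by
    have : ((n + 2 : ℕ) : ℝ) - 1 = n + 1 := by
      push_cast
      ring
    rw [this]
    positivity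
  set α : ℝ := fiberEinstein (n + 2) Λ G ρ p₀ / (((n + 2 : ℕ) : ℝ) - 1) with hα
  have hE : ∀ p ∈ U, fiberEinstein (n + 2) Λ G ρ p = (((n + 2 : ℕ) : ℝ) - 1) * α := by
    intro p hp
    rw [hv.fiberEinstein_eq h hy hp hp₀, hα]
    field_simp
  choose! φ hφ _ using fun p (hp : p ∈ U) => hv.exists_hessian_eq (by omega) h hy hp
  have hφ2 : ∀ p ∈ U, 2 * ρ p * φ p = ((n + 2 : ℕ) - 1 : ℝ) * (α - gradNormSq G ρ p)
      - 2 * Λ / (n + 2 : ℕ) * ρ p ^ 2 := by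
    intro p hp
    have := hE p hp
    rw [fiberEinstein] at this
    simp only [h.base.hessianUp_of_hessian hp h.smooth (hφ p hp), if_true, Fin.sum_univ_two] at this
    linear_combination this
  have hNs : ContDiffOn ℝ ∞ (gradNormSq G ρ) U :=
    ContDiffOn.sum fun i _ => (h.smooth.partialD i h.base.isOpen).mul
      (h.base.smooth_gradUp h.smooth i)
  set c : ℝ := 2 * Λ / ((((n + 2 : ℕ) : ℝ) + 1) * (n + 2 : ℕ)) with hc
  set F : (Fin 2 → ℝ) → ℝ := fun p =>
    ρ p ^ (n + 1) * (gradNormSq G ρ p - α) + c * ρ p ^ (n + 3) with hF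
  have hFd : ∀ p ∈ U, fderiv ℝ F p = 0 := by
    intro p hp
    rw [fderiv_eq_zero_iff_partialD]
    intro i
    have d1 := h.smooth.differentiableAt_of_isOpen h.base.isOpen hp
    have d2 := hNs.differentiableAt_of_isOpen h.base.isOpen hp
    have pw : ∀ k : ℕ, partialD i (fun q => ρ q ^ (k + 1)) p
        = (k + 1) * ρ p ^ k * partialD i ρ p := by
      intro k
      rw [partialD_comp i (f := fun x => x ^ (k + 1)) (differentiableAt_pow _) d1]
      simp
    rw [hF, partialD_add i ((d1.fun_pow _).fun_mul (d2.fun_sub (differentiableAt_const _)))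
      ((d1.fun_pow _).const_mul c),
      partialD_mul i (d1.fun_pow _) (d2.fun_sub (differentiableAt_const _)),
      partialD_const_mul i c (d1.fun_pow _), partialD_sub i d2 (differentiableAt_const _),
      partialD_const, pw, pw, partialD_gradNormSq h.base h.smooth hp (hφ p hp)]
    have e := hφ2 p hp
    have hc' : c * ((n : ℝ) + 3) = 2 * Λ / (n + 2 : ℕ) := by
      rw [hc]
      push_cast
      field_simp
      ring
    push_cast at e hc' ⊢
    linear_combination ρ p ^ n * partialD i ρ p * e + ρ p ^ (n + 2) * partialD i ρ p * hc'
  have hFc : ∀ p ∈ U, F p = F p₀ := by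
    intro p hp
    refine h.base.isOpen.is_const_of_fderiv_eq_zero hUc ?_ (fun x hx => hFd x hx) hp hp₀
    intro x hx
    exact (DifferentiableAt.add (((h.smooth.differentiableAt_of_isOpen h.base.isOpen hx).fun_pow
      _).fun_mul ((hNs.differentiableAt_of_isOpen h.base.isOpen hx).fun_sub
      (differentiableAt_const _))) (((h.smooth.differentiableAt_of_isOpen h.base.isOpen
      hx).fun_pow _).const_mul c)).differentiableWithinAt
  refine ⟨α, -F p₀ / 2, ⟨h.base, h.smooth, h.ne_zero, fun p hp i j => ?_, fun p hp => ?_⟩, hE⟩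
  · have hρ := h.ne_zero p hp
    rw [hφ p hp, (hasDerivAt_profile hm hρ).deriv]
    congr 1
    have e := hφ2 p hp
    rw [← hFc p hp, hF]
    have : φ p = (2 * ρ p * φ p) / (2 * ρ p) := by field_simp
    rw [this, e, hc]
    push_cast
    field_simp
    ring
  · have hρ := h.ne_zero p hp
    rw [profile_two_add, ← hFc p hp, hF, hc]
    simp only [Nat.add_succ_sub_one]
    push_cast
    field_simp
    ring

end IsWarpVacuum

end Vacuum

/-! ### Closed one-forms and null frames in the plane -/

section Poincare

variable {ι : Type*} [Fintype ι] [DecidableEq ι]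

/-- The Poincaré lemma for smooth one-forms on convex open sets, in components. -/
theorem exists_partialD_eq_of_closed {U : Set (ι → ℝ)} (hU : IsOpen U) (hc : Convex ℝ U)
    {η : ι → (ι → ℝ) → ℝ} (hη : ∀ i, ContDiffOn ℝ ∞ (η i) U)
    (hcl : ∀ p ∈ U, ∀ i j, partialD i (η j) p = partialD j (η i) p) :
    ∃ v : (ι → ℝ) → ℝ, ContDiffOn ℝ ∞ v U ∧ ∀ p ∈ U, ∀ i, partialD i v p = η i p := by
  set Ξ : (ι → ℝ) → (ι → ℝ) →L[ℝ] ℝ :=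
    fun p => ∑ i, η i p • ContinuousLinearMap.proj (R := ℝ) (φ := fun _ : ι => ℝ) i with hΞ
  have hΞs : ContDiffOn ℝ ∞ Ξ U := ContDiffOn.sum fun i _ => (hη i).smul contDiffOn_const
  have hfd : ∀ p ∈ U, ∀ x y : ι → ℝ, fderiv ℝ Ξ p x y
      = ∑ i, ∑ j, x j * y i * partialD j (η i) p := by
    intro p hp x y
    have hd : ∀ i, HasFDerivAt (η i) (fderiv ℝ (η i) p) p := fun i =>
      ((hη i).differentiableAt_of_isOpen hU hp).hasFDerivAt
    have : HasFDerivAt Ξ (∑ i, (fderiv ℝ (η i) p).smulRight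
        (ContinuousLinearMap.proj (R := ℝ) (φ := fun _ : ι => ℝ) i)) p :=
      HasFDerivAt.fun_sum fun i _ => (hd i).smul_const
        (ContinuousLinearMap.proj (R := ℝ) (φ := fun _ : ι => ℝ) i)
    rw [this.fderiv]
    simp only [_root_.sum_apply, ContinuousLinearMap.smulRight_apply,
      _root_.smul_apply, ContinuousLinearMap.proj_apply, smul_eq_mul,
      fderiv_apply_eq_sum_partialD, Finset.sum_mul]
    exact Finset.sum_congr rfl fun i _ => Finset.sum_congr rfl fun j _ => by ring
  obtain ⟨v, hv⟩ := hc.exists_forall_hasFDerivAt_of_fderiv_symmetric hU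
    (hΞs.differentiableOn (by simp)) fun p hp x y => by
      rw [hfd p hp, hfd p hp, Finset.sum_comm]
      refine Finset.sum_congr rfl fun i _ => Finset.sum_congr rfl fun j _ => ?_
      rw [hcl p hp]
      ring
  refine ⟨v, ?_, fun p hp i => ?_⟩
  · rw [contDiffOn_infty_iff_fderiv_of_isOpen hU]
    exact ⟨fun p hp => (hv p hp).differentiableAt.differentiableWithinAt,
      hΞs.congr fun p hp => (hv p hp).fderiv⟩
  · rw [partialD, (hv p hp).fderiv]
    simp [hΞ, Pi.single_apply]

end Poincare

section NullFrame

theorem partialD_div {ι : Type*} [Fintype ι] [DecidableEq ι] {F H : (ι → ℝ) → ℝ} {p : ι → ℝ}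
    (i : ι) (hF : DifferentiableAt ℝ F p) (hH : DifferentiableAt ℝ H p) (h0 : H p ≠ 0) :
    partialD i (fun q => F q / H q) p
      = (partialD i F p * H p - F p * partialD i H p) / H p ^ 2 := by
  simp only [div_eq_mul_inv (F _)]
  rw [partialD_mul i hF (hH.fun_inv h0),
    partialD_comp i (f := fun x => x⁻¹) (differentiableAt_inv h0) hH, deriv_inv]
  field_simp
  ring

/-- A null coframe `(L, K)` of a metric on an open subset of the plane: `G = L ⊗ K + K ⊗ L`. -/
structure IsNullFrame (G : (Fin 2 → ℝ) → Matrix (Fin 2) (Fin 2) ℝ)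
    (L K : Fin 2 → (Fin 2 → ℝ) → ℝ) (U : Set (Fin 2 → ℝ)) : Prop where
  isOpen : IsOpen U
  smooth_left : ∀ i, ContDiffOn ℝ ∞ (L i) U
  smooth_right : ∀ i, ContDiffOn ℝ ∞ (K i) U
  eq : ∀ p ∈ U, ∀ i j, G p i j = L i p * K j p + K i p * L j p
  wedge_ne_zero : ∀ p ∈ U, L 0 p * K 1 p - L 1 p * K 0 p ≠ 0

/-- The component along `L` of the differential of `ρ` in the coframe `(L, K)`. -/
def frameComponent (L K : Fin 2 → (Fin 2 → ℝ) → ℝ) (ρ : (Fin 2 → ℝ) → ℝ) (p : Fin 2 → ℝ) : ℝ :=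
  (partialD 0 ρ p * K 1 p - partialD 1 ρ p * K 0 p) / (L 0 p * K 1 p - L 1 p * K 0 p)

/-- The exterior derivative `∂₀η₁ - ∂₁η₀` of a one-form in the plane. -/
def curl (η : Fin 2 → (Fin 2 → ℝ) → ℝ) (p : Fin 2 → ℝ) : ℝ :=
  partialD 0 (η 1) p - partialD 1 (η 0) p

/-- The connection one-form `θ` of a null coframe, determined by `dL = -θ ∧ L` and
`dK = θ ∧ K`. -/
def frameConnection (L K : Fin 2 → (Fin 2 → ℝ) → ℝ) (i : Fin 2) (p : Fin 2 → ℝ) : ℝ :=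
  (curl K p * L i p + curl L p * K i p) / (L 0 p * K 1 p - L 1 p * K 0 p)

variable {G : (Fin 2 → ℝ) → Matrix (Fin 2) (Fin 2) ℝ} {L K : Fin 2 → (Fin 2 → ℝ) → ℝ}
  {U : Set (Fin 2 → ℝ)} {p : Fin 2 → ℝ} {ρ : (Fin 2 → ℝ) → ℝ}

namespace IsNullFrame

theorem swap (h : IsNullFrame G L K U) : IsNullFrame G K L U where
  isOpen := h.isOpen
  smooth_left := h.smooth_right
  smooth_right := h.smooth_left
  eq p hp i j := by rw [h.eq p hp, add_comm]
  wedge_ne_zero p hp := by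
    have := h.wedge_ne_zero p hp
    contrapose! this
    linear_combination -this

theorem mono (h : IsNullFrame G L K U) {V : Set (Fin 2 → ℝ)} (hV : IsOpen V) (hVU : V ⊆ U) :
    IsNullFrame G L K V :=
  ⟨hV, fun i => (h.smooth_left i).mono hVU, fun i => (h.smooth_right i).mono hVU,
    fun p hp => h.eq p (hVU hp), fun p hp => h.wedge_ne_zero p (hVU hp)⟩

theorem smooth_wedge (h : IsNullFrame G L K U) :
    ContDiffOn ℝ ∞ (fun p => L 0 p * K 1 p - L 1 p * K 0 p) U :=
  ((h.smooth_left 0).mul (h.smooth_right 1)).sub ((h.smooth_left 1).mul (h.smooth_right 0))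

theorem smooth_frameComponent (h : IsNullFrame G L K U) (hρ : ContDiffOn ℝ ∞ ρ U) :
    ContDiffOn ℝ ∞ (frameComponent L K ρ) U :=
  (((hρ.partialD 0 h.isOpen).mul (h.smooth_right 1)).sub
    ((hρ.partialD 1 h.isOpen).mul (h.smooth_right 0))).div h.smooth_wedge h.wedge_ne_zero

theorem smooth_curl {η : Fin 2 → (Fin 2 → ℝ) → ℝ} (hU : IsOpen U)
    (hη : ∀ i, ContDiffOn ℝ ∞ (η i) U) : ContDiffOn ℝ ∞ (curl η) U :=
  ((hη 1).partialD 0 hU).sub ((hη 0).partialD 1 hU)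

theorem smooth_frameConnection (h : IsNullFrame G L K U) (i : Fin 2) :
    ContDiffOn ℝ ∞ (frameConnection L K i) U :=
  (((smooth_curl h.isOpen h.smooth_right).mul (h.smooth_left i)).add
    ((smooth_curl h.isOpen h.smooth_left).mul (h.smooth_right i))).div h.smooth_wedge
    h.wedge_ne_zero

theorem frameConnection_swap (L K : Fin 2 → (Fin 2 → ℝ) → ℝ) (i : Fin 2) (p : Fin 2 → ℝ) :
    frameConnection K L i p = -frameConnection L K i p := by
  rw [frameConnection, frameConnection,
    show K 0 p * L 1 p - K 1 p * L 0 p = -(L 0 p * K 1 p - L 1 p * K 0 p) by ring, div_neg,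
    add_comm]

theorem partialD_eq (h : IsNullFrame G L K U) (hp : p ∈ U) (ρ : (Fin 2 → ℝ) → ℝ) (i : Fin 2) :
    partialD i ρ p = frameComponent L K ρ p * L i p + frameComponent K L ρ p * K i p := by
  have hW := h.wedge_ne_zero p hp
  simp only [frameComponent]
  rw [show K 0 p * L 1 p - K 1 p * L 0 p = -(L 0 p * K 1 p - L 1 p * K 0 p) by ring, div_neg,
    ← neg_div, div_mul_eq_mul_div, div_mul_eq_mul_div, ← add_div, eq_div_iff hW]
  fin_cases i <;> simp only [Fin.zero_eta, Fin.mk_one] <;> ring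

theorem isMetricOn (h : IsNullFrame G L K U) : IsMetricOn G U where
  isOpen := h.isOpen
  smooth i j := (((h.smooth_left i).mul (h.smooth_right j)).add
    ((h.smooth_right i).mul (h.smooth_left j))).congr fun p hp => h.eq p hp i j
  symm p hp i j := by
    rw [h.eq p hp, h.eq p hp]
    ring
  det_ne_zero p hp := by
    have : (G p).det = -(L 0 p * K 1 p - L 1 p * K 0 p) ^ 2 := by
      rw [Matrix.det_fin_two]
      simp only [h.eq p hp]
      ring
    rw [this]
    exact neg_ne_zero.2 (pow_ne_zero _ (h.wedge_ne_zero p hp))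

theorem frameComponent_eq (h : IsNullFrame G L K U) (hp : p ∈ U) (ρ : (Fin 2 → ℝ) → ℝ) :
    frameComponent L K ρ p = K 0 p * gradUp G ρ 0 p + K 1 p * gradUp G ρ 1 p := by
  have hW := h.wedge_ne_zero p hp
  have e := fun k => (h.isMetricOn.sum_lower_gradUp hp ρ k).trans (h.partialD_eq hp ρ k)
  simp only [Fin.sum_univ_two, h.eq p hp] at e
  refine mul_left_cancel₀ hW ?_
  linear_combination K 0 p * e 1 - K 1 p * e 0

theorem gradNormSq_eq (h : IsNullFrame G L K U) (hp : p ∈ U) (ρ : (Fin 2 → ℝ) → ℝ) :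
    gradNormSq G ρ p = 2 * frameComponent L K ρ p * frameComponent K L ρ p := by
  rw [gradNormSq, Fin.sum_univ_two, h.partialD_eq hp, h.partialD_eq hp]
  have e1 := h.frameComponent_eq hp ρ
  have e2 := h.swap.frameComponent_eq hp ρ
  linear_combination -frameComponent L K ρ p * e2 - frameComponent K L ρ p * e1

theorem partialD_metric (h : IsNullFrame G L K U) (hp : p ∈ U) (k i j : Fin 2) :
    partialD k (fun q => G q i j) p = partialD k (L i) p * K j p + L i p * partialD k (K j) p
      + (partialD k (K i) p * L j p + K i p * partialD k (L j) p) := by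
  have hL := fun i => (h.smooth_left i).differentiableAt_of_isOpen h.isOpen hp
  have hK := fun i => (h.smooth_right i).differentiableAt_of_isOpen h.isOpen hp
  rw [partialD_congr_of_eqOn k h.isOpen (fun q hq => h.eq q hq i j) hp,
    partialD_add k ((hL i).fun_mul (hK j)) ((hK i).fun_mul (hL j)), partialD_mul k (hL i) (hK j),
    partialD_mul k (hK i) (hL j)]

/-- If `∇∇ρ = φ G` and `dρ = a L + b K`, then `da - a θ = φ K`. -/
theorem partialD_frameComponent (h : IsNullFrame G L K U) (hp : p ∈ U) (hρ : ContDiffOn ℝ ∞ ρ U)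
    {φ : ℝ} (hφ : ∀ i j, hessian G ρ i j p = φ * G p i j) (i : Fin 2) :
    partialD i (frameComponent L K ρ) p
      = frameComponent L K ρ p * frameConnection L K i p + φ * K i p := by
  have hW := h.wedge_ne_zero p hp
  have hL := fun i => (h.smooth_left i).differentiableAt_of_isOpen h.isOpen hp
  have hK := fun i => (h.smooth_right i).differentiableAt_of_isOpen h.isOpen hp
  have ha := (h.smooth_frameComponent hρ).differentiableAt_of_isOpen h.isOpen hp
  have hb := (h.swap.smooth_frameComponent hρ).differentiableAt_of_isOpen h.isOpen hp
  have e1 : ∀ j, partialD i (partialD j ρ) p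
      = partialD i (frameComponent L K ρ) p * L j p
        + frameComponent L K ρ p * partialD i (L j) p
        + (partialD i (frameComponent K L ρ) p * K j p
        + frameComponent K L ρ p * partialD i (K j) p) := by
    intro j
    rw [partialD_congr_of_eqOn i h.isOpen (fun q hq => h.partialD_eq hq ρ j) hp,
      partialD_add i (ha.fun_mul (hL j)) (hb.fun_mul (hK j)), partialD_mul i ha (hL j),
      partialD_mul i hb (hK j)]
  have e2 := fun j => hφ i j
  simp only [h.isMetricOn.hessian_eq hp, e1, Fin.sum_univ_two, christoffelDown,
    h.partialD_metric hp, h.eq p hp, h.frameComponent_eq hp, h.swap.frameComponent_eq hp] at e2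
  have e3 := e2 0
  have e4 := e2 1
  rw [frameConnection, curl, curl, h.frameComponent_eq hp, mul_div_assoc', ← sub_eq_iff_eq_add,
    eq_div_iff hW]
  clear e1 e2
  generalize partialD i (frameComponent L K ρ) p = a' at *
  generalize partialD i (frameComponent K L ρ) p = b' at *
  generalize gradUp G ρ 0 p = x at *
  generalize gradUp G ρ 1 p = y at *
  fin_cases i <;> simp only [Fin.zero_eta, Fin.mk_one] at e3 e4 ⊢ <;>
    linear_combination K 1 p * e3 - K 0 p * e4

theorem curl_left (h : IsNullFrame G L K U) (hp : p ∈ U) :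
    curl L p = L 0 p * frameConnection L K 1 p - L 1 p * frameConnection L K 0 p := by
  have hW := h.wedge_ne_zero p hp
  rw [frameConnection, frameConnection, mul_div_assoc', mul_div_assoc', ← sub_div, eq_div_iff hW]
  ring

/-- The null one-form `L / b`, where `dρ = a L + b K`, is closed. -/
theorem closed_left_div (h : IsNullFrame G L K U) (hp : p ∈ U) (hρ : ContDiffOn ℝ ∞ ρ U)
    {φ : ℝ} (hφ : ∀ i j, hessian G ρ i j p = φ * G p i j) (hb : frameComponent K L ρ p ≠ 0) :
    partialD 0 (fun q => L 1 q / frameComponent K L ρ q) p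
      = partialD 1 (fun q => L 0 q / frameComponent K L ρ q) p := by
  have hL := fun i => (h.smooth_left i).differentiableAt_of_isOpen h.isOpen hp
  have hd := (h.swap.smooth_frameComponent hρ).differentiableAt_of_isOpen h.isOpen hp
  have hc := h.curl_left hp
  rw [curl] at hc
  rw [partialD_div 0 (hL 1) hd hb, partialD_div 1 (hL 0) hd hb,
    h.swap.partialD_frameComponent hp hρ hφ, h.swap.partialD_frameComponent hp hρ hφ,
    frameConnection_swap L K, frameConnection_swap L K]
  congr 1
  linear_combination frameComponent K L ρ p * hc

end IsNullFrame

/-- A metric of Lorentzian signature on an open subset of the plane has null coframes locally. -/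
theorem IsMetricOn.exists_isNullFrame (h : IsMetricOn G U) (hp : p ∈ U)
    (hdet : ∀ q ∈ U, (G q).det < 0) :
    ∃ (L K : Fin 2 → (Fin 2 → ℝ) → ℝ) (V : Set (Fin 2 → ℝ)), V ⊆ U ∧ p ∈ V ∧
      IsNullFrame G L K V := by
  have hD : ∀ q ∈ U, -(G q).det ≠ 0 := fun q hq => neg_ne_zero.2 (hdet q hq).ne
  -- A square root `s` of `-det G`, of the sign for which `G 0 1 + s` does not vanish at `p`.
  obtain ⟨s, hss, hs2, hsp⟩ : ∃ s : (Fin 2 → ℝ) → ℝ, ContDiffOn ℝ ∞ s U ∧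
      (∀ q ∈ U, s q ^ 2 = -(G q).det) ∧ G p 0 1 + s p ≠ 0 := by
    have h1 : ContDiffOn ℝ ∞ (fun q => Real.sqrt (-(G q).det)) U :=
      (contDiffOn_det h.smooth).neg.sqrt hD
    have h2 : ∀ q ∈ U, Real.sqrt (-(G q).det) ^ 2 = -(G q).det := fun q hq =>
      Real.sq_sqrt (neg_nonneg.2 (hdet q hq).le)
    by_cases hB : G p 0 1 + Real.sqrt (-(G p).det) = 0
    · refine ⟨_, h1.neg, fun q hq => by rw [neg_sq, h2 q hq], fun h3 => ?_⟩
      have h4 := Real.sqrt_pos.2 (neg_pos.2 (hdet p hp))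
      linarith
    · exact ⟨_, h1, h2, hB⟩
  have hs0 : ∀ q ∈ U, s q ≠ 0 := fun q hq h0 => hD q hq (by rw [← hs2 q hq, h0]; ring)
  have hbs : ContDiffOn ℝ ∞ (fun q => G q 0 1 + s q) U := (h.smooth 0 1).add hss
  set V : Set (Fin 2 → ℝ) := U ∩ (fun q => G q 0 1 + s q) ⁻¹' {0}ᶜ with hV
  have hVo : IsOpen V :=
    hbs.continuousOn.isOpen_inter_preimage h.isOpen isOpen_compl_singleton
  have hVU : V ⊆ U := inter_subset_left
  have hA : ∀ q ∈ V, 2 * (G q 0 1 + s q) ≠ 0 := fun q hq => mul_ne_zero two_ne_zero hq.2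
  have sm := fun i j => (h.smooth i j).mono hVU
  have hbs' := hbs.mono hVU
  refine ⟨fun i => if i = 0 then fun q => G q 0 0 else fun q => G q 0 1 + s q,
    fun i => if i = 0 then fun _ => 1 / 2 else fun q => G q 1 1 / (2 * (G q 0 1 + s q)),
    V, hVU, ⟨hp, hsp⟩, hVo, fun i => ?_, fun i => ?_, fun q hq i j => ?_, fun q hq => ?_⟩
  · fin_cases i
    · exact sm 0 0
    · exact hbs'
  · fin_cases i
    · exact contDiffOn_const
    · exact (sm 1 1).div (hbs'.const_smul (2 : ℝ)) hA
  · have hA' : G q 0 1 + s q ≠ 0 := hq.2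
    have h2 := hs2 q (hVU hq)
    have h3 := h.symm q (hVU hq) 1 0
    rw [Matrix.det_fin_two, h3] at h2
    fin_cases i <;> fin_cases j <;> simp only [Fin.zero_eta, Fin.mk_one, if_true, if_false,
      one_ne_zero, h3] <;> field_simp <;> first | ring1 | linear_combination -h2
  · have hA' : G q 0 1 + s q ≠ 0 := hq.2
    have h2 := hs2 q (hVU hq)
    have h3 := h.symm q (hVU hq) 1 0
    rw [Matrix.det_fin_two, h3] at h2
    have : G q 0 0 * (G q 1 1 / (2 * (G q 0 1 + s q))) - (G q 0 1 + s q) * (1 / 2) = -s q := by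
      field_simp
      linear_combination h2
    simpa only [if_true, if_false, one_ne_zero, this, neg_ne_zero] using hs0 q (hVU hq)

end NullFrame

/-! ### Local normal forms of the base metric -/

section NormalForm

variable {G : (Fin 2 → ℝ) → Matrix (Fin 2) (Fin 2) ℝ} {L K : Fin 2 → (Fin 2 → ℝ) → ℝ}
  {U : Set (Fin 2 → ℝ)} {p : Fin 2 → ℝ} {ρ : (Fin 2 → ℝ) → ℝ} {f : ℝ → ℝ}

/-- The retarded or advanced time: if `dρ = a L + b K` with `b ≠ 0`, then `L / b = dv` and
`G = -f dv² + 2 dv dρ`. -/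
theorem IsBirkhoffBase.exists_null_coordinate (hB : IsBirkhoffBase f G ρ U)
    (h : IsNullFrame G L K U) (hU : Convex ℝ U) (hb : ∀ q ∈ U, frameComponent K L ρ q ≠ 0) :
    ∃ v : (Fin 2 → ℝ) → ℝ, ContDiffOn ℝ ∞ v U ∧ ∀ q ∈ U, ∀ i j,
      G q i j = -f (ρ q) * partialD i v q * partialD j v q + partialD i v q * partialD j ρ q
        + partialD j v q * partialD i ρ q := by
  obtain ⟨v, hv, hvd⟩ := exists_partialD_eq_of_closed h.isOpen hU
    (η := fun i q => L i q / frameComponent K L ρ q)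
    (fun i => (h.smooth_left i).div (h.swap.smooth_frameComponent hB.smooth) hb)
    (fun q hq i j => by
      have := h.closed_left_div hq hB.smooth (hB.hessian_eq q hq) (hb q hq)
      fin_cases i <;> fin_cases j
      exacts [rfl, this, this.symm, rfl])
  refine ⟨v, hv, fun q hq i j => ?_⟩
  have hb' := hb q hq
  rw [hvd q hq, hvd q hq, h.partialD_eq hq, h.partialD_eq hq, ← hB.gradNormSq_eq q hq,
    h.gradNormSq_eq hq, h.eq q hq]
  field_simp
  ring

theorem IsBirkhoffBase.exists_eddington (hB : IsBirkhoffBase f G ρ U) (hp : p ∈ U)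
    (hdet : ∀ q ∈ U, (G q).det < 0) (hd : fderiv ℝ ρ p ≠ 0) :
    ∃ (V : Set (Fin 2 → ℝ)) (v : (Fin 2 → ℝ) → ℝ), IsOpen V ∧ V ⊆ U ∧ p ∈ V ∧
      ContDiffOn ℝ ∞ v V ∧ ∀ q ∈ V, ∀ i j,
      G q i j = -f (ρ q) * partialD i v q * partialD j v q + partialD i v q * partialD j ρ q
        + partialD j v q * partialD i ρ q := by
  obtain ⟨L, K, V, hVU, hpV, h⟩ := hB.metric.exists_isNullFrame hp hdet
  obtain ⟨L, K, h, hb⟩ : ∃ L K, IsNullFrame G L K V ∧ frameComponent K L ρ p ≠ 0 := by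
    by_contra! hne
    refine hd (fderiv_eq_zero_iff_partialD.2 fun i => ?_)
    rw [h.partialD_eq hpV, hne L K h, hne K L h.swap]
    ring
  have hbc := (h.swap.smooth_frameComponent (hB.smooth.mono hVU)).continuousOn
  have hW : IsOpen (V ∩ frameComponent K L ρ ⁻¹' {0}ᶜ) :=
    hbc.isOpen_inter_preimage h.isOpen isOpen_compl_singleton
  obtain ⟨ε, hε, hball⟩ := Metric.isOpen_iff.1 hW p ⟨hpV, hb⟩
  have hbV : Metric.ball p ε ⊆ V := fun q hq => (hball hq).1
  obtain ⟨v, hv⟩ := (hB.mono Metric.isOpen_ball (hbV.trans hVU)).exists_null_coordinate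
    (h.mono Metric.isOpen_ball hbV) (convex_ball p ε) fun q hq => (hball hq).2
  exact ⟨_, v, Metric.isOpen_ball, hbV.trans hVU, Metric.mem_ball_self hε, hv⟩

end NormalForm

section Bifurcation

/-- A Gronwall argument on segments. -/
theorem eq_zero_of_norm_fderiv_le {E F : Type*} [NormedAddCommGroup E] [NormedSpace ℝ E]
    [NormedAddCommGroup F] [NormedSpace ℝ F] {S : Set E} (hS : Convex ℝ S) {Z : E → F} {C : ℝ}
    (hd : ∀ q ∈ S, DifferentiableAt ℝ Z q) (hC : ∀ q ∈ S, ‖fderiv ℝ Z q‖ ≤ C * ‖Z q‖)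
    {x q : E} (hx : x ∈ S) (hq : q ∈ S) (h0 : Z x = 0) : Z q = 0 := by
  set c : ℝ → E := fun t => x + t • (q - x) with hc
  have hcS : ∀ t ∈ Icc (0 : ℝ) 1, c t ∈ S := fun t ht => hS.add_smul_sub_mem hx hq ht
  have hcd : ∀ t, HasDerivAt c (q - x) t := fun t =>
    (((hasDerivAt_id t).smul_const (q - x)).const_add x).congr_deriv (one_smul _ _)
  have hZd : ∀ t ∈ Icc (0 : ℝ) 1, HasDerivAt (fun t => Z (c t)) (fderiv ℝ Z (c t) (q - x)) t :=
    fun t ht => (hd _ (hcS t ht)).hasFDerivAt.comp_hasDerivAt t (hcd t)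
  have := eq_zero_of_abs_deriv_le_mul_abs_self_of_eq_zero_right (f := fun t => Z (c t))
    (f' := fun t => fderiv ℝ Z (c t) (q - x)) (K := C * ‖q - x‖) (a := 0) (b := 1)
    (fun t ht => (hZd t ht).continuousAt.continuousWithinAt)
    (fun t ht => (hZd t (Ico_subset_Icc_self ht)).hasDerivWithinAt)
    (by simp [hc, h0])
    (fun t ht => by
      have h1 := (fderiv ℝ Z (c t)).le_opNorm (q - x)
      have h2 := mul_le_mul_of_nonneg_right (hC _ (hcS t (Ico_subset_Icc_self ht)))
        (norm_nonneg (q - x))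
      linarith) 1 (by simp)
  simpa [hc] using this

theorem norm_fderiv_le_of_partialD {F : (Fin 2 → ℝ) → ℝ} {p : Fin 2 → ℝ} {C : ℝ}
    (h : ∀ i, |partialD i F p| ≤ C) : ‖fderiv ℝ F p‖ ≤ 2 * C := by
  have hC : 0 ≤ C := (abs_nonneg _).trans (h 0)
  refine ContinuousLinearMap.opNorm_le_bound _ (by positivity) fun v => ?_
  rw [fderiv_apply_eq_sum_partialD, Fin.sum_univ_two, Real.norm_eq_abs]
  refine (abs_add_le _ _).trans ?_
  rw [abs_mul, abs_mul]
  have h0 := mul_le_mul (norm_le_pi_norm v 0) (h 0) (abs_nonneg _) (norm_nonneg _)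
  have h1 := mul_le_mul (norm_le_pi_norm v 1) (h 1) (abs_nonneg _) (norm_nonneg _)
  simp only [Real.norm_eq_abs] at h0 h1
  linarith

variable {G : (Fin 2 → ℝ) → Matrix (Fin 2) (Fin 2) ℝ} {L K : Fin 2 → (Fin 2 → ℝ) → ℝ}
  {U : Set (Fin 2 → ℝ)} {p : Fin 2 → ℝ} {ρ : (Fin 2 → ℝ) → ℝ} {f : ℝ → ℝ}

/-- Unique continuation: if `dρ = 0` at a point where `f'(ρ) = 0`, then `ρ` is constant near it.
The functions `ρ - ρ(p)`, `a` and `b`, where `dρ = a L + b K`, satisfy a homogeneous linear system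
of first order. -/
theorem IsBirkhoffBase.eventually_eq_of_deriv_eq_zero (hB : IsBirkhoffBase f G ρ U)
    (h : IsNullFrame G L K U) (hp : p ∈ U) (hd : fderiv ℝ ρ p = 0) {Q : ℝ → ℝ}
    (hQ : ContinuousAt Q (ρ p)) (hf : ∀ᶠ r in 𝓝 (ρ p), deriv f r = (r - ρ p) * Q r) :
    ∀ᶠ q in 𝓝 p, ρ q = ρ p := by
  have hρc : ContinuousAt ρ p := (hB.smooth.contDiffAt (h.isOpen.mem_nhds hp)).continuousAt
  have ca : ∀ {F : (Fin 2 → ℝ) → ℝ}, ContDiffOn ℝ ∞ F U → ContinuousAt F p :=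
    fun hF => (hF.contDiffAt (h.isOpen.mem_nhds hp)).continuousAt
  have hbd : ∀ {F : (Fin 2 → ℝ) → ℝ}, ContinuousAt F p → ∀ᶠ q in 𝓝 p, |F q| ≤ |F p| + 1 := by
    intro F hF
    filter_upwards [hF.abs.eventually (gt_mem_nhds (lt_add_one |F p|))] with q hq using hq.le
  have hall : ∀ {F : Fin 2 → (Fin 2 → ℝ) → ℝ}, (∀ i, ContinuousAt (F i) p) →
      ∀ᶠ q in 𝓝 p, ∀ i, |F i q| ≤ |F 0 p| + |F 1 p| + 1 := by
    intro F hF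
    filter_upwards [hbd (hF 0), hbd (hF 1)] with q h0 h1 i
    have := abs_nonneg (F 0 p)
    have := abs_nonneg (F 1 p)
    fin_cases i <;> simp only [Fin.zero_eta, Fin.mk_one] <;> linarith
  have hQc : ContinuousAt (fun q => Q (ρ q)) p := ContinuousAt.comp hQ hρc
  set C : ℝ := (|L 0 p| + |L 1 p| + 1) + (|K 0 p| + |K 1 p| + 1)
    + (|frameConnection L K 0 p| + |frameConnection L K 1 p| + 1)
    + (|Q (ρ p)| + 1) * (|L 0 p| + |L 1 p| + 1) + (|Q (ρ p)| + 1) * (|K 0 p| + |K 1 p| + 1)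
    with hC
  have hev : ∀ᶠ q in 𝓝 p, q ∈ U ∧ deriv f (ρ q) = (ρ q - ρ p) * Q (ρ q) ∧ (∀ i, |L i q| ≤ C)
      ∧ (∀ i, |K i q| ≤ C) ∧ (∀ i, |frameConnection L K i q| ≤ C) ∧ (∀ i, |Q (ρ q) * L i q| ≤ C)
      ∧ ∀ i, |Q (ρ q) * K i q| ≤ C := by
    have hLL := hall fun i => ca (h.smooth_left i)
    have hKK := hall fun i => ca (h.smooth_right i)
    filter_upwards [h.isOpen.mem_nhds hp, hρc.eventually hf, hLL, hKK,
      hall fun i => ca (h.smooth_frameConnection i), hbd hQc] with q h1 h2 h3 h4 h5 h6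
    have n1 : 0 ≤ |L 0 p| + |L 1 p| + 1 := by positivity
    have n2 : 0 ≤ |K 0 p| + |K 1 p| + 1 := by positivity
    have n3 : 0 ≤ |frameConnection L K 0 p| + |frameConnection L K 1 p| + 1 := by positivity
    have n4 : 0 ≤ (|Q (ρ p)| + 1) * (|L 0 p| + |L 1 p| + 1) := by positivity
    have n5 : 0 ≤ (|Q (ρ p)| + 1) * (|K 0 p| + |K 1 p| + 1) := by positivity
    refine ⟨h1, h2, fun i => (h3 i).trans (by linarith), fun i => (h4 i).trans (by linarith),
      fun i => (h5 i).trans (by linarith), fun i => ?_, fun i => ?_⟩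
    · rw [abs_mul]
      exact (mul_le_mul h6 (h3 i) (abs_nonneg _) (by positivity)).trans (by linarith)
    · rw [abs_mul]
      exact (mul_le_mul h6 (h4 i) (abs_nonneg _) (by positivity)).trans (by linarith)
  obtain ⟨ε, hε, hball⟩ := Metric.eventually_nhds_iff_ball.1 hev
  set a := frameComponent L K ρ with ha
  set b := frameComponent K L ρ with hb
  set Z : (Fin 2 → ℝ) → ℝ × ℝ × ℝ := fun q => (ρ q - ρ p, a q, b q) with hZ
  have hW := h.wedge_ne_zero p hp
  have hfd0 := fderiv_eq_zero_iff_partialD.1 hd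
  have hZ0 : Z p = 0 := by
    simp [hZ, ha, hb, frameComponent, hfd0]
  have dρ : ∀ q ∈ U, DifferentiableAt ℝ ρ q := fun q hq =>
    hB.smooth.differentiableAt_of_isOpen h.isOpen hq
  have da : ∀ q ∈ U, DifferentiableAt ℝ a q := fun q hq =>
    (h.smooth_frameComponent hB.smooth).differentiableAt_of_isOpen h.isOpen hq
  have db : ∀ q ∈ U, DifferentiableAt ℝ b q := fun q hq =>
    (h.swap.smooth_frameComponent hB.smooth).differentiableAt_of_isOpen h.isOpen hq
  refine Metric.eventually_nhds_iff_ball.2 ⟨ε, hε, fun q hq => ?_⟩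
  have hz : Z q = 0 := by
    refine eq_zero_of_norm_fderiv_le (convex_ball p ε) (C := 4 * C) (fun q hq => ?_)
      (fun q hq => ?_) (Metric.mem_ball_self hε) hq hZ0
    · have hqU := (hball q hq).1
      exact ((dρ q hqU).sub_const _).prodMk ((da q hqU).prodMk (db q hqU))
    · obtain ⟨hqU, h2, hL, hK, hθ, hQL, hQK⟩ := hball q hq
      have hs : |ρ q - ρ p| ≤ ‖Z q‖ := norm_fst_le (Z q)
      have han : |a q| ≤ ‖Z q‖ := (norm_fst_le (Z q).2).trans (norm_snd_le (Z q))
      have hbn : |b q| ≤ ‖Z q‖ := (norm_snd_le (Z q).2).trans (norm_snd_le (Z q))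
      have hn := norm_nonneg (Z q)
      have hφ := hB.hessian_eq q hqU
      have two : ∀ {u v x y : ℝ}, |u| ≤ ‖Z q‖ → |v| ≤ ‖Z q‖ → |x| ≤ C → |y| ≤ C →
          |u * x + v * y| ≤ 2 * C * ‖Z q‖ := by
        intro u v x y hu hv hx hy
        refine (abs_add_le _ _).trans ?_
        rw [abs_mul, abs_mul]
        have := mul_le_mul hu hx (abs_nonneg _) hn
        have := mul_le_mul hv hy (abs_nonneg _) hn
        linarith
      have hhalf : |1 / 2 * (ρ q - ρ p)| ≤ ‖Z q‖ := by
        rw [abs_mul, abs_of_pos (by norm_num : (0 : ℝ) < 1 / 2)]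
        linarith [abs_nonneg (ρ q - ρ p)]
      have b1 : ‖fderiv ℝ (fun q => ρ q - ρ p) q‖ ≤ 2 * (2 * C * ‖Z q‖) := by
        refine norm_fderiv_le_of_partialD fun i => ?_
        rw [partialD_sub i (dρ q hqU) (differentiableAt_const _), partialD_const, sub_zero,
          h.partialD_eq hqU]
        exact two han hbn (hL i) (hK i)
      have b2 : ‖fderiv ℝ a q‖ ≤ 2 * (2 * C * ‖Z q‖) := by
        refine norm_fderiv_le_of_partialD fun i => ?_
        rw [ha, h.partialD_frameComponent hqU hB.smooth hφ, h2,
          show 1 / 2 * ((ρ q - ρ p) * Q (ρ q)) * K i q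
            = 1 / 2 * (ρ q - ρ p) * (Q (ρ q) * K i q) by ring]
        exact two han hhalf (hθ i) (hQK i)
      have b3 : ‖fderiv ℝ b q‖ ≤ 2 * (2 * C * ‖Z q‖) := by
        refine norm_fderiv_le_of_partialD fun i => ?_
        rw [hb, h.swap.partialD_frameComponent hqU hB.smooth hφ, h2,
          show 1 / 2 * ((ρ q - ρ p) * Q (ρ q)) * L i q
            = 1 / 2 * (ρ q - ρ p) * (Q (ρ q) * L i q) by ring]
        refine two hbn hhalf ?_ (hQL i)
        rw [IsNullFrame.frameConnection_swap, abs_neg]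
        exact hθ i
      have e : fderiv ℝ Z q
          = (fderiv ℝ (fun q => ρ q - ρ p) q).prod ((fderiv ℝ a q).prod (fderiv ℝ b q)) :=
        (((dρ q hqU).sub_const _).hasFDerivAt.prodMk
          ((da q hqU).hasFDerivAt.prodMk (db q hqU).hasFDerivAt)).fderiv
      rw [e]
      refine ContinuousLinearMap.opNorm_le_bound _ ?_ fun w => ?_
      · exact mul_nonneg (mul_nonneg (by norm_num) ((abs_nonneg _).trans (hL 0))) hn
      · refine max_le (((fderiv ℝ (fun q => ρ q - ρ p) q).le_of_opNorm_le b1 w).trans_eq ?_)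
          (max_le (((fderiv ℝ a q).le_of_opNorm_le b2 w).trans_eq ?_)
            (((fderiv ℝ b q).le_of_opNorm_le b3 w).trans_eq ?_)) <;> ring
  have : ρ q - ρ p = 0 := congrArg Prod.fst hz
  linarith

/-- Israel's coordinates at a bifurcation point, where `dρ = 0`, for
`f(r) = (r - r₀) E(r)` and `E(r) = 2 κ + (r - r₀) D(r)`: functions `X` and `Y` with
`ρ = r₀ + X Y` and `G = 2/κ dX dY - Y²/κ² D(ρ) dX²`.

With `dρ = a L + b K`, the function `X` is `b e^w` where `dX = κ e^w L`; the one-form `dw` is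
closed because it is `κ L/b - db/b` where `b ≠ 0`. -/
theorem IsBirkhoffBase.exists_israel (hB : IsBirkhoffBase f G ρ U) (h : IsNullFrame G L K U)
    (hU : Convex ℝ U) {r₀ κ : ℝ} (hκ : κ ≠ 0) {E D : ℝ → ℝ} {I : Set ℝ} (hI : IsOpen I)
    (hE : ContDiffOn ℝ ∞ E I) (hD : ContDiffOn ℝ ∞ D I) (hfE : ∀ r ∈ I, f r = (r - r₀) * E r)
    (hED : ∀ r ∈ I, E r = 2 * κ + (r - r₀) * D r) (hE0 : ∀ r ∈ I, E r ≠ 0)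
    (hf' : ∀ r ∈ I, deriv f r ≠ 0) (hUI : MapsTo ρ U I) :
    ∃ X Y : (Fin 2 → ℝ) → ℝ, ContDiffOn ℝ ∞ X U ∧ ContDiffOn ℝ ∞ Y U ∧
      (∀ q ∈ U, ρ q = r₀ + X q * Y q) ∧
      (∀ q ∈ U, partialD 0 ρ q = 0 → partialD 1 ρ q = 0 → X q = 0 ∧ Y q = 0) ∧
      ∀ q ∈ U, ∀ i j, G q i j
        = 1 / κ * (partialD i X q * partialD j Y q + partialD j X q * partialD i Y q)
          - Y q ^ 2 / κ ^ 2 * D (ρ q) * (partialD i X q * partialD j X q) := by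
  set a := frameComponent L K ρ with ha
  set b := frameComponent K L ρ with hb
  have hdE : ∀ r ∈ I, DifferentiableAt ℝ E r := fun r hr =>
    (hE.contDiffAt (hI.mem_nhds hr)).differentiableAt (by simp)
  have hE's : ContDiffOn ℝ ∞ (deriv E) I := hE.deriv_of_isOpen hI (by simp)
  have hf'E : ∀ r ∈ I, deriv f r = E r + (r - r₀) * deriv E r := by
    intro r hr
    have h1 : f =ᶠ[𝓝 r] fun r => (r - r₀) * E r :=
      Filter.eventuallyEq_of_mem (hI.mem_nhds hr) hfE
    rw [h1.deriv_eq]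
    have := (((hasDerivAt_id r).sub_const r₀).fun_mul (hdE r hr).hasDerivAt).deriv
    simpa using this
  have hEρ : ContDiffOn ℝ ∞ (fun q => E (ρ q)) U := hE.comp hB.smooth hUI
  have hE'ρ : ContDiffOn ℝ ∞ (fun q => deriv E (ρ q)) U := hE's.comp hB.smooth hUI
  have hDρ : ContDiffOn ℝ ∞ (fun q => D (ρ q)) U := hD.comp hB.smooth hUI
  have has : ContDiffOn ℝ ∞ a U := h.smooth_frameComponent hB.smooth
  have hbs : ContDiffOn ℝ ∞ b U := h.swap.smooth_frameComponent hB.smooth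
  have hEρ0 : ∀ q ∈ U, E (ρ q) ≠ 0 := fun q hq => hE0 _ (hUI hq)
  have hab : ∀ q ∈ U, 2 * a q * b q = (ρ q - r₀) * E (ρ q) := by
    intro q hq
    rw [ha, hb, ← h.gradNormSq_eq hq, hB.gradNormSq_eq q hq, hfE _ (hUI hq)]
  set η : Fin 2 → (Fin 2 → ℝ) → ℝ := fun i q => frameConnection L K i q
    - a q * (D (ρ q) + deriv E (ρ q)) / E (ρ q) * L i q with hη
  have hηs : ∀ i, ContDiffOn ℝ ∞ (η i) U := fun i =>
    (h.smooth_frameConnection i).sub (((has.mul (hDρ.add hE'ρ)).div hEρ hEρ0).mul (h.smooth_left i))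
  have pa : ∀ q ∈ U, ∀ i, partialD i a q = a q * frameConnection L K i q
      + 1 / 2 * deriv f (ρ q) * K i q := fun q hq i =>
    h.partialD_frameComponent hq hB.smooth (hB.hessian_eq q hq) i
  have pb : ∀ q ∈ U, ∀ i, partialD i b q = -(b q * frameConnection L K i q)
      + 1 / 2 * deriv f (ρ q) * L i q := by
    intro q hq i
    rw [hb, h.swap.partialD_frameComponent hq hB.smooth (hB.hessian_eq q hq) i,
      IsNullFrame.frameConnection_swap]
    ring
  -- The one-form `η` is `κ L/b - db/b` where `b ≠ 0`, and smooth where `b = 0`.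
  have hbη : ∀ q ∈ U, ∀ i, b q * η i q = κ * L i q - partialD i b q := by
    intro q hq i
    have e1 := hab q hq
    have e2 := hf'E _ (hUI hq)
    have e3 := hED _ (hUI hq)
    have e0 := hEρ0 q hq
    rw [pb q hq, hη, e2]
    have e4 : b q * (a q * (D (ρ q) + deriv E (ρ q)) / E (ρ q) * L i q)
        = 1 / 2 * (2 * a q * b q) * (D (ρ q) + deriv E (ρ q)) / E (ρ q) * L i q := by ring
    have e5 : b q * (a q * (D (ρ q) + deriv E (ρ q)) / E (ρ q) * L i q)
        = 1 / 2 * (ρ q - r₀) * (D (ρ q) + deriv E (ρ q)) * L i q := by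
      rw [e4, e1]
      field_simp
    simp only [mul_sub, e5]
    linear_combination L i q / 2 * e3
  have hbcurl : ∀ q ∈ U, b q * curl η q = 0 := by
    intro q hq
    have dη := fun i => (hηs i).differentiableAt_of_isOpen h.isOpen hq
    have dL := fun i => (h.smooth_left i).differentiableAt_of_isOpen h.isOpen hq
    have db := hbs.differentiableAt_of_isOpen h.isOpen hq
    have dpb := fun i => (hbs.partialD i h.isOpen).differentiableAt_of_isOpen h.isOpen hq
    have e : ∀ i j, partialD i b q * η j q + b q * partialD i (η j) q
        = κ * partialD i (L j) q - partialD i (partialD j b) q := by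
      intro i j
      rw [← partialD_mul i db (dη j), ← partialD_const_mul i κ (dL j),
        ← partialD_sub i ((dL j).const_mul κ) (dpb j)]
      exact partialD_congr_of_eqOn i h.isOpen (fun q hq => hbη q hq j) hq
    have e01 := e 0 1
    have e10 := e 1 0
    have hc := h.curl_left hq
    rw [curl] at hc ⊢
    have b0 := hbη q hq 0
    have b1 := hbη q hq 1
    have η0 : η 0 q = frameConnection L K 0 q
      - a q * (D (ρ q) + deriv E (ρ q)) / E (ρ q) * L 0 q := rfl
    have η1 : η 1 q = frameConnection L K 1 q
      - a q * (D (ρ q) + deriv E (ρ q)) / E (ρ q) * L 1 q := rfl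
    have comm := partialD_comm 0 1 hbs h.isOpen hq
    have e6 : κ * (L 0 q * η 1 q - L 1 q * η 0 q)
        = κ * (partialD 0 (L 1) q - partialD 1 (L 0) q) := by
      rw [η0, η1, hc]
      ring
    linear_combination e01 - e10 - comm - e6 - η 1 q * b0 + η 0 q * b1
  have hcurl : ∀ q ∈ U, curl η q = 0 := by
    intro q hq
    by_contra hne
    have hcs : ContinuousOn (curl η) U := (IsNullFrame.smooth_curl h.isOpen hηs).continuousOn
    have hev : b =ᶠ[𝓝 q] fun _ => 0 := by
      filter_upwards [h.isOpen.mem_nhds hq,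
        ((hcs.continuousAt (h.isOpen.mem_nhds hq)).eventually_ne hne)] with z hz hz'
      exact (mul_eq_zero.1 (hbcurl z hz)).resolve_right hz'
    have hb0 : b q = 0 := hev.eq_of_nhds
    have hL0 : ∀ i, L i q = 0 := by
      intro i
      have e1 := pb q hq i
      rw [partialD_congr i hev, partialD_const, hb0, zero_mul, neg_zero, zero_add] at e1
      exact (mul_eq_zero.1 e1.symm).resolve_left
        (mul_ne_zero (by norm_num) (hf' _ (hUI hq)))
    exact h.wedge_ne_zero q hq (by rw [hL0, hL0]; ring)
  obtain ⟨w, hw, hwd⟩ := exists_partialD_eq_of_closed h.isOpen hU hηs fun q hq i j => by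
    have := hcurl q hq
    rw [curl] at this
    fin_cases i <;> fin_cases j
    exacts [rfl, sub_eq_zero.1 this, (sub_eq_zero.1 this).symm, rfl]
  have hexp : ContDiffOn ℝ ∞ (fun q => Real.exp (w q)) U := hw.exp
  have hexp' : ContDiffOn ℝ ∞ (fun q => Real.exp (-w q)) U := hw.neg.exp
  have hee : ∀ q, Real.exp (w q) * Real.exp (-w q) = 1 := fun q => by
    rw [← Real.exp_add, add_neg_cancel, Real.exp_zero]
  have pX : ∀ q ∈ U, ∀ i, partialD i (fun q => b q * Real.exp (w q)) q
      = κ * Real.exp (w q) * L i q := by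
    intro q hq i
    have dw := hw.differentiableAt_of_isOpen h.isOpen hq
    have db := hbs.differentiableAt_of_isOpen h.isOpen hq
    have de := hexp.differentiableAt_of_isOpen h.isOpen hq
    rw [partialD_mul i db de, partialD_comp i Real.differentiableAt_exp dw, Real.deriv_exp,
      hwd q hq]
    linear_combination Real.exp (w q) * hbη q hq i
  have pY : ∀ q ∈ U, ∀ i, partialD i (fun q => 2 * a q / E (ρ q) * Real.exp (-w q)) q
      = Real.exp (-w q) * (K i q + 2 * a q ^ 2 / E (ρ q) ^ 2 * D (ρ q) * L i q) := by
    intro q hq i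
    have dw := hw.differentiableAt_of_isOpen h.isOpen hq
    have dρ := hB.smooth.differentiableAt_of_isOpen h.isOpen hq
    have da := has.differentiableAt_of_isOpen h.isOpen hq
    have de := hexp'.differentiableAt_of_isOpen h.isOpen hq
    have dE := hEρ.differentiableAt_of_isOpen h.isOpen hq
    have e0 := hEρ0 q hq
    have dq : DifferentiableAt ℝ (fun q => 2 * a q / E (ρ q)) q :=
      ((has.const_smul (2 : ℝ)).div hEρ hEρ0).differentiableAt_of_isOpen h.isOpen hq
    have pw : partialD i (fun q => Real.exp (-w q)) q = -(Real.exp (-w q) * η i q) := by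
      rw [partialD_comp i (f := fun x => Real.exp (-x)) (by fun_prop) dw, hwd q hq]
      have := ((hasDerivAt_neg (w q)).exp).deriv
      rw [this]
      ring
    have e1 := hab q hq
    have e2 := hf'E _ (hUI hq)
    rw [partialD_mul i dq de, partialD_div i (da.const_mul 2) dE e0, partialD_const_mul i 2 da,
      partialD_comp i (hdE _ (hUI hq)) dρ, pw, pa q hq, e2, h.partialD_eq hq, hη]
    change _ + _ * -(_ * (_ - _)) = _
    rw [← ha, ← hb]
    field_simp
    linear_combination -(deriv E (ρ q) * K i q) * e1
  refine ⟨fun q => b q * Real.exp (w q), fun q => 2 * a q / E (ρ q) * Real.exp (-w q),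
    hbs.mul hexp, ((has.const_smul (2 : ℝ)).div hEρ hEρ0).mul hexp', fun q hq => ?_,
    fun q hq h0 h1 => ?_, fun q hq i j => ?_⟩
  · have e1 := hab q hq
    have e0 := hEρ0 q hq
    have e2 := hee q
    have : b q * Real.exp (w q) * (2 * a q / E (ρ q) * Real.exp (-w q))
        = (2 * a q * b q) / E (ρ q) * (Real.exp (w q) * Real.exp (-w q)) := by ring
    rw [this, e1, e2]
    field_simp
    ring
  · have : a q = 0 ∧ b q = 0 := by simp [ha, hb, frameComponent, h0, h1]
    simp [this]
  · have e0 := hEρ0 q hq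
    have e2 := hee q
    rw [pX q hq, pX q hq, pY q hq, pY q hq, h.eq q hq]
    beta_reduce
    generalize Real.exp (w q) = u at *
    generalize Real.exp (-w q) = v at *
    have key : 1 / κ * (κ * u * L i q * (v * (K j q + 2 * a q ^ 2 / E (ρ q) ^ 2 * D (ρ q) * L j q))
          + κ * u * L j q * (v * (K i q + 2 * a q ^ 2 / E (ρ q) ^ 2 * D (ρ q) * L i q)))
        - (2 * a q / E (ρ q) * v) ^ 2 / κ ^ 2 * D (ρ q) * (κ * u * L i q * (κ * u * L j q))
        = (u * v) * (L i q * (K j q + 2 * a q ^ 2 / E (ρ q) ^ 2 * D (ρ q) * L j q)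
          + L j q * (K i q + 2 * a q ^ 2 / E (ρ q) ^ 2 * D (ρ q) * L i q))
        - (u * v) ^ 2 * (4 * a q ^ 2 / E (ρ q) ^ 2 * D (ρ q) * (L i q * L j q)) := by
      field_simp
      ring
    rw [key, e2]
    ring

end Bifurcation

/-! ### Metrics and functions on a manifold in local coordinates -/

section LocalCoordinates

variable {ι N : Type*} [Fintype ι] [DecidableEq ι] [TopologicalSpace N] [ChartedSpace (ι → ℝ) N]

theorem bilinForm_eq_sum (b : LinearMap.BilinForm ℝ (ι → ℝ)) (u v : ι → ℝ) :
    b u v = ∑ i, ∑ j, u i * v j * b (Pi.single i 1) (Pi.single j 1) := by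
  have h : ∀ w : ι → ℝ, w = ∑ i, w i • (Pi.single i 1 : ι → ℝ) := fun w => by
    conv_lhs => rw [← Finset.univ_sum_single w]
    simp only [← Pi.single_smul, smul_eq_mul, mul_one]
  conv_lhs => rw [h u, h v]
  simp only [map_sum, map_smul, LinearMap.sum_apply, LinearMap.smul_apply, smul_eq_mul,
    Finset.mul_sum]
  rw [Finset.sum_comm]
  exact Finset.sum_congr rfl fun i _ => Finset.sum_congr rfl fun j _ => by ring

variable (e : LocalCoords ι N) {p : ι → ℝ}

theorem mdifferentiableAt_coords_symm (hp : p ∈ e.target) :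
    MDifferentiableAt 𝓘(ℝ, ι → ℝ) 𝓘(ℝ, ι → ℝ) e.symm p :=
  e.symm.mdifferentiableAt (by simp) hp

theorem mdifferentiableAt_coords {x : N} (hx : x ∈ e.source) :
    MDifferentiableAt 𝓘(ℝ, ι → ℝ) 𝓘(ℝ, ι → ℝ) e x :=
  e.mdifferentiableAt (by simp) hx

/-- The coordinate basis at the point with coordinates `p`, as a linear map from `ℝ^ι` to the
tangent space. -/
def coordFrame (e : LocalCoords ι N) (p : ι → ℝ) :
    (ι → ℝ) →ₗ[ℝ] TangentSpace 𝓘(ℝ, ι → ℝ) (e.symm p) :=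
  (mfderiv 𝓘(ℝ, ι → ℝ) 𝓘(ℝ, ι → ℝ) e.symm p).toLinearMap

theorem coordFrame_injective (hp : p ∈ e.target) : Function.Injective (coordFrame e p) := by
  have h1 : mfderiv 𝓘(ℝ, ι → ℝ) 𝓘(ℝ, ι → ℝ) (e ∘ e.symm) p = ContinuousLinearMap.id ℝ _ := by
    rw [← mfderiv_id]
    refine Filter.EventuallyEq.mfderiv_eq ?_
    filter_upwards [e.open_target.mem_nhds hp] with q hq using e.right_inv hq
  rw [mfderiv_comp p (mdifferentiableAt_coords e (e.symm.map_source hp))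
    (mdifferentiableAt_coords_symm e hp)] at h1
  intro u v huv
  have h2 := fun w => DFunLike.congr_fun h1 w
  refine (h2 u).symm.trans (Eq.trans ?_ (h2 v))
  exact congrArg (mfderiv 𝓘(ℝ, ι → ℝ) 𝓘(ℝ, ι → ℝ) e (e.symm p)) huv

theorem coordFrame_surjective (hp : p ∈ e.target) : Function.Surjective (coordFrame e p) :=
  LinearMap.injective_iff_surjective (f := (show (ι → ℝ) →ₗ[ℝ] (ι → ℝ) from coordFrame e p)).1
    (coordFrame_injective e hp)

theorem form_coordFrame (b : ∀ x : N, LinearMap.BilinForm ℝ (TangentSpace 𝓘(ℝ, ι → ℝ) x))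
    (u v : ι → ℝ) : b (e.symm p) (coordFrame e p u) (coordFrame e p v)
      = ∑ i, ∑ j, u i * v j * bilinComponents b e p i j :=
  bilinForm_eq_sum ((b (e.symm p)).compl₁₂ (coordFrame e p) (coordFrame e p)) u v

theorem PseudoRiemannianMetric.isMetricOn (g : PseudoRiemannianMetric ι N) :
    IsMetricOn (g.components e) e.target where
  isOpen := e.open_target
  smooth := g.smooth e
  symm p _ i j := (g.symm (e.symm p)).eq _ _
  det_ne_zero p hp h0 := by
    obtain ⟨v, hv, hv0⟩ := Matrix.exists_mulVec_eq_zero_iff.2 h0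
    refine hv (coordFrame_injective e hp ?_)
    rw [map_zero]
    refine (g.nondegenerate (e.symm p)).2 _ fun w => ?_
    obtain ⟨u, rfl⟩ := coordFrame_surjective e hp w
    rw [form_coordFrame]
    refine Finset.sum_eq_zero fun i _ => ?_
    have := congrFun hv0 i
    rw [Matrix.mulVec, dotProduct] at this
    simp only [mul_assoc, ← Finset.mul_sum]
    rw [show ∑ j, v j * bilinComponents g.form e p i j = 0 from
      (Finset.sum_congr rfl fun j _ => mul_comm _ _).trans this, mul_zero]

section Function

variable {r : N → ℝ} (hr : ContMDiff 𝓘(ℝ, ι → ℝ) 𝓘(ℝ, ℝ) ∞ r)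
include hr

theorem contDiffOn_comp_coords_symm : ContDiffOn ℝ ∞ (r ∘ e.symm) e.target :=
  contMDiffOn_iff_contDiffOn.1 (hr.comp_contMDiffOn e.contMDiffOn_invFun)

theorem mfderiv_coordFrame (hp : p ∈ e.target) (v : ι → ℝ) :
    (mfderiv 𝓘(ℝ, ι → ℝ) 𝓘(ℝ, ℝ) r (e.symm p) (coordFrame e p v) : ℝ)
      = fderiv ℝ (r ∘ e.symm) p v := by
  rw [← mfderiv_eq_fderiv, mfderiv_comp p (hr.mdifferentiable (by simp) _)
    (mdifferentiableAt_coords_symm e hp)]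
  rfl

theorem mfderiv_eq_zero_iff_fderiv_coords {x : N} (hx : x ∈ e.source) :
    mfderiv 𝓘(ℝ, ι → ℝ) 𝓘(ℝ, ℝ) r x = 0 ↔ fderiv ℝ (r ∘ e.symm) (e x) = 0 := by
  have hp : e x ∈ e.target := e.map_source hx
  obtain ⟨p, hp', rfl⟩ : ∃ p ∈ e.target, e.symm p = x := ⟨e x, hp, e.left_inv hx⟩
  rw [show e (e.symm p) = p from e.right_inv hp']
  constructor
  · intro h
    ext v
    rw [← mfderiv_coordFrame e hr hp' v, h]
    rfl
  · intro h
    refine ContinuousLinearMap.ext fun w => ?_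
    obtain ⟨u, rfl⟩ := coordFrame_surjective e hp' w
    refine (mfderiv_coordFrame e hr hp' u).trans ?_
    rw [h]
    rfl

theorem gradSq_eq_gradNormSq (g : PseudoRiemannianMetric ι N) {x : N} (hx : x ∈ e.source) :
    g.gradSq r x = gradNormSq (g.components e) (r ∘ e.symm) (e x) := by
  obtain ⟨p, hp, rfl⟩ : ∃ p ∈ e.target, e.symm p = x := ⟨e x, e.map_source hx, e.left_inv hx⟩
  rw [show e (e.symm p) = p from e.right_inv hp]
  have hG := g.isMetricOn e
  obtain ⟨u, hu⟩ := coordFrame_surjective e hp (g.gradient r (e.symm p))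
  have h1 : ∀ v : ι → ℝ, ∑ i, ∑ j, u i * v j * g.components e p i j
      = fderiv ℝ (r ∘ e.symm) p v := fun v => by
    rw [← mfderiv_coordFrame e hr hp, ← g.form_gradient, ← hu]
    exact (form_coordFrame e g.form u v).symm
  have h2 : ∀ k, ∑ s, g.components e p k s * u s
      = ∑ s, g.components e p k s * gradUp (g.components e) (r ∘ e.symm) s p := fun k => by
    rw [hG.sum_lower_gradUp hp, partialD, ← h1]
    refine Finset.sum_congr rfl fun i _ => ?_
    simp [Pi.single_apply, hG.symm p hp k i, mul_comm]
  have h3 : g.gradSq r (e.symm p) = fderiv ℝ (r ∘ e.symm) p u := by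
    rw [PseudoRiemannianMetric.gradSq, ← h1, ← hu]
    exact form_coordFrame e g.form u u
  rw [h3, fderiv_apply_eq_sum_partialD, gradNormSq]
  refine Finset.sum_congr rfl fun i _ => ?_
  rw [hG.eq_of_lower_eq hp h2, mul_comm]

end Function

/-- In dimension two, Lorentzian signature means that the determinant of the components is
negative: for `w` with `w_i = ε_{ij} g_{jk} v_k` orthogonal to `v`, `g(w,w) = det g · g(v,v)`. -/
theorem PseudoRiemannianMetric.IsLorentzian.det_components_neg {B : Type*} [TopologicalSpace B]
    [ChartedSpace (Fin 2 → ℝ) B] {g : PseudoRiemannianMetric (Fin 2) B} (hg : g.IsLorentzian)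
    (e : LocalCoords (Fin 2) B) {p : Fin 2 → ℝ} (hp : p ∈ e.target) :
    (g.components e p).det < 0 := by
  obtain ⟨v', hv, hw⟩ := hg (e.symm p)
  obtain ⟨v, rfl⟩ := coordFrame_surjective e hp v'
  have hG := g.isMetricOn e
  have h0 := hG.det_ne_zero p hp
  have hs := hG.symm p hp 1 0
  have form : ∀ u v : Fin 2 → ℝ, g.form (e.symm p) (coordFrame e p u) (coordFrame e p v)
      = ∑ i, ∑ j, u i * v j * g.components e p i j := form_coordFrame e g.form
  rw [form] at hv
  simp only [Fin.sum_univ_two, hs] at hv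
  rw [Matrix.det_fin_two, hs] at h0 ⊢
  set a := g.components e p 0 0
  set b := g.components e p 0 1
  set d := g.components e p 1 1
  let w : Fin 2 → ℝ := ![-(b * v 0 + d * v 1), a * v 0 + b * v 1]
  have e0 : w 0 = -(b * v 0 + d * v 1) := rfl
  have e1 : w 1 = a * v 0 + b * v 1 := rfl
  have hw0 : w ≠ 0 := by
    intro h
    have h0' := congrFun h 0
    have h1' := congrFun h 1
    rw [e0] at h0'
    rw [e1] at h1'
    simp only [Pi.zero_apply] at h0' h1'
    refine hv.ne ?_
    linear_combination v 0 * h1' - v 1 * h0'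
  have := hw (coordFrame e p w)
    (fun h => hw0 (coordFrame_injective e hp (h.trans (map_zero _).symm))) (by
      rw [form]
      simp only [Fin.sum_univ_two, e0, e1, hs]
      ring)
  rw [form] at this
  simp only [Fin.sum_univ_two, e0, e1, hs] at this
  nlinarith

theorem exists_localCoords [IsManifold 𝓘(ℝ, ι → ℝ) ∞ N] (x : N) :
    ∃ e : LocalCoords ι N, x ∈ e.source :=
  ⟨{ toPartialEquiv := (chartAt (ι → ℝ) x).toPartialEquiv
     open_source := (chartAt (ι → ℝ) x).open_source
     open_target := (chartAt (ι → ℝ) x).open_target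
     contMDiffOn_toFun := contMDiffOn_chart
     contMDiffOn_invFun := contMDiffOn_chart_symm }, mem_chart_source (ι → ℝ) x⟩

/-- The restriction of local coordinates to the points whose coordinates lie in an open set. -/
def restrCoords (e : LocalCoords ι N) (O : Set (ι → ℝ)) (hO : IsOpen O) : LocalCoords ι N where
  toFun := e
  invFun := e.symm
  source := e.source ∩ e ⁻¹' O
  target := e.target ∩ O
  map_source' _ hx := ⟨e.map_source hx.1, hx.2⟩
  map_target' p hp := ⟨e.map_target hp.1,
    show e (e.symm p) ∈ O from (e.right_inv hp.1).symm ▸ hp.2⟩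
  left_inv' _ hx := e.left_inv hx.1
  right_inv' _ hp := e.right_inv hp.1
  open_source := e.contMDiffOn_toFun.continuousOn.isOpen_inter_preimage e.open_source hO
  open_target := e.open_target.inter hO
  contMDiffOn_toFun := e.contMDiffOn_toFun.mono inter_subset_left
  contMDiffOn_invFun := e.contMDiffOn_invFun.mono inter_subset_left

end LocalCoordinates

/-! ### Changes of coordinates -/

section ChangeOfCoordinates

variable {ι N : Type*} [Fintype ι] [DecidableEq ι] [TopologicalSpace N] [ChartedSpace (ι → ℝ) N]

/-- The inverse function theorem: near a point where its Jacobian matrix is invertible, a smooth map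
of `ℝ^ι` is a diffeomorphism. -/
theorem exists_partialDiffeomorph {ψ : ι → (ι → ℝ) → ℝ} {O : Set (ι → ℝ)} {q₀ : ι → ℝ}
    (hO : IsOpen O) (hq₀ : q₀ ∈ O) (hψ : ∀ a, ContDiffOn ℝ ∞ (ψ a) O)
    (hJ : ∀ q ∈ O, (Matrix.of fun a i => partialD i (ψ a) q).det ≠ 0) :
    ∃ Ψ : PartialDiffeomorph 𝓘(ℝ, ι → ℝ) 𝓘(ℝ, ι → ℝ) (ι → ℝ) (ι → ℝ) ∞,
      q₀ ∈ Ψ.source ∧ Ψ.source ⊆ O ∧ ∀ q, Ψ q = fun a => ψ a q := by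
  set F : (ι → ℝ) → (ι → ℝ) := fun q a => ψ a q with hF
  have hFs : ContDiffOn ℝ ∞ F O := contDiffOn_pi.2 hψ
  have hFat : ∀ q ∈ O, ContDiffAt ℝ ∞ F q := fun q hq => hFs.contDiffAt (hO.mem_nhds hq)
  have hdiff : ∀ q ∈ O, ∃ A : (ι → ℝ) ≃L[ℝ] (ι → ℝ),
      HasFDerivAt F (A : (ι → ℝ) →L[ℝ] (ι → ℝ)) q := by
    intro q hq
    have hd : HasFDerivAt F (fderiv ℝ F q) q :=
      ((hFat q hq).differentiableAt (by simp)).hasFDerivAt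
    have happ : ∀ v, fderiv ℝ F q v = (Matrix.of fun a i => partialD i (ψ a) q).mulVec v := by
      intro v
      ext a
      have h1 : HasFDerivAt (ψ a) (fderiv ℝ (ψ a) q) q :=
        ((hψ a).differentiableAt_of_isOpen hO hq).hasFDerivAt
      have h2 := (hasFDerivAt_pi'.1 hd a).unique h1
      have h3 := DFunLike.congr_fun h2 v
      rw [fderiv_apply_eq_sum_partialD] at h3
      simp only [Matrix.mulVec, dotProduct, Matrix.of_apply]
      refine h3.trans (Finset.sum_congr rfl fun i _ => mul_comm _ _)
    have hinj : Function.Injective (fderiv ℝ F q).toLinearMap := by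
      rw [← LinearMap.ker_eq_bot, LinearMap.ker_eq_bot']
      intro v hv
      by_contra hv0
      refine hJ q hq (Matrix.exists_mulVec_eq_zero_iff.1 ⟨v, hv0, ?_⟩)
      rw [← happ]
      exact hv
    exact ⟨(LinearEquiv.ofInjectiveEndo _ hinj).toContinuousLinearEquiv, hd⟩
  obtain ⟨A₀, hA₀⟩ := hdiff q₀ hq₀
  set T := (hFat q₀ hq₀).toOpenPartialHomeomorph F hA₀ (by simp) with hT
  have hTF : (T : (ι → ℝ) → (ι → ℝ)) = F := (hFat q₀ hq₀).toOpenPartialHomeomorph_coe hA₀ (by simp)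
  have hTq : q₀ ∈ T.source := (hFat q₀ hq₀).mem_toOpenPartialHomeomorph_source hA₀ (by simp)
  set T' := T.restrOpen O hO
  have hT'F : (T' : (ι → ℝ) → (ι → ℝ)) = F := hTF
  have hsrc : T'.source ⊆ O := fun q hq => hq.2
  refine ⟨{ toPartialEquiv := T'.toPartialEquiv
            open_source := T'.open_source
            open_target := T'.open_target
            contMDiffOn_toFun := ?_
            contMDiffOn_invFun := ?_ }, ⟨hTq, hq₀⟩, hsrc, fun q => congrFun hT'F q⟩
  · change ContMDiffOn _ _ _ T' _
    rw [hT'F]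
    exact (hFs.mono hsrc).contMDiffOn
  · refine ContDiffOn.contMDiffOn fun p hp => ContDiffAt.contDiffWithinAt ?_
    have hq : T'.symm p ∈ O := hsrc (T'.map_target hp)
    obtain ⟨A, hA⟩ := hdiff _ hq
    refine T'.contDiffAt_symm hp (f₀' := A) ?_ ?_
    · rw [hT'F]
      exact hA
    · rw [hT'F]
      exact hFat _ hq

/-- A partial diffeomorphism has components `Ψ a` whose Jacobian matrix is inverse to that of the
inverse. -/
theorem sum_partialD_mul_partialD_symm
    (Ψ : PartialDiffeomorph 𝓘(ℝ, ι → ℝ) 𝓘(ℝ, ι → ℝ) (ι → ℝ) (ι → ℝ) ∞) {p : ι → ℝ}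
    (hp : p ∈ Ψ.target) (a i : ι) :
    ∑ k, partialD k (fun q => Ψ q a) (Ψ.symm p) * partialD i (fun q => Ψ.symm q k) p
      = if a = i then 1 else 0 := by
  have hS : DifferentiableAt ℝ Ψ.symm p :=
    ((contMDiffOn_iff_contDiffOn.1 Ψ.contMDiffOn_invFun).contDiffAt
      (Ψ.open_target.mem_nhds hp)).differentiableAt (by simp)
  have hq : Ψ.symm p ∈ Ψ.source := Ψ.map_target hp
  have hF : DifferentiableAt ℝ (fun q => Ψ q a) (Ψ.symm p) :=
    differentiableAt_pi.1 (((contMDiffOn_iff_contDiffOn.1 Ψ.contMDiffOn_toFun).contDiffAt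
      (Ψ.open_source.mem_nhds hq)).differentiableAt (by simp)) a
  have h1 : partialD i (fun q => Ψ (Ψ.symm q) a) p = if a = i then 1 else 0 := by
    rw [partialD_congr_of_eqOn (F := fun q => Ψ (Ψ.symm q) a) (H := fun q => q a) i Ψ.open_target
      (fun q hq => congrFun (Ψ.right_inv hq) a) hp, partialD_proj]
    simp only [eq_comm]
  rw [← h1, partialD]
  change _ = fderiv ℝ ((fun q => Ψ q a) ∘ Ψ.symm) p (Pi.single i 1)
  rw [fderiv_comp p hF hS, ContinuousLinearMap.comp_apply, fderiv_apply_eq_sum_partialD]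
  refine Finset.sum_congr rfl fun k _ => ?_
  rw [mul_comm]
  congr 1
  have h2 := hasFDerivAt_pi'.1 hS.hasFDerivAt k
  rw [partialD, h2.fderiv]
  rfl

/-- The transformation law of the components of a metric. -/
theorem components_trans (g : PseudoRiemannianMetric ι N) (e : LocalCoords ι N)
    (Ψ : PartialDiffeomorph 𝓘(ℝ, ι → ℝ) 𝓘(ℝ, ι → ℝ) (ι → ℝ) (ι → ℝ) ∞) {p : ι → ℝ}
    (hp : p ∈ (e.trans Ψ).target) (i j : ι) :
    g.components (e.trans Ψ) p i j = ∑ a, ∑ b, partialD i (fun q => Ψ.symm q a) p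
      * partialD j (fun q => Ψ.symm q b) p * g.components e (Ψ.symm p) a b := by
  have hpΨ : p ∈ Ψ.target := hp.1
  have hpe : Ψ.symm p ∈ e.target := hp.2
  have hS : DifferentiableAt ℝ Ψ.symm p :=
    ((contMDiffOn_iff_contDiffOn.1 Ψ.contMDiffOn_invFun).contDiffAt
      (Ψ.open_target.mem_nhds hpΨ)).differentiableAt (by simp)
  have key : ∀ v : ι → ℝ, mfderiv 𝓘(ℝ, ι → ℝ) 𝓘(ℝ, ι → ℝ) (e.trans Ψ).symm p v
      = coordFrame e (Ψ.symm p) (fderiv ℝ Ψ.symm p v) := by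
    intro v
    have : mfderiv 𝓘(ℝ, ι → ℝ) 𝓘(ℝ, ι → ℝ) (e.symm ∘ Ψ.symm) p v
      = coordFrame e (Ψ.symm p) (fderiv ℝ Ψ.symm p v) := by
      rw [mfderiv_comp p (mdifferentiableAt_coords_symm e hpe) hS.mdifferentiableAt,
        mfderiv_eq_fderiv]
      rfl
    exact this
  have comp : ∀ k a : ι, fderiv ℝ Ψ.symm p (Pi.single k 1) a
      = partialD k (fun q => Ψ.symm q a) p := by
    intro k a
    have h2 := hasFDerivAt_pi'.1 hS.hasFDerivAt a
    rw [partialD, h2.fderiv]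
    rfl
  change g.form (e.symm (Ψ.symm p)) (mfderiv 𝓘(ℝ, ι → ℝ) 𝓘(ℝ, ι → ℝ) (e.trans Ψ).symm p _)
    (mfderiv 𝓘(ℝ, ι → ℝ) 𝓘(ℝ, ι → ℝ) (e.trans Ψ).symm p _) = _
  rw [key, key, form_coordFrame]
  simp only [comp]
  rfl

/-- The Jacobian matrix of a map is invertible if it pulls a matrix back to an invertible one. -/
theorem det_jacobian_ne_zero {A C J : Matrix ι ι ℝ} (hA : A.det ≠ 0)
    (h : ∀ i j, A i j = ∑ a, ∑ b, C a b * J a i * J b j) : J.det ≠ 0 := by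
  intro h0
  refine hA ?_
  have : A = J.transpose * C * J := by
    ext i j
    rw [h]
    simp only [Matrix.mul_apply, Matrix.transpose_apply, Finset.sum_mul]
    rw [Finset.sum_comm]
    exact Finset.sum_congr rfl fun a _ => Finset.sum_congr rfl fun b _ => by ring
  rw [this, Matrix.det_mul, h0, mul_zero]

/-- If the components of `g` in the coordinates `e` are those of the pull back of `Mf` by a map
`ψ`, then `ψ ∘ e` are local coordinates in which the components of `g` are `Mf`. -/
theorem exists_coords_of_components_eq (g : PseudoRiemannianMetric ι N) (e : LocalCoords ι N)
    {x : N} (hx : x ∈ e.source) {O : Set (ι → ℝ)} (hO : IsOpen O) (hOe : O ⊆ e.target)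
    (hxO : e x ∈ O) {ψ : ι → (ι → ℝ) → ℝ} (hψ : ∀ a, ContDiffOn ℝ ∞ (ψ a) O)
    {Mf : (ι → ℝ) → Matrix ι ι ℝ}
    (hM : ∀ q ∈ O, ∀ i j, g.components e q i j = ∑ a, ∑ b, Mf (fun c => ψ c q) a b
      * partialD i (ψ a) q * partialD j (ψ b) q) :
    ∃ e' : LocalCoords ι N, x ∈ e'.source ∧ e'.source ⊆ e.source ∧
      (∀ y ∈ e'.source, e y ∈ O ∧ e' y = fun c => ψ c (e y)) ∧
      ∀ p ∈ e'.target, g.components e' p = Mf p := by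
  have hG := g.isMetricOn e
  have hJ : ∀ q ∈ O, (Matrix.of fun a i => partialD i (ψ a) q).det ≠ 0 := fun q hq =>
    det_jacobian_ne_zero (hG.det_ne_zero q (hOe hq)) (hM q hq)
  obtain ⟨Ψ, hΨx, hΨO, hΨ⟩ := exists_partialDiffeomorph hO hxO hψ hJ
  refine ⟨e.trans Ψ, ⟨hx, hΨx⟩, fun y hy => hy.1, fun y hy => ⟨hΨO hy.2, hΨ (e y)⟩, fun p hp => ?_⟩
  ext i j
  rw [components_trans g e Ψ hp]
  have hq : Ψ.symm p ∈ Ψ.source := Ψ.map_target hp.1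
  have hpq : (fun c => ψ c (Ψ.symm p)) = p := (hΨ _).symm.trans (Ψ.right_inv hp.1)
  have hψΨ : ∀ a, ψ a = fun q => Ψ q a := fun a => funext fun q => by rw [hΨ]
  have inv := fun a i => sum_partialD_mul_partialD_symm Ψ hp.1 a i
  simp only [hM _ (hΨO hq), hpq]
  simp only [hψΨ]
  calc ∑ a, ∑ b, partialD i (fun q => Ψ.symm q a) p * partialD j (fun q => Ψ.symm q b) p
        * ∑ c, ∑ d, Mf p c d * partialD a (fun q => Ψ q c) (Ψ.symm p)
          * partialD b (fun q => Ψ q d) (Ψ.symm p)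
      = ∑ c, ∑ d, Mf p c d
        * (∑ a, partialD a (fun q => Ψ q c) (Ψ.symm p) * partialD i (fun q => Ψ.symm q a) p)
        * (∑ b, partialD b (fun q => Ψ q d) (Ψ.symm p) * partialD j (fun q => Ψ.symm q b) p) := by
        simp only [Finset.mul_sum, Finset.sum_mul]
        rw [Finset.sum_congr rfl fun a _ => Finset.sum_comm, Finset.sum_comm]
        refine Finset.sum_congr rfl fun c _ => ?_
        rw [Finset.sum_congr rfl fun a _ => Finset.sum_comm, Finset.sum_comm]
        refine Finset.sum_congr rfl fun d _ => ?_
        rw [Finset.sum_comm]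
        exact Finset.sum_congr rfl fun b _ => Finset.sum_congr rfl fun a _ => by ring
    _ = Mf p i j := by
        simp only [inv, mul_ite, mul_one, mul_zero, Finset.sum_ite_eq', Finset.mem_univ, if_true]

end ChangeOfCoordinates

/-! ### Product coordinates on a warped product -/

section Congruence

variable {ι : Type*} [Fintype ι] [DecidableEq ι] {G G' : (ι → ℝ) → Matrix ι ι ℝ}
  {U : Set (ι → ℝ)} {p : ι → ℝ}

theorem christoffel_congr (hU : IsOpen U) (h : EqOn G G' U) (k i j : ι) :
    EqOn (christoffel G k i j) (christoffel G' k i j) U := by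
  intro q hq
  have hd : ∀ l a b, partialD l (fun x => G x a b) q = partialD l (fun x => G' x a b) q :=
    fun l a b => partialD_congr_of_eqOn l hU (fun x hx => by rw [h hx]) hq
  simp only [christoffel, hd, h hq]

theorem riemannUp_congr (hU : IsOpen U) (h : EqOn G G' U) (k l i j : ι) :
    EqOn (riemannUp G k l i j) (riemannUp G' k l i j) U := by
  intro q hq
  have hc := fun k i j => christoffel_congr hU h k i j
  have hd : ∀ s k i j, partialD s (christoffel G k i j) q = partialD s (christoffel G' k i j) q :=
    fun s k i j => partialD_congr_of_eqOn s hU (hc k i j) hq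
  simp only [riemannUp, hd, hc _ _ _ hq]

theorem riemannDown_congr (hU : IsOpen U) (h : EqOn G G' U) (k l i j : ι) :
    EqOn (riemannDown G k l i j) (riemannDown G' k l i j) U := fun q hq => by
  simp only [riemannDown, riemannUp_congr hU h _ _ _ _ hq, h hq]

theorem ricci_congr (hU : IsOpen U) (h : EqOn G G' U) (i j : ι) :
    EqOn (ricci G i j) (ricci G' i j) U := fun q hq => by
  simp only [ricci, riemannUp_congr hU h _ _ _ _ hq]

end Congruence

section ProductCoordinates

variable {ι κ N B S : Type*} [Fintype ι] [DecidableEq ι] [Fintype κ] [DecidableEq κ]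
  [TopologicalSpace N] [ChartedSpace (ι ⊕ κ → ℝ) N]
  [TopologicalSpace B] [ChartedSpace (ι → ℝ) B] [TopologicalSpace S] [ChartedSpace (κ → ℝ) S]

/-- The local coordinates on a product given by local coordinates on the factors. -/
def prodCoords (eB : LocalCoords ι B) (eS : LocalCoords κ S) :
    PartialDiffeomorph (𝓘(ℝ, ι → ℝ).prod 𝓘(ℝ, κ → ℝ)) 𝓘(ℝ, ι ⊕ κ → ℝ) (B × S) (ι ⊕ κ → ℝ) ∞ where
  toFun x := Sum.elim (eB x.1) (eS x.2)
  invFun p := (eB.symm (p ∘ Sum.inl), eS.symm (p ∘ Sum.inr))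
  source := eB.source ×ˢ eS.source
  target := sumSet eB.target eS.target
  map_source' _ hx := ⟨eB.map_source hx.1, eS.map_source hx.2⟩
  map_target' _ hp := ⟨eB.map_target hp.1, eS.map_target hp.2⟩
  left_inv' _ hx := Prod.ext (eB.left_inv hx.1) (eS.left_inv hx.2)
  right_inv' p hp := by
    funext i
    rcases i with i | i
    · exact congrFun (eB.right_inv hp.1) i
    · exact congrFun (eS.right_inv hp.2) i
  open_source := eB.open_source.prod eS.open_source
  open_target := isOpen_sumSet eB.open_target eS.open_target
  contMDiffOn_toFun := by
    refine contMDiffOn_pi_space.2 fun i => ?_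
    rcases i with i | i
    · exact contMDiffOn_pi_space.1 (eB.contMDiffOn_toFun.comp contMDiffOn_fst fun x hx => hx.1) i
    · exact contMDiffOn_pi_space.1 (eS.contMDiffOn_toFun.comp contMDiffOn_snd fun x hx => hx.2) i
  contMDiffOn_invFun :=
    (eB.contMDiffOn_invFun.comp contDiff_comp_inl.contMDiff.contMDiffOn fun _ hp => hp.1).prodMk
      (eS.contMDiffOn_invFun.comp contDiff_comp_inr.contMDiff.contMDiffOn fun _ hp => hp.2)

theorem mfderiv_comp_inl (e : LocalCoords ι B) {p : ι ⊕ κ → ℝ} (hp : p ∘ Sum.inl ∈ e.target)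
    (u : ι ⊕ κ → ℝ) :
    mfderiv 𝓘(ℝ, ι ⊕ κ → ℝ) 𝓘(ℝ, ι → ℝ) (fun q : ι ⊕ κ → ℝ => e.symm (q ∘ Sum.inl)) p u
      = coordFrame e (p ∘ Sum.inl) (u ∘ Sum.inl) := by
  have hd : HasFDerivAt (fun q : ι ⊕ κ → ℝ => q ∘ Sum.inl)
      (ContinuousLinearMap.pi fun i => ContinuousLinearMap.proj (R := ℝ) (φ := fun _ => ℝ)
        (Sum.inl i)) p :=
    hasFDerivAt_pi.2 fun i => hasFDerivAt_apply (𝕜 := ℝ) (Sum.inl i) p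
  change mfderiv 𝓘(ℝ, ι ⊕ κ → ℝ) 𝓘(ℝ, ι → ℝ) (e.symm ∘ fun q : ι ⊕ κ → ℝ => q ∘ Sum.inl) p u = _
  rw [mfderiv_comp p (mdifferentiableAt_coords_symm e hp)
    hd.differentiableAt.mdifferentiableAt, mfderiv_eq_fderiv, hd.fderiv]
  rfl

theorem mfderiv_comp_inr (e : LocalCoords κ S) {p : ι ⊕ κ → ℝ} (hp : p ∘ Sum.inr ∈ e.target)
    (u : ι ⊕ κ → ℝ) :
    mfderiv 𝓘(ℝ, ι ⊕ κ → ℝ) 𝓘(ℝ, κ → ℝ) (fun q : ι ⊕ κ → ℝ => e.symm (q ∘ Sum.inr)) p u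
      = coordFrame e (p ∘ Sum.inr) (u ∘ Sum.inr) := by
  have hd : HasFDerivAt (fun q : ι ⊕ κ → ℝ => q ∘ Sum.inr)
      (ContinuousLinearMap.pi fun i => ContinuousLinearMap.proj (R := ℝ) (φ := fun _ => ℝ)
        (Sum.inr i)) p :=
    hasFDerivAt_pi.2 fun i => hasFDerivAt_apply (𝕜 := ℝ) (Sum.inr i) p
  change mfderiv 𝓘(ℝ, ι ⊕ κ → ℝ) 𝓘(ℝ, κ → ℝ) (e.symm ∘ fun q : ι ⊕ κ → ℝ => q ∘ Sum.inr) p u = _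
  rw [mfderiv_comp p (mdifferentiableAt_coords_symm e hp)
    hd.differentiableAt.mdifferentiableAt, mfderiv_eq_fderiv, hd.fderiv]
  rfl

theorem form_congr (b : ∀ x : B, LinearMap.BilinForm ℝ (TangentSpace 𝓘(ℝ, ι → ℝ) x)) {x x' : B}
    (h : x = x') (u v : ι → ℝ) : b x u v = b x' u v := by
  subst h
  rfl

variable {gbar : PseudoRiemannianMetric (ι ⊕ κ) N} {g : PseudoRiemannianMetric ι B} {r : B → ℝ}
  {Ω : PseudoRiemannianMetric κ S}
  {Φ : PartialDiffeomorph 𝓘(ℝ, ι ⊕ κ → ℝ) (𝓘(ℝ, ι → ℝ).prod 𝓘(ℝ, κ → ℝ)) N (B × S) ∞}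

/-- In product coordinates the components of a warped product metric are those of the coordinate
warped product. -/
theorem IsWarpedProductVia.components_prodCoords (hΦ : IsWarpedProductVia gbar g r Ω Φ)
    (eB : LocalCoords ι B) (eS : LocalCoords κ S) {p : ι ⊕ κ → ℝ}
    (hp : p ∈ (Φ.trans (prodCoords eB eS)).target) :
    gbar.components (Φ.trans (prodCoords eB eS)) p
      = warp (g.components eB) (r ∘ eB.symm) (Ω.components eS) p := by
  set e : LocalCoords (ι ⊕ κ) N := Φ.trans (prodCoords eB eS) with he
  have hpB : p ∘ Sum.inl ∈ eB.target := hp.1.1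
  have hpS : p ∘ Sum.inr ∈ eS.target := hp.1.2
  have hxs : e.symm p ∈ Φ.source := (e.map_target hp).1
  have hΦe : ∀ q ∈ e.target, Φ (e.symm q) = (eB.symm (q ∘ Sum.inl), eS.symm (q ∘ Sum.inr)) :=
    fun q hq => Φ.right_inv hq.2
  have hΦd : MDifferentiableAt 𝓘(ℝ, ι ⊕ κ → ℝ) (𝓘(ℝ, ι → ℝ).prod 𝓘(ℝ, κ → ℝ)) Φ (e.symm p) :=
    Φ.mdifferentiableAt (by simp) hxs
  have h1 : ∀ u : ι ⊕ κ → ℝ, mfderiv 𝓘(ℝ, ι ⊕ κ → ℝ) 𝓘(ℝ, ι → ℝ) (fun q' => (Φ q').1) (e.symm p)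
      (mfderiv 𝓘(ℝ, ι ⊕ κ → ℝ) 𝓘(ℝ, ι ⊕ κ → ℝ) e.symm p u)
      = (coordFrame eB (p ∘ Sum.inl) (u ∘ Sum.inl) : ι → ℝ) := by
    intro u
    have hd1 : MDifferentiableAt 𝓘(ℝ, ι ⊕ κ → ℝ) 𝓘(ℝ, ι → ℝ) (fun q' => (Φ q').1) (e.symm p) :=
      mdifferentiableAt_fst.comp _ hΦd
    have hc := mfderiv_comp p hd1 (mdifferentiableAt_coords_symm e hp)
    have hev : ((fun q' => (Φ q').1) ∘ e.symm) =ᶠ[𝓝 p]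
        fun q : ι ⊕ κ → ℝ => eB.symm (q ∘ Sum.inl) := by
      filter_upwards [e.open_target.mem_nhds hp] with q hq using congrArg Prod.fst (hΦe q hq)
    rw [← mfderiv_comp_inl eB hpB, ← hev.mfderiv_eq, hc]
    rfl
  have h2 : ∀ u : ι ⊕ κ → ℝ, mfderiv 𝓘(ℝ, ι ⊕ κ → ℝ) 𝓘(ℝ, κ → ℝ) (fun q' => (Φ q').2) (e.symm p)
      (mfderiv 𝓘(ℝ, ι ⊕ κ → ℝ) 𝓘(ℝ, ι ⊕ κ → ℝ) e.symm p u)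
      = (coordFrame eS (p ∘ Sum.inr) (u ∘ Sum.inr) : κ → ℝ) := by
    intro u
    have hd1 : MDifferentiableAt 𝓘(ℝ, ι ⊕ κ → ℝ) 𝓘(ℝ, κ → ℝ) (fun q' => (Φ q').2) (e.symm p) :=
      mdifferentiableAt_snd.comp _ hΦd
    have hc := mfderiv_comp p hd1 (mdifferentiableAt_coords_symm e hp)
    have hev : ((fun q' => (Φ q').2) ∘ e.symm) =ᶠ[𝓝 p]
        fun q : ι ⊕ κ → ℝ => eS.symm (q ∘ Sum.inr) := by
      filter_upwards [e.open_target.mem_nhds hp] with q hq using congrArg Prod.snd (hΦe q hq)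
    rw [← mfderiv_comp_inr eS hpS, ← hev.mfderiv_eq, hc]
    rfl
  have key : ∀ k l, gbar.components e p k l
      = g.form (eB.symm (p ∘ Sum.inl))
          (coordFrame eB (p ∘ Sum.inl) ((Pi.single k 1 : ι ⊕ κ → ℝ) ∘ Sum.inl))
          (coordFrame eB (p ∘ Sum.inl) ((Pi.single l 1 : ι ⊕ κ → ℝ) ∘ Sum.inl))
        + r (eB.symm (p ∘ Sum.inl)) ^ 2 * Ω.form (eS.symm (p ∘ Sum.inr))
          (coordFrame eS (p ∘ Sum.inr) ((Pi.single k 1 : ι ⊕ κ → ℝ) ∘ Sum.inr))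
          (coordFrame eS (p ∘ Sum.inr) ((Pi.single l 1 : ι ⊕ κ → ℝ) ∘ Sum.inr)) := by
    intro k l
    refine (hΦ (e.symm p) hxs _ _).trans ?_
    rw [h1, h1, h2, h2]
    have hB := congrArg Prod.fst (hΦe p hp)
    have hS := congrArg Prod.snd (hΦe p hp)
    exact congrArg₂ (· + ·) (form_congr g.form hB _ _)
      (congrArg₂ (· * ·) (congrArg (fun b => r b ^ 2) hB) (form_congr Ω.form hS _ _))
  have s1 : ∀ i : ι, (Pi.single (Sum.inl i) 1 : ι ⊕ κ → ℝ) ∘ Sum.inl = Pi.single i 1 := fun i => by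
    ext j
    simp [Pi.single_apply]
  have s2 : ∀ i : ι, (Pi.single (Sum.inl i) 1 : ι ⊕ κ → ℝ) ∘ Sum.inr = 0 := fun i => by
    ext j
    simp
  have s3 : ∀ i : κ, (Pi.single (Sum.inr i) 1 : ι ⊕ κ → ℝ) ∘ Sum.inl = 0 := fun i => by
    ext j
    simp
  have s4 : ∀ i : κ, (Pi.single (Sum.inr i) 1 : ι ⊕ κ → ℝ) ∘ Sum.inr = Pi.single i 1 := fun i => by
    ext j
    simp [Pi.single_apply]
  ext k l
  rw [key]
  rcases k with k | k <;> rcases l with l | l <;>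
    simp only [s1, s2, s3, s4, map_zero, LinearMap.zero_apply, mul_zero, add_zero, zero_add] <;> rfl

/-- Near a point of a warped product there are product coordinates, defined on a product of open
sets. -/
theorem IsWarpedProductVia.exists_coords (hΦ : IsWarpedProductVia gbar g r Ω Φ) {xbar : N}
    (hxbar : xbar ∈ Φ.source) {x : B} {y : S} (hxy : Φ xbar = (x, y)) (eB : LocalCoords ι B)
    (hx : x ∈ eB.source) (eS : LocalCoords κ S) (hy : y ∈ eS.source) :
    ∃ (U : Set (ι → ℝ)) (V : Set (κ → ℝ)), IsOpen U ∧ U ⊆ eB.target ∧ eB x ∈ U ∧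
      IsOpen V ∧ V ⊆ eS.target ∧ eS y ∈ V ∧
      ∀ U' ⊆ U, ∀ V' ⊆ V, IsOpen U' → IsOpen V' → eB x ∈ U' → eS y ∈ V' →
        ∃ e : LocalCoords (ι ⊕ κ) N, xbar ∈ e.source ∧ e.target = sumSet U' V' ∧
          ∀ p ∈ sumSet U' V',
            gbar.components e p = warp (g.components eB) (r ∘ eB.symm) (Ω.components eS) p := by
  set e : LocalCoords (ι ⊕ κ) N := Φ.trans (prodCoords eB eS) with he
  have hxe : xbar ∈ e.source := ⟨hxbar, by
    change Φ xbar ∈ (prodCoords eB eS).source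
    rw [hxy]
    exact ⟨hx, hy⟩⟩
  have hex : e xbar = Sum.elim (eB x) (eS y) := by
    change Sum.elim (eB (Φ xbar).1) (eS (Φ xbar).2) = _
    rw [hxy]
  have hcont : Continuous fun z : (ι → ℝ) × (κ → ℝ) => (Sum.elim z.1 z.2 : ι ⊕ κ → ℝ) := by
    refine continuous_pi fun i => ?_
    rcases i with i | i
    · exact (continuous_apply i).comp continuous_fst
    · exact (continuous_apply i).comp continuous_snd
  obtain ⟨U, V, hU, hV, hxU, hyV, hUV⟩ := isOpen_prod_iff.1 (e.open_target.preimage hcont)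
    (eB x) (eS y) (show Sum.elim (eB x) (eS y) ∈ e.target from hex ▸ e.map_source hxe)
  have hsub : ∀ p ∈ sumSet U V, p ∈ e.target := fun p hp => by
    have : (p ∘ Sum.inl, p ∘ Sum.inr) ∈ _ := hUV ⟨hp.1, hp.2⟩
    rwa [mem_preimage, Sum.elim_comp_inl_inr] at this
  refine ⟨U, V, hU, fun q hq => ?_, hxU, hV, fun q hq => ?_, hyV, ?_⟩
  · exact (hUV (show (q, eS y) ∈ U ×ˢ V from ⟨hq, hyV⟩)).1.1
  · exact (hUV (show (eB x, q) ∈ U ×ˢ V from ⟨hxU, hq⟩)).1.2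
  · intro U' hU' V' hV' hUo hVo hx' hy'
    have hss : sumSet U' V' ⊆ e.target := fun p hp => hsub p ⟨hU' hp.1, hV' hp.2⟩
    refine ⟨restrCoords e (sumSet U' V') (isOpen_sumSet hUo hVo), ⟨hxe, ?_⟩,
      inter_eq_right.2 hss, fun p hp => ?_⟩
    · change e xbar ∈ sumSet U' V'
      rw [hex]
      exact ⟨hx', hy'⟩
    · exact hΦ.components_prodCoords eB eS (hss hp)

end ProductCoordinates

/-! ### Simple zeros and primitives of functions of one variable -/

section OneVariable

theorem AnalyticAt.dslope_self {f : ℝ → ℝ} {a : ℝ} (hf : AnalyticAt ℝ f a) :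
    AnalyticAt ℝ (dslope f a) a := by
  obtain ⟨p, hp⟩ := hf
  exact hp.has_fpower_series_dslope_fslope.analyticAt

theorem uIcc_subset_ball {r₀ δ r : ℝ} (hr : r ∈ Metric.ball r₀ δ) :
    uIcc r₀ r ⊆ Metric.ball r₀ δ := by
  rw [← segment_eq_uIcc]
  exact (convex_ball r₀ δ).segment_subset
    (Metric.mem_ball_self ((dist_nonneg).trans_lt (Metric.mem_ball.1 hr))) hr

theorem hasDerivAt_integral_of_contDiffOn {g : ℝ → ℝ} {r₀ δ r : ℝ}
    (hg : ContDiffOn ℝ ∞ g (Metric.ball r₀ δ)) (hr : r ∈ Metric.ball r₀ δ) :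
    HasDerivAt (fun r => ∫ s in r₀..r, g s) (g r) r :=
  intervalIntegral.integral_hasDerivAt_right
    (hg.continuousOn.mono (uIcc_subset_ball hr)).intervalIntegrable
    (hg.continuousOn.stronglyMeasurableAtFilter Metric.isOpen_ball r hr)
    (hg.continuousOn.continuousAt (Metric.isOpen_ball.mem_nhds hr))

theorem contDiffOn_of_hasDerivAt {F g : ℝ → ℝ} {s : Set ℝ} (hs : IsOpen s)
    (hg : ContDiffOn ℝ ∞ g s) (hF : ∀ r ∈ s, HasDerivAt F (g r) r) : ContDiffOn ℝ ∞ F s :=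
  (contDiffOn_infty_iff_deriv_of_isOpen hs).2
    ⟨fun r hr => (hF r hr).differentiableAt.differentiableWithinAt,
      hg.congr fun r hr => (hF r hr).deriv⟩

/-- On the interval of radius `δ` around `r₀`, the analytic function `f` has a simple zero at `r₀`
with derivative `2κ`, and `f = (r - r₀) E`, `E = 2κ + (r - r₀) D`. -/
structure IsSimpleZeroOn (f E D : ℝ → ℝ) (r₀ κ δ : ℝ) : Prop where
  radius_pos : 0 < δ
  slope_ne_zero : κ ≠ 0
  deriv_eq : deriv f r₀ = 2 * κ
  analytic_left : AnalyticOnNhd ℝ E (Metric.ball r₀ δ)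
  analytic_right : AnalyticOnNhd ℝ D (Metric.ball r₀ δ)
  eq_mul : ∀ r ∈ Metric.ball r₀ δ, f r = (r - r₀) * E r
  left_eq : ∀ r ∈ Metric.ball r₀ δ, E r = 2 * κ + (r - r₀) * D r
  left_ne_zero : ∀ r ∈ Metric.ball r₀ δ, E r ≠ 0
  deriv_ne_zero : ∀ r ∈ Metric.ball r₀ δ, deriv f r ≠ 0

theorem exists_isSimpleZeroOn {f : ℝ → ℝ} {r₀ : ℝ} (hf : AnalyticAt ℝ f r₀) (h0 : f r₀ = 0)
    (h1 : deriv f r₀ ≠ 0) {s : Set ℝ} (hs : s ∈ 𝓝 r₀) :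
    ∃ E D : ℝ → ℝ, ∃ κ δ : ℝ, IsSimpleZeroOn f E D r₀ κ δ ∧ Metric.ball r₀ δ ⊆ s := by
  have hE : AnalyticAt ℝ (dslope f r₀) r₀ := hf.dslope_self
  have hD := hE.dslope_self
  have hE0 : dslope f r₀ r₀ ≠ 0 := by rwa [dslope_same]
  obtain ⟨δ, hδ, hball⟩ := Metric.mem_nhds_iff.1 (inter_mem hs (inter_mem
    (hE.eventually_analyticAt.and hD.eventually_analyticAt)
    ((hE.continuousAt.eventually_ne hE0).and (hf.deriv.continuousAt.eventually_ne h1))))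
  refine ⟨dslope f r₀, dslope (dslope f r₀) r₀, deriv f r₀ / 2, δ,
    ⟨hδ, div_ne_zero h1 two_ne_zero, by ring, fun r hr => (hball hr).2.1.1,
      fun r hr => (hball hr).2.1.2, fun r _ => ?_, fun r _ => ?_, fun r hr => (hball hr).2.2.1,
      fun r hr => (hball hr).2.2.2⟩, fun r hr => (hball hr).1⟩
  · have := sub_smul_dslope f r₀ r
    rw [smul_eq_mul, h0, sub_zero] at this
    exact this.symm
  · have := sub_smul_dslope (dslope f r₀) r₀ r
    rw [smul_eq_mul, dslope_same] at this
    linarith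

namespace IsSimpleZeroOn

variable {f E D : ℝ → ℝ} {r₀ κ δ r : ℝ} (hz : IsSimpleZeroOn f E D r₀ κ δ)
include hz

theorem zero_eq : f r₀ = 0 := by
  rw [hz.eq_mul r₀ (Metric.mem_ball_self hz.radius_pos), sub_self, zero_mul]

theorem contDiffOn_left : ContDiffOn ℝ ∞ E (Metric.ball r₀ δ) :=
  fun r hr => (hz.analytic_left r hr).contDiffAt.contDiffWithinAt

theorem contDiffOn_right : ContDiffOn ℝ ∞ D (Metric.ball r₀ δ) :=
  fun r hr => (hz.analytic_right r hr).contDiffAt.contDiffWithinAt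

/-- The integrand of `h` is the restriction of a smooth function. -/
theorem kruskalIntegrand_eq (hr : r ∈ Metric.ball r₀ δ) (hne : r ≠ r₀) :
    kruskalIntegrand f r₀ r = -(D r / E r) := by
  have h1 : r - r₀ ≠ 0 := sub_ne_zero.2 hne
  have h2 := hz.left_ne_zero r hr
  rw [kruskalIntegrand, hz.eq_mul r hr, hz.deriv_eq]
  field_simp
  linarith [hz.left_eq r hr]

theorem contDiffOn_neg_div : ContDiffOn ℝ ∞ (fun r => -(D r / E r)) (Metric.ball r₀ δ) :=
  (hz.contDiffOn_right.div hz.contDiffOn_left hz.left_ne_zero).neg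

theorem eqOn_kruskalIntegrand (hr : r ∈ Metric.ball r₀ δ) :
    EqOn (fun r => -(D r / E r)) (kruskalIntegrand f r₀) (uIoo r₀ r) := fun s hs => by
  refine (hz.kruskalIntegrand_eq (uIcc_subset_ball hr (uIoo_subset_uIcc_self hs)) ?_).symm
  rintro rfl
  exact left_notMem_uIoo hs

theorem intervalIntegrable_kruskalIntegrand (hr : r ∈ Metric.ball r₀ δ) :
    IntervalIntegrable (kruskalIntegrand f r₀) MeasureTheory.volume r₀ r :=
  (hz.contDiffOn_neg_div.continuousOn.mono
    (uIcc_subset_ball hr)).intervalIntegrable.congr_uIoo (hz.eqOn_kruskalIntegrand hr)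

theorem hasDerivAt_kruskalH (hr : r ∈ Metric.ball r₀ δ) :
    HasDerivAt (kruskalH f r₀) (-(D r / E r)) r := by
  refine (hasDerivAt_integral_of_contDiffOn hz.contDiffOn_neg_div hr).congr_of_eventuallyEq ?_
  filter_upwards [Metric.isOpen_ball.mem_nhds hr] with s hs
  exact (intervalIntegral.integral_congr_uIoo (hz.eqOn_kruskalIntegrand hs)).symm

theorem contDiffOn_kruskalH : ContDiffOn ℝ ∞ (kruskalH f r₀) (Metric.ball r₀ δ) :=
  contDiffOn_of_hasDerivAt Metric.isOpen_ball hz.contDiffOn_neg_div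
    fun _ hr => hz.hasDerivAt_kruskalH hr

omit hz in
theorem _root_.kruskalH_self (f : ℝ → ℝ) (r₀ : ℝ) : kruskalH f r₀ r₀ = 0 :=
  intervalIntegral.integral_same

theorem kruskalFactor_eq (hr₀ : r₀ ≠ 0) (hr : r ∈ Metric.ball r₀ δ) :
    kruskalFactor f r₀ r / 2 = r₀ * Real.exp (-kruskalH f r₀ r) * E r / (2 * κ ^ 2) := by
  have hκ := hz.slope_ne_zero
  rw [kruskalFactor]
  split_ifs with h
  · have := hz.left_eq r hr
    rw [h, sub_self, zero_mul, add_zero] at this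
    rw [h, this, hz.deriv_eq, kruskalH_self, neg_zero, Real.exp_zero]
    field_simp
    norm_num
  · have h1 : r - r₀ ≠ 0 := sub_ne_zero.2 h
    have h2 : r₀ - r ≠ 0 := sub_ne_zero.2 (Ne.symm h)
    have h3 : 1 - r / r₀ = -(r - r₀) / r₀ := by
      field_simp
      ring
    rw [hz.eq_mul r hr, hz.deriv_eq, h3]
    field_simp
    ring

/-- The function `UV` of `r` in Kruskal coordinates. -/
def _root_.kruskalProduct (f : ℝ → ℝ) (r₀ r : ℝ) : ℝ :=
  (r - r₀) * Real.exp (kruskalH f r₀ r) / r₀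

theorem hasDerivAt_kruskalProduct (hr : r ∈ Metric.ball r₀ δ) :
    HasDerivAt (kruskalProduct f r₀)
      (2 * κ / E r * Real.exp (kruskalH f r₀ r) / r₀) r := by
  have h1 := ((((hasDerivAt_id r).sub_const r₀).fun_mul (hz.hasDerivAt_kruskalH hr).exp).div_const
    r₀)
  refine HasDerivAt.congr_deriv h1 ?_
  have h2 := hz.left_ne_zero r hr
  have h3 : (E r + -((r - r₀) * D r)) = 2 * κ := by linarith [hz.left_eq r hr]
  rw [id_eq, ← h3]
  field_simp

theorem contDiffOn_kruskalProduct : ContDiffOn ℝ ∞ (kruskalProduct f r₀) (Metric.ball r₀ δ) :=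
  ((contDiffOn_id.sub contDiffOn_const).mul hz.contDiffOn_kruskalH.exp).div_const r₀

omit hz in
theorem _root_.kruskalProduct_self (f : ℝ → ℝ) (r₀ : ℝ) : kruskalProduct f r₀ r₀ = 0 := by
  simp [kruskalProduct]

/-- The area radius as a smooth function of `z = UV`. -/
theorem exists_kruskal_radius (hr₀ : r₀ ≠ 0) :
    ∃ ε > 0, ∃ ϱ : ℝ → ℝ, ContDiffOn ℝ ∞ ϱ (Ioo (-ε) ε) ∧
      (∀ z ∈ Ioo (-ε) ε, z * deriv ϱ z = f (ϱ z) / deriv f r₀) ∧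
      (∀ᶠ r in 𝓝 r₀, kruskalProduct f r₀ r ∈ Ioo (-ε) ε ∧ ϱ (kruskalProduct f r₀ r) = r) ∧
      (fun z => ϱ z - (r₀ + r₀ * z)) =O[𝓝 0] fun z => z ^ 2 := by
  have hκ := hz.slope_ne_zero
  have hmem : r₀ ∈ Metric.ball r₀ δ := Metric.mem_ball_self hz.radius_pos
  set k := kruskalProduct f r₀ with hk
  have hd : ∀ r ∈ Metric.ball r₀ δ, HasDerivAt k
      (2 * κ / E r * Real.exp (kruskalH f r₀ r) / r₀) r := fun r hr =>
    hz.hasDerivAt_kruskalProduct hr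
  have hd0 : ∀ r ∈ Metric.ball r₀ δ, 2 * κ / E r * Real.exp (kruskalH f r₀ r) / r₀ ≠ 0 :=
    fun r hr => div_ne_zero (mul_ne_zero (div_ne_zero (mul_ne_zero two_ne_zero hκ)
      (hz.left_ne_zero r hr)) (Real.exp_pos _).ne') hr₀
  have hs : ∀ r ∈ Metric.ball r₀ δ, ContDiffAt ℝ ∞ k r := fun r hr =>
    hz.contDiffOn_kruskalProduct.contDiffAt (Metric.isOpen_ball.mem_nhds hr)
  have hstrict := (hs r₀ hmem).hasStrictDerivAt' (hd r₀ hmem) (by simp)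
  set T := (hstrict.hasStrictFDerivAt_equiv (hd0 r₀ hmem)).toOpenPartialHomeomorph k with hT
  set T' := T.restrOpen (Metric.ball r₀ δ) Metric.isOpen_ball with hT'
  have hTk : ∀ r, T' r = k r := fun r => rfl
  have hsrc : r₀ ∈ T'.source :=
    ⟨(hstrict.hasStrictFDerivAt_equiv (hd0 r₀ hmem)).mem_toOpenPartialHomeomorph_source, hmem⟩
  have hk0 : k r₀ = 0 := kruskalProduct_self f r₀
  have h0t : (0 : ℝ) ∈ T'.target := by
    rw [← hk0]
    exact T'.map_source hsrc
  obtain ⟨ε, hε, hball⟩ := Metric.isOpen_iff.1 T'.open_target 0 h0t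
  rw [Real.ball_eq_Ioo, zero_sub, zero_add] at hball
  have hin : ∀ z ∈ T'.target, T'.symm z ∈ Metric.ball r₀ δ := fun z hz' => (T'.map_target hz').2
  have hϱd : ∀ z ∈ T'.target, HasDerivAt T'.symm
      (2 * κ / E (T'.symm z) * Real.exp (kruskalH f r₀ (T'.symm z)) / r₀)⁻¹ z := fun z hz' =>
    T'.hasDerivAt_symm hz' (hd0 _ (hin z hz')) (hd _ (hin z hz'))
  have hϱ0 : T'.symm 0 = r₀ := by
    rw [← hk0]
    exact T'.left_inv hsrc
  refine ⟨ε, hε, T'.symm, fun z hz' => ?_, fun z hz' => ?_, ?_, ?_⟩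
  · exact (T'.contDiffAt_symm_deriv (hd0 _ (hin z (hball hz'))) (hball hz')
      (hd _ (hin z (hball hz'))) (hs _ (hin z (hball hz')))).contDiffWithinAt
  · have hb := hin z (hball hz')
    have hzk : z = k (T'.symm z) := (T'.right_inv (hball hz')).symm
    have hE0 := hz.left_ne_zero _ hb
    rw [(hϱd z (hball hz')).deriv, hz.deriv_eq, hz.eq_mul _ hb]
    nth_rewrite 1 [hzk]
    have hexp := (Real.exp_pos (kruskalH f r₀ (T'.symm z))).ne'
    rw [hk, kruskalProduct]
    field_simp
  · have h1 : ∀ᶠ r in 𝓝 r₀, k r ∈ Ioo (-ε) ε := by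
      refine (hs r₀ hmem).continuousAt.eventually (isOpen_Ioo.mem_nhds ?_)
      rw [hk0]
      exact ⟨by linarith, hε⟩
    filter_upwards [h1, T'.open_source.mem_nhds hsrc] with r hr hr' using ⟨hr, T'.left_inv hr'⟩
  · -- `ϱ - r₀ - r₀ z = (ϱ - r₀) (1 - exp h)`, and both factors are `O(ϱ - r₀) = O(z)`
    have hcont : ContinuousAt T'.symm 0 := (hϱd 0 h0t).continuousAt
    have hO1 : (fun z => T'.symm z - r₀) =O[𝓝 0] fun z => z := by
      have := (hϱd 0 h0t).differentiableAt.isBigO_sub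
      simpa only [hϱ0, sub_zero] using this
    have hO2 : (fun r => Real.exp (kruskalH f r₀ r) - 1) =O[𝓝 r₀] fun r => r - r₀ := by
      have := (hz.hasDerivAt_kruskalH hmem).exp.differentiableAt.isBigO_sub
      simpa only [kruskalH_self, Real.exp_zero] using this
    have hO3 : (fun z => Real.exp (kruskalH f r₀ (T'.symm z)) - 1) =O[𝓝 0] fun z => z := by
      refine (hO2.comp_tendsto (k := T'.symm) (l' := 𝓝 0) ?_).trans hO1
      have := hcont.tendsto
      rwa [hϱ0] at this
    have hO4 := (hO1.mul hO3).neg_left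
    refine (hO4.congr' ?_ ?_)
    · filter_upwards [T'.open_target.mem_nhds h0t] with z hz'
      have hzk : z = k (T'.symm z) := (T'.right_inv hz').symm
      have h5 : r₀ * z = (T'.symm z - r₀) * Real.exp (kruskalH f r₀ (T'.symm z)) := by
        nth_rewrite 1 [hzk]
        rw [hk, kruskalProduct]
        field_simp
      rw [h5]
      ring
    · exact Eventually.of_forall fun z => (sq z).symm

end IsSimpleZeroOn

end OneVariable

/-! ### Schwarzschild, Eddington–Finkelstein and Kruskal coordinates -/

section PlaneNormalForms

variable {G : (Fin 2 → ℝ) → Matrix (Fin 2) (Fin 2) ℝ} {U : Set (Fin 2 → ℝ)} {p : Fin 2 → ℝ}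
  {ρ : (Fin 2 → ℝ) → ℝ} {f : ℝ → ℝ}

/-- The metric `G` is `-f(ρ) dv² + 2 dv dρ` on the open set `O`. -/
structure IsEddingtonOn (f : ℝ → ℝ) (G : (Fin 2 → ℝ) → Matrix (Fin 2) (Fin 2) ℝ)
    (v ρ : (Fin 2 → ℝ) → ℝ) (O : Set (Fin 2 → ℝ)) : Prop where
  isOpen : IsOpen O
  smooth_time : ContDiffOn ℝ ∞ v O
  smooth_radius : ContDiffOn ℝ ∞ ρ O
  eq : ∀ q ∈ O, ∀ i j, G q i j = -f (ρ q) * partialD i v q * partialD j v q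
    + partialD i v q * partialD j ρ q + partialD j v q * partialD i ρ q

/-- Where `f ≠ 0`, the coordinate `t = v - ∫ dρ / f` turns `-f dv² + 2 dv dρ` into
`-f dt² + dρ² / f`. -/
theorem IsEddingtonOn.exists_static_time {v : (Fin 2 → ℝ) → ℝ} {O : Set (Fin 2 → ℝ)}
    (h : IsEddingtonOn f G v ρ O) (hp : p ∈ O) (hf : AnalyticAt ℝ f (ρ p)) (hf0 : f (ρ p) ≠ 0) :
    ∃ (V : Set (Fin 2 → ℝ)) (t : (Fin 2 → ℝ) → ℝ), IsOpen V ∧ V ⊆ O ∧ p ∈ V ∧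
      ContDiffOn ℝ ∞ t V ∧ ∀ q ∈ V, f (ρ q) ≠ 0 ∧ ∀ i j, G q i j
        = -f (ρ q) * partialD i t q * partialD j t q
          + 1 / f (ρ q) * partialD i ρ q * partialD j ρ q := by
  obtain ⟨δ, hδ, hball⟩ := Metric.mem_nhds_iff.1
    (hf.eventually_analyticAt.and (hf.continuousAt.eventually_ne hf0))
  have hg : ContDiffOn ℝ ∞ (fun r => 1 / f r) (Metric.ball (ρ p) δ) := fun r hr =>
    (contDiffAt_const.div (hball hr).1.contDiffAt (hball hr).2).contDiffWithinAt
  set F : ℝ → ℝ := fun r => ∫ s in (ρ p)..r, 1 / f s with hF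
  have hFd : ∀ r ∈ Metric.ball (ρ p) δ, HasDerivAt F (1 / f r) r := fun r hr =>
    hasDerivAt_integral_of_contDiffOn hg hr
  have hFs : ContDiffOn ℝ ∞ F (Metric.ball (ρ p) δ) :=
    contDiffOn_of_hasDerivAt Metric.isOpen_ball hg hFd
  have hV : IsOpen (O ∩ ρ ⁻¹' Metric.ball (ρ p) δ) :=
    h.smooth_radius.continuousOn.isOpen_inter_preimage h.isOpen Metric.isOpen_ball
  refine ⟨O ∩ ρ ⁻¹' Metric.ball (ρ p) δ, fun q => v q - F (ρ q), hV, inter_subset_left,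
    ⟨hp, Metric.mem_ball_self hδ⟩, (h.smooth_time.mono inter_subset_left).sub
      (hFs.comp (h.smooth_radius.mono inter_subset_left) fun q hq => hq.2), fun q hq => ?_⟩
  have hq0 : f (ρ q) ≠ 0 := (hball hq.2).2
  have hdρ := h.smooth_radius.differentiableAt_of_isOpen h.isOpen hq.1
  have hdv := h.smooth_time.differentiableAt_of_isOpen h.isOpen hq.1
  have hdF := (hFd _ hq.2).differentiableAt
  have ht : ∀ i, partialD i (fun q => v q - F (ρ q)) q
      = partialD i v q - 1 / f (ρ q) * partialD i ρ q := fun i => by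
    rw [partialD_sub (H := fun q => F (ρ q)) i hdv (hdF.comp q hdρ), partialD_comp i hdF hdρ,
      (hFd _ hq.2).deriv]
  refine ⟨hq0, fun i j => ?_⟩
  rw [h.eq q hq.1, ht, ht]
  field_simp
  ring

theorem IsBirkhoffBase.exists_isEddingtonOn (hB : IsBirkhoffBase f G ρ U) (hp : p ∈ U)
    (hdet : ∀ q ∈ U, (G q).det < 0) (hd : fderiv ℝ ρ p ≠ 0) :
    ∃ (V : Set (Fin 2 → ℝ)) (v : (Fin 2 → ℝ) → ℝ), V ⊆ U ∧ p ∈ V ∧ IsEddingtonOn f G v ρ V := by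
  obtain ⟨V, v, hV, hVU, hpV, hv, hG⟩ := hB.exists_eddington hp hdet hd
  exact ⟨V, v, hVU, hpV, hV, hv, hB.smooth.mono hVU, hG⟩

/-- The metric `G` is `(2 dX dY - κ⁻¹ Y² D(ρ) dX²) / κ` on the open set `O`, with
`ρ = r₀ + X Y`. -/
structure IsIsraelOn (D : ℝ → ℝ) (r₀ κ : ℝ) (G : (Fin 2 → ℝ) → Matrix (Fin 2) (Fin 2) ℝ)
    (X Y ρ : (Fin 2 → ℝ) → ℝ) (O : Set (Fin 2 → ℝ)) : Prop where
  isOpen : IsOpen O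
  smooth_left : ContDiffOn ℝ ∞ X O
  smooth_right : ContDiffOn ℝ ∞ Y O
  radius_eq : ∀ q ∈ O, ρ q = r₀ + X q * Y q
  eq : ∀ q ∈ O, ∀ i j, G q i j
    = 1 / κ * (partialD i X q * partialD j Y q + partialD j X q * partialD i Y q)
      - Y q ^ 2 / κ ^ 2 * D (ρ q) * (partialD i X q * partialD j X q)

theorem IsIsraelOn.mono {D : ℝ → ℝ} {r₀ κ : ℝ} {X Y : (Fin 2 → ℝ) → ℝ} {O V : Set (Fin 2 → ℝ)}
    (h : IsIsraelOn D r₀ κ G X Y ρ O) (hV : IsOpen V) (hVO : V ⊆ O) :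
    IsIsraelOn D r₀ κ G X Y ρ V :=
  ⟨hV, h.smooth_left.mono hVO, h.smooth_right.mono hVO, fun q hq => h.radius_eq q (hVO hq),
    fun q hq => h.eq q (hVO hq)⟩

theorem IsIsraelOn.smooth_radius {D : ℝ → ℝ} {r₀ κ : ℝ} {X Y : (Fin 2 → ℝ) → ℝ}
    {O : Set (Fin 2 → ℝ)} (h : IsIsraelOn D r₀ κ G X Y ρ O) : ContDiffOn ℝ ∞ ρ O :=
  (contDiffOn_const.add (h.smooth_left.mul h.smooth_right)).congr h.radius_eq

theorem IsIsraelOn.partialD_radius {D : ℝ → ℝ} {r₀ κ : ℝ} {X Y : (Fin 2 → ℝ) → ℝ}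
    {O : Set (Fin 2 → ℝ)} (h : IsIsraelOn D r₀ κ G X Y ρ O) (hp : p ∈ O) (i : Fin 2) :
    partialD i ρ p = X p * partialD i Y p + Y p * partialD i X p := by
  have hX := h.smooth_left.differentiableAt_of_isOpen h.isOpen hp
  have hY := h.smooth_right.differentiableAt_of_isOpen h.isOpen hp
  rw [partialD_congr_of_eqOn i h.isOpen h.radius_eq hp,
    partialD_add i (differentiableAt_const r₀) (hX.fun_mul hY), partialD_const,
    partialD_mul i hX hY]
  ring

/-- At a critical point of a non-constant `ρ`, the function `f` has a simple zero. -/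
theorem IsBirkhoffBase.deriv_ne_zero (hB : IsBirkhoffBase f G ρ U) (hp : p ∈ U)
    (hdet : ∀ q ∈ U, (G q).det < 0) (hd : fderiv ℝ ρ p = 0) (hρ : ¬ ∀ᶠ q in 𝓝 p, ρ q = ρ p)
    (hf : AnalyticAt ℝ f (ρ p)) : deriv f (ρ p) ≠ 0 := by
  intro h0
  obtain ⟨L, K, V, hVU, hpV, h⟩ := hB.metric.exists_isNullFrame hp hdet
  refine hρ ((hB.mono h.isOpen hVU).eventually_eq_of_deriv_eq_zero h hpV hd
    (Q := dslope (deriv f) (ρ p)) hf.deriv.dslope_self.continuousAt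
    (Eventually.of_forall fun r => ?_))
  have := sub_smul_dslope (deriv f) (ρ p) r
  rw [h0, sub_zero, smul_eq_mul] at this
  exact this.symm

/-- Critical points of the radius are zeros of the profile, as `(∇ρ)² = f(ρ)`. -/
theorem IsBirkhoffBase.eq_zero_of_fderiv_eq_zero (hB : IsBirkhoffBase f G ρ U) (hp : p ∈ U)
    (hd : fderiv ℝ ρ p = 0) : f (ρ p) = 0 := by
  rw [← hB.gradNormSq_eq p hp, gradNormSq]
  simp [fderiv_eq_zero_iff_partialD.1 hd]

theorem IsBirkhoffBase.exists_isIsraelOn (hB : IsBirkhoffBase f G ρ U) (hp : p ∈ U)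
    (hdet : ∀ q ∈ U, (G q).det < 0) (hd : fderiv ℝ ρ p = 0) {E D : ℝ → ℝ} {κ δ : ℝ}
    (hz : IsSimpleZeroOn f E D (ρ p) κ δ) :
    ∃ (V : Set (Fin 2 → ℝ)) (X Y : (Fin 2 → ℝ) → ℝ), V ⊆ U ∧ p ∈ V ∧
      MapsTo ρ V (Metric.ball (ρ p) δ) ∧ X p = 0 ∧ Y p = 0 ∧ IsIsraelOn D (ρ p) κ G X Y ρ V := by
  obtain ⟨L, K, V, hVU, hpV, h⟩ := hB.metric.exists_isNullFrame hp hdet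
  have hW : IsOpen (V ∩ ρ ⁻¹' Metric.ball (ρ p) δ) :=
    (hB.smooth.mono hVU).continuousOn.isOpen_inter_preimage h.isOpen Metric.isOpen_ball
  obtain ⟨ε, hε, hball⟩ := Metric.isOpen_iff.1 hW p ⟨hpV, Metric.mem_ball_self hz.radius_pos⟩
  have hbV : Metric.ball p ε ⊆ V := fun q hq => (hball hq).1
  have hpb : p ∈ Metric.ball p ε := Metric.mem_ball_self hε
  obtain ⟨X, Y, hX, hY, hρ, hXY, hG⟩ := (hB.mono Metric.isOpen_ball (hbV.trans hVU)).exists_israel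
    (h.mono Metric.isOpen_ball hbV) (convex_ball p ε) hz.slope_ne_zero Metric.isOpen_ball
    hz.contDiffOn_left hz.contDiffOn_right hz.eq_mul hz.left_eq hz.left_ne_zero hz.deriv_ne_zero
    fun q hq => (hball hq).2
  have h0 := hXY p hpb (fderiv_eq_zero_iff_partialD.1 hd 0) (fderiv_eq_zero_iff_partialD.1 hd 1)
  exact ⟨_, X, Y, hbV.trans hVU, hpb, fun q hq => (hball hq).2, h0.1, h0.2, Metric.isOpen_ball, hX,
    hY, hρ, hG⟩

/-- Off the horizon `X = 0`, the function `log |X| / κ` is a null time of the Israel form. -/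
theorem IsIsraelOn.isEddingtonOn {E D : ℝ → ℝ} {r₀ κ δ : ℝ} (hz : IsSimpleZeroOn f E D r₀ κ δ)
    {X Y : (Fin 2 → ℝ) → ℝ} {O : Set (Fin 2 → ℝ)} (h : IsIsraelOn D r₀ κ G X Y ρ O)
    (hX : ∀ q ∈ O, X q ≠ 0) (hρ : MapsTo ρ O (Metric.ball r₀ δ)) :
    IsEddingtonOn f G (fun q => 1 / κ * Real.log (X q)) ρ O := by
  refine ⟨h.isOpen, contDiffOn_const.mul (h.smooth_left.log hX), h.smooth_radius,
    fun q hq i j => ?_⟩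
  have hκ := hz.slope_ne_zero
  have hX0 := hX q hq
  have hXd := h.smooth_left.differentiableAt_of_isOpen h.isOpen hq
  have hv : ∀ i, partialD i (fun q => 1 / κ * Real.log (X q)) q
      = 1 / κ * ((X q)⁻¹ * partialD i X q) := fun i => by
    rw [partialD_const_mul (F := fun q => Real.log (X q)) i _
        ((Real.differentiableAt_log hX0).comp q hXd),
      partialD_comp i (Real.differentiableAt_log hX0) hXd, Real.deriv_log]
  rw [h.eq q hq, hv, hv, h.partialD_radius hq, h.partialD_radius hq, hz.eq_mul _ (hρ hq),
    hz.left_eq _ (hρ hq)]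
  have : ρ q - r₀ = X q * Y q := by
    rw [h.radius_eq q hq]
    ring
  rw [this]
  field_simp
  ring

/-- The Kruskal form of the metric: `V = X` and `U = Y e^{h(ρ)} / r₀`. -/
theorem IsIsraelOn.kruskal {E D : ℝ → ℝ} {r₀ κ δ : ℝ} (hz : IsSimpleZeroOn f E D r₀ κ δ)
    (hr₀ : r₀ ≠ 0) {X Y : (Fin 2 → ℝ) → ℝ} {O : Set (Fin 2 → ℝ)}
    (h : IsIsraelOn D r₀ κ G X Y ρ O) (hρ : MapsTo ρ O (Metric.ball r₀ δ)) {q : Fin 2 → ℝ}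
    (hq : q ∈ O) (i j : Fin 2) :
    G q i j = kruskalFactor f r₀ (ρ q) / 2
      * (partialD i (fun q => Y q * Real.exp (kruskalH f r₀ (ρ q)) / r₀) q * partialD j X q
        + partialD j (fun q => Y q * Real.exp (kruskalH f r₀ (ρ q)) / r₀) q * partialD i X q) := by
  have hκ := hz.slope_ne_zero
  have hE := hz.left_ne_zero _ (hρ hq)
  have hYd := h.smooth_right.differentiableAt_of_isOpen h.isOpen hq
  have hρd := h.smooth_radius.differentiableAt_of_isOpen h.isOpen hq
  have hexp := (hz.hasDerivAt_kruskalH (hρ hq)).exp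
  have hU : ∀ i, partialD i (fun q => Y q * Real.exp (kruskalH f r₀ (ρ q)) / r₀) q
      = Real.exp (kruskalH f r₀ (ρ q)) / r₀
        * (2 * κ / E (ρ q) * partialD i Y q - Y q ^ 2 * D (ρ q) / E (ρ q) * partialD i X q) := by
    intro i
    have e1 : (fun q => Y q * Real.exp (kruskalH f r₀ (ρ q)) / r₀)
        = fun q => 1 / r₀ * (Y q * Real.exp (kruskalH f r₀ (ρ q))) := by
      funext q
      ring
    have e2 : DifferentiableAt ℝ (fun q => Real.exp (kruskalH f r₀ (ρ q))) q :=
      hexp.differentiableAt.comp q hρd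
    have e3 : 2 * κ = E (ρ q) - X q * Y q * D (ρ q) := by
      have := hz.left_eq _ (hρ hq)
      rw [show ρ q - r₀ = X q * Y q by rw [h.radius_eq q hq]; ring] at this
      linarith
    rw [e1, partialD_const_mul i _ (hYd.fun_mul e2), partialD_mul i hYd e2,
      partialD_comp (f := fun r => Real.exp (kruskalH f r₀ r)) i hexp.differentiableAt hρd,
      hexp.deriv, h.partialD_radius hq, e3]
    field_simp
    ring
  rw [hz.kruskalFactor_eq hr₀ (hρ hq), h.eq q hq, hU, hU, Real.exp_neg]
  have := (Real.exp_pos (kruskalH f r₀ (ρ q))).ne'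
  field_simp
  ring

end PlaneNormalForms

section NormalFormsOnSurface

variable {B : Type*} [TopologicalSpace B] [ChartedSpace (Fin 2 → ℝ) B]
  {g : PseudoRiemannianMetric (Fin 2) B} {r : B → ℝ} {e : LocalCoords (Fin 2) B} {x : B}
  {f : ℝ → ℝ} {O : Set (Fin 2 → ℝ)}

theorem IsEddingtonOn.hasEddingtonFinkelsteinForm {v : (Fin 2 → ℝ) → ℝ}
    (h : IsEddingtonOn f (g.components e) v (r ∘ e.symm) O) (hO : O ⊆ e.target)
    (hx : x ∈ e.source) (hxO : e x ∈ O) : HasEddingtonFinkelsteinForm f g r x := by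
  obtain ⟨e', hxe', hsrc, he', hM⟩ := exists_coords_of_components_eq g e hx h.isOpen hO hxO
    (ψ := ![v, r ∘ e.symm]) (Mf := fun p => !![-f (p 1), 1; 1, 0])
    (by
      intro a
      fin_cases a
      exacts [h.smooth_time, h.smooth_radius])
    (by
      intro q hq i j
      rw [h.eq q hq]
      simp [Fin.sum_univ_two]
      ring)
  refine ⟨e', hxe', fun y hy => ?_, hM⟩
  rw [(he' y hy).2]
  exact congrArg r (e.left_inv (hsrc hy))

theorem IsEddingtonOn.hasSchwarzschildForm {v : (Fin 2 → ℝ) → ℝ}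
    (h : IsEddingtonOn f (g.components e) v (r ∘ e.symm) O) (hO : O ⊆ e.target)
    (hx : x ∈ e.source) (hxO : e x ∈ O) (hf : AnalyticAt ℝ f (r x)) (hf0 : f (r x) ≠ 0) :
    HasSchwarzschildForm f g r x := by
  have hrx : (r ∘ e.symm) (e x) = r x := congrArg r (e.left_inv hx)
  rw [← hrx] at hf hf0
  obtain ⟨V, t, hV, hVO, hxV, ht, hG⟩ := h.exists_static_time hxO hf hf0
  obtain ⟨e', hxe', hsrc, he', hM⟩ := exists_coords_of_components_eq g e hx hV (hVO.trans hO) hxV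
    (ψ := ![t, r ∘ e.symm]) (Mf := fun p => schwarzschildMatrix f (p 1))
    (by
      intro a
      fin_cases a
      exacts [ht, h.smooth_radius.mono hVO])
    (by
      intro q hq i j
      rw [(hG q hq).2]
      simp [Fin.sum_univ_two, schwarzschildMatrix])
  refine ⟨e', hxe', fun y hy => ?_, hM⟩
  have hry : (r ∘ e.symm) (e y) = r y := congrArg r (e.left_inv (hsrc hy))
  refine ⟨?_, hry ▸ (hG _ (he' y hy).1).1⟩
  rw [(he' y hy).2]
  exact hry

theorem IsIsraelOn.hasKruskalForm {E D : ℝ → ℝ} {κ δ : ℝ} (hz : IsSimpleZeroOn f E D (r x) κ δ)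
    (hr₀ : r x ≠ 0) {X Y : (Fin 2 → ℝ) → ℝ}
    (h : IsIsraelOn D (r x) κ (g.components e) X Y (r ∘ e.symm) O)
    (hρ : MapsTo (r ∘ e.symm) O (Metric.ball (r x) δ)) (hO : O ⊆ e.target)
    (hx : x ∈ e.source) (hxO : e x ∈ O) (hX0 : X (e x) = 0) (hY0 : Y (e x) = 0) :
    HasKruskalForm f g r x := by
  set ρ := r ∘ e.symm with hρdef
  have hrx : ρ (e x) = r x := congrArg r (e.left_inv hx)
  obtain ⟨ε, hε, ϱ, hϱs, hϱd, hϱk, hϱO⟩ := hz.exists_kruskal_radius hr₀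
  obtain ⟨W, hWr, hWo, hxW⟩ := eventually_nhds_iff.1 hϱk
  have hV : IsOpen (O ∩ ρ ⁻¹' W) :=
    h.smooth_radius.continuousOn.isOpen_inter_preimage h.isOpen hWo
  have hVO : O ∩ ρ ⁻¹' W ⊆ O := inter_subset_left
  have hxV : e x ∈ O ∩ ρ ⁻¹' W := ⟨hxO, by rwa [mem_preimage, hrx]⟩
  set Y' : (Fin 2 → ℝ) → ℝ := fun q => Y q * Real.exp (kruskalH f (r x) (ρ q)) / r x with hY'
  have hY's : ContDiffOn ℝ ∞ Y' O :=
    ((h.smooth_right.mul (hz.contDiffOn_kruskalH.comp h.smooth_radius hρ).exp)).div_const _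
  have hprod : ∀ q ∈ O, Y' q * X q = kruskalProduct f (r x) (ρ q) := fun q hq => by
    rw [kruskalProduct, show ρ q - r x = X q * Y q by rw [h.radius_eq q hq]; ring]
    ring
  have hϱρ : ∀ q ∈ O ∩ ρ ⁻¹' W, Y' q * X q ∈ Ioo (-ε) ε ∧ ϱ (Y' q * X q) = ρ q := fun q hq => by
    rw [hprod q hq.1]
    exact hWr _ hq.2
  obtain ⟨e', hxe', hsrc, he', hM⟩ := exists_coords_of_components_eq g e hx hV (hVO.trans hO) hxV
    (ψ := ![Y', X]) (Mf := fun p => !![0, kruskalFactor f (r x) (ϱ (p 0 * p 1)) / 2;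
      kruskalFactor f (r x) (ϱ (p 0 * p 1)) / 2, 0])
    (by
      intro a
      fin_cases a
      exacts [hY's.mono hVO, h.smooth_left.mono hVO])
    (by
      intro q hq i j
      rw [h.kruskal hz hr₀ hρ hq.1]
      simp only [Fin.sum_univ_two, Matrix.of_apply, Matrix.cons_val', Matrix.cons_val_zero,
        Matrix.cons_val_one, Matrix.cons_val_fin_one, (hϱρ q hq).2]
      ring)
  have key : ∀ p ∈ e'.target, p 0 * p 1 ∈ Ioo (-ε) ε ∧ r (e'.symm p) = ϱ (p 0 * p 1) ∧
      r (e'.symm p) ∈ Metric.ball (r x) δ := by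
    intro p hp
    have hy : e'.symm p ∈ e'.source := e'.map_target hp
    obtain ⟨hyO, hye⟩ := he' _ hy
    have hpe : p = fun c => (![Y', X] : Fin 2 → (Fin 2 → ℝ) → ℝ) c (e (e'.symm p)) :=
      (e'.right_inv hp).symm.trans hye
    have h0 : p 0 = Y' (e (e'.symm p)) := congrFun hpe 0
    have h1 : p 1 = X (e (e'.symm p)) := congrFun hpe 1
    have hry : ρ (e (e'.symm p)) = r (e'.symm p) := congrArg r (e.left_inv (hsrc hy))
    rw [h0, h1]
    refine ⟨(hϱρ _ hyO).1, ((hϱρ _ hyO).2.trans hry).symm, ?_⟩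
    rw [← hry]
    exact hρ hyO.1
  have hx0 : e' x = 0 := by
    rw [(he' x hxe').2]
    funext c
    fin_cases c
    · change Y' (e x) = 0
      rw [hY']
      simp [hY0]
    · exact hX0
  refine ⟨e', hxe', hx0, ⟨ε, hε, ϱ, hϱs, fun p hp => ⟨(key p hp).1, (key p hp).2.1⟩, hϱd⟩, ?_,
    fun p hp => ⟨hz.intervalIntegrable_kruskalIntegrand (key p hp).2.2, ?_⟩⟩
  · have h0t : (0 : Fin 2 → ℝ) ∈ e'.target := hx0 ▸ e'.map_source hxe'
    have hcont : Continuous fun p : Fin 2 → ℝ => p 0 * p 1 :=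
      (continuous_apply 0).mul (continuous_apply 1)
    have h1 : (fun p : Fin 2 → ℝ => ϱ (p 0 * p 1) - (r x + r x * (p 0 * p 1)))
        =O[𝓝 0] fun p : Fin 2 → ℝ => (p 0 * p 1) ^ 2 :=
      hϱO.comp_tendsto (by simpa using hcont.tendsto 0)
    have h2 : (fun p : Fin 2 → ℝ => (p 0 * p 1) ^ 2) =O[𝓝 0] fun p : Fin 2 → ℝ => ‖p‖ ^ 3 := by
      refine Asymptotics.IsBigO.of_bound 1 ?_
      filter_upwards [Metric.ball_mem_nhds (0 : Fin 2 → ℝ) one_pos] with p hp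
      rw [mem_ball_zero_iff] at hp
      have b0 : |p 0| ≤ ‖p‖ := norm_le_pi_norm p 0
      have b1 : |p 1| ≤ ‖p‖ := norm_le_pi_norm p 1
      have hn := norm_nonneg p
      have b2 : |p 0| * |p 1| ≤ ‖p‖ * ‖p‖ := mul_le_mul b0 b1 (abs_nonneg _) hn
      rw [one_mul, Real.norm_eq_abs, Real.norm_eq_abs, abs_pow, abs_mul, abs_pow, abs_norm]
      calc (|p 0| * |p 1|) ^ 2 ≤ (‖p‖ * ‖p‖) ^ 2 := by gcongr
        _ = ‖p‖ ^ 3 * ‖p‖ := by ring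
        _ ≤ ‖p‖ ^ 3 := mul_le_of_le_one_right (by positivity) hp.le
    refine (h1.trans h2).congr' ?_ (EventuallyEq.refl _ _)
    filter_upwards [e'.open_target.mem_nhds h0t] with p hp
    rw [(key p hp).2.1]
  · rw [hM p hp, (key p hp).2.1]

end NormalFormsOnSurface

/-! ### Local isometries to generalized Schwarzschild-Tangherlini bases -/

section GST

/-- The sign convention of the base for negative radii: on the component of `r₀` its profile with
parameter `±M` is the profile with parameter `M`. -/
theorem gSTProfile_eq {n : ℕ} {α M Λ r₀ r : ℝ} {M' : ℝ}
    (hM' : M' = if r₀ < 0 ∧ Odd n then -M else M) (h : 0 < r * r₀) :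
    gSTProfile n α M' Λ r = profile n α M Λ r := by
  have hs : r < 0 ↔ r₀ < 0 :=
    ⟨fun hr => neg_of_mul_pos_right h hr.le, fun hr => neg_of_mul_pos_left h hr.le⟩
  rw [gSTProfile, hM']
  by_cases hc : r₀ < 0 ∧ Odd n
  · rw [if_pos hc, if_pos ⟨hs.2 hc.1, hc.2⟩, neg_neg]
  · rw [if_neg hc, if_neg fun hr => hc ⟨hs.1 hr.1, hr.2⟩]

/-- For `M ≠ 0` the profile does not vanish identically near any point. -/
theorem frequently_profile_ne_zero {m : ℕ} (hm : 2 ≤ m) (α : ℝ) {M : ℝ} (Λ : ℝ) {r₀ : ℝ}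
    (hM : M ≠ 0) (hr₀ : r₀ ≠ 0) : ∃ᶠ r in 𝓝 r₀, profile (2 + m) α M Λ r ≠ 0 := by
  intro hcon
  set A : ℝ := 2 * M * ((m : ℝ) - 1) with hA
  set c : ℝ := 4 * Λ / (((m : ℝ) + 1) * m) with hc
  have hm2 : (2 : ℝ) ≤ m := by exact_mod_cast hm
  have hA0 : A ≠ 0 := mul_ne_zero (mul_ne_zero two_ne_zero hM) (by linarith)
  have h1 : ∀ᶠ r in 𝓝 r₀, c * r ^ (m + 1) = A := by
    have hev : ∀ᶠ r in 𝓝 r₀, profile (2 + m) α M Λ r = 0 := hcon.mono fun r hr => not_not.1 hr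
    filter_upwards [hev.eventually_nhds, isOpen_ne.mem_nhds hr₀] with r hr hr0
    have hd := (hasDerivAt_profile (α := α) (M := M) (Λ := Λ) hm hr0).deriv
    have hz : profile (2 + m) α M Λ =ᶠ[𝓝 r] fun _ => 0 := hr
    rw [hz.deriv_eq, deriv_const, ← hA, ← hc, eq_comm, sub_eq_zero,
      div_eq_iff (pow_ne_zero m hr0)] at hd
    rw [hd]
    ring
  have h2 : (fun r => c * r ^ (m + 1)) =ᶠ[𝓝 r₀] fun _ => A := h1
  have h3 := ((hasDerivAt_pow (m + 1) r₀).const_mul c).deriv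
  rw [h2.deriv_eq, deriv_const, Nat.add_sub_cancel] at h3
  have h4 : c = 0 := by
    rcases mul_eq_zero.1 h3.symm with h | h
    · exact h
    · refine absurd h (mul_ne_zero ?_ (pow_ne_zero m hr₀))
      positivity
  refine hA0 ?_
  rw [← h1.self_of_nhds, h4, zero_mul]

variable {G : (Fin 2 → ℝ) → Matrix (Fin 2) (Fin 2) ℝ} {f : ℝ → ℝ}

/-- The metric `G` is `-f(ρ) dt² + dρ² / f(ρ)` on the open set `O`. -/
structure IsStaticOn (f : ℝ → ℝ) (G : (Fin 2 → ℝ) → Matrix (Fin 2) (Fin 2) ℝ)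
    (t ρ : (Fin 2 → ℝ) → ℝ) (O : Set (Fin 2 → ℝ)) : Prop where
  isOpen : IsOpen O
  smooth_time : ContDiffOn ℝ ∞ t O
  smooth_radius : ContDiffOn ℝ ∞ ρ O
  ne_zero : ∀ q ∈ O, f (ρ q) ≠ 0
  eq : ∀ q ∈ O, ∀ i j, G q i j = -f (ρ q) * partialD i t q * partialD j t q
    + 1 / f (ρ q) * partialD i ρ q * partialD j ρ q

/-- The map `(t, ρ)` is an isometry onto a part of the static chart. -/
theorem IsStaticOn.exists_chart {t ρ : (Fin 2 → ℝ) → ℝ} {O : Set (Fin 2 → ℝ)}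
    (h : IsStaticOn f G t ρ O) (hO : O.Nonempty) (hdet : ∀ q ∈ O, (G q).det ≠ 0) :
    ∃ Ψ : PartialDiffeomorph 𝓘(ℝ, Fin 2 → ℝ) 𝓘(ℝ, Fin 2 → ℝ) (Fin 2 → ℝ) (Fin 2 → ℝ) ∞,
      Ψ.source.Nonempty ∧ Ψ.source ⊆ O ∧ ∀ p ∈ Ψ.source, Ψ p 1 = ρ p ∧ f (ρ p) ≠ 0 ∧
        ∀ i j, G p i j = ∑ a, ∑ b, schwarzschildMatrix f (ρ p) a b *
          partialD i (fun q => Ψ q a) p * partialD j (fun q => Ψ q b) p := by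
  have hψ : ∀ a, ContDiffOn ℝ ∞ ((![t, ρ] : Fin 2 → (Fin 2 → ℝ) → ℝ) a) O := by
    intro a
    fin_cases a
    exacts [h.smooth_time, h.smooth_radius]
  have hG : ∀ p ∈ O, ∀ i j, G p i j = ∑ a, ∑ b, schwarzschildMatrix f (ρ p) a b *
      partialD i ((![t, ρ] : Fin 2 → (Fin 2 → ℝ) → ℝ) a) p
        * partialD j ((![t, ρ] : Fin 2 → (Fin 2 → ℝ) → ℝ) b) p := by
    intro p hp i j
    rw [h.eq p hp]
    simp [Fin.sum_univ_two, schwarzschildMatrix]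
  obtain ⟨q, hq⟩ := hO
  obtain ⟨Ψ, hqΨ, hΨO, hΨ⟩ := exists_partialDiffeomorph h.isOpen hq hψ
    fun p hp => det_jacobian_ne_zero (hdet p hp) (hG p hp)
  have hψΨ : ∀ a, (![t, ρ] : Fin 2 → (Fin 2 → ℝ) → ℝ) a = fun q => Ψ q a :=
    fun a => funext fun q => by rw [hΨ]
  refine ⟨Ψ, ⟨q, hqΨ⟩, hΨO, fun p hp => ⟨?_, h.ne_zero p (hΨO hp), fun i j => ?_⟩⟩
  · rw [hΨ]
    rfl
  · simp only [hG p (hΨO hp), hψΨ]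

theorem IsStaticOn.congr {φ : ℝ → ℝ} {t ρ : (Fin 2 → ℝ) → ℝ} {O : Set (Fin 2 → ℝ)}
    (h : IsStaticOn f G t ρ O) (hφ : ∀ q ∈ O, φ (ρ q) = f (ρ q)) : IsStaticOn φ G t ρ O :=
  ⟨h.isOpen, h.smooth_time, h.smooth_radius, fun q hq => hφ q hq ▸ h.ne_zero q hq,
    fun q hq i j => by rw [hφ q hq, h.eq q hq]⟩

theorem IsEddingtonOn.exists_isStaticOn {v ρ : (Fin 2 → ℝ) → ℝ} {O : Set (Fin 2 → ℝ)}
    {p : Fin 2 → ℝ} (h : IsEddingtonOn f G v ρ O) (hp : p ∈ O) (hf : AnalyticAt ℝ f (ρ p))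
    (hf0 : f (ρ p) ≠ 0) : ∃ V t, V ⊆ O ∧ V.Nonempty ∧ IsStaticOn f G t ρ V := by
  obtain ⟨V, t, hV, hVO, hpV, ht, hG⟩ := h.exists_static_time hp hf hf0
  exact ⟨V, t, hVO, ⟨p, hpV⟩, hV, ht, h.smooth_radius.mono hVO, fun q hq => (hG q hq).1,
    fun q hq => (hG q hq).2⟩

variable {B : Type*} [TopologicalSpace B] [ChartedSpace (Fin 2 → ℝ) B]
  {g : PseudoRiemannianMetric (Fin 2) B} {r : B → ℝ} {x : B} {n : ℕ} {α M Λ : ℝ}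

/-- A local isometry respecting the warping functions preserves `(∇r)²`. -/
theorem GSTBaseDomain.LocallyIsometricAt.gradSq_eq {E : GSTBaseDomain n α M Λ} {p : Fin 2 → ℝ}
    (h : GSTBaseDomain.LocallyIsometricAt g r x E p)
    (hr : ContMDiff 𝓘(ℝ, Fin 2 → ℝ) 𝓘(ℝ, ℝ) ∞ r) :
    E.gradSq p = g.gradSq r x ∧
      (fderiv ℝ E.r p = 0 ↔ mfderiv 𝓘(ℝ, Fin 2 → ℝ) 𝓘(ℝ, ℝ) r x = 0) := by
  obtain ⟨χ, hx, rfl, hχ, hM, hrE⟩ := h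
  have hxt : χ x ∈ χ.target := χ.map_source hx
  have hEr : EqOn E.r (r ∘ χ.symm) χ.target := fun q hq => by
    have := hrE (χ.symm q) (χ.map_target hq)
    rwa [show χ (χ.symm q) = q from χ.right_inv hq] at this
  have hd : fderiv ℝ E.r (χ x) = fderiv ℝ (r ∘ χ.symm) (χ x) :=
    (hEr.eventuallyEq_of_mem (χ.open_target.mem_nhds hxt)).fderiv_eq
  refine ⟨?_, ?_⟩
  · rw [gradSq_eq_gradNormSq χ hr g hx, GSTBaseDomain.gradSq, gradNormSq]
    refine Finset.sum_congr rfl fun i _ => ?_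
    rw [gradUp, Finset.mul_sum]
    refine Finset.sum_congr rfl fun j _ => ?_
    simp only [partialD, hd, hM _ hxt]
    ring
  · rw [hd, mfderiv_eq_zero_iff_fderiv_coords χ hr hx]

/-- A coordinate system in which the metric and `r` are analytic, and arbitrarily close to `x` of
the static form, defines a coordinate domain of a generalized Schwarzschild-Tangherlini base. -/
theorem exists_gSTBaseDomain (hg : g.IsLorentzian) (hr0 : ∀ b, r b ≠ 0) {e : LocalCoords (Fin 2) B}
    (hx : x ∈ e.source) {W : Set (Fin 2 → ℝ)} (hW : IsOpen W) (hWe : W ⊆ e.target) (hxW : e x ∈ W)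
    {R : (Fin 2 → ℝ) → ℝ} (hG : ∀ p ∈ W, g.components e p = G p)
    (hR : ∀ p ∈ W, r (e.symm p) = R p)
    (hGa : ∀ i j, AnalyticOnNhd ℝ (fun p => G p i j) W) (hRa : AnalyticOnNhd ℝ R W)
    (hst : ∀ O ⊆ W, IsOpen O → e x ∈ O →
      ∃ V t, V ⊆ O ∧ V.Nonempty ∧ IsStaticOn (gSTProfile n α M Λ) G t R V) :
    ∃ (E : GSTBaseDomain n α M Λ) (p : Fin 2 → ℝ), GSTBaseDomain.LocallyIsometricAt g r x E p := by
  obtain ⟨ε, hε, hball⟩ := Metric.isOpen_iff.1 hW _ hxW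
  have hxb : e x ∈ Metric.ball (e x) ε := Metric.mem_ball_self hε
  have hdet : ∀ p ∈ W, (G p).det < 0 := fun p hp => hG p hp ▸ hg.det_components_neg e (hWe hp)
  obtain ⟨V, t, hVO, hV, hs⟩ := hst _ hball Metric.isOpen_ball hxb
  obtain ⟨Ψ, hΨ, hΨV, hΨG⟩ := hs.exists_chart hV fun q hq => (hdet q (hball (hVO hq))).ne
  refine ⟨{
      domain := Metric.ball (e x) ε
      metric := G
      r := R
      isOpen_domain := Metric.isOpen_ball
      isConnected_domain := (convex_ball _ _).isConnected ⟨_, hxb⟩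
      analytic_metric := fun i j p hp => hGa i j p (hball hp)
      symm_metric := fun p hp => ?_
      lorentzian_metric := fun p hp => hdet p (hball hp)
      analytic_r := fun p hp => hRa p (hball hp)
      r_ne_zero := fun p hp => hR p (hball hp) ▸ hr0 _
      extends_chart := ⟨Ψ, hΨ, hΨV.trans hVO, hΨG⟩ }, e x,
    restrCoords e _ Metric.isOpen_ball, ⟨hx, hxb⟩, rfl, inter_subset_right, fun q hq => ?_,
    fun q hq => ?_⟩
  · rw [← hG p (hball hp)]
    exact Matrix.IsSymm.ext fun i j => (g.isMetricOn e).symm p (hWe (hball hp)) j i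
  · exact hG q (hball hq.2)
  · exact (hR _ (hball hq.2)).symm.trans (congrArg r (e.left_inv hq.1))

variable {M' : ℝ}

theorem isOpen_radius_sign {R : (Fin 2 → ℝ) → ℝ} (hR : Continuous R) (r₀ : ℝ) :
    IsOpen {p | 0 < R p * r₀} :=
  isOpen_lt continuous_const (hR.mul continuous_const)

theorem HasSchwarzschildForm.exists_gSTBaseDomain (hg : g.IsLorentzian) (hr0 : ∀ b, r b ≠ 0)
    (h : HasSchwarzschildForm (profile n α M Λ) g r x)
    (hM' : M' = if r x < 0 ∧ Odd n then -M else M) :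
    ∃ (E : GSTBaseDomain n α M' Λ) (p : Fin 2 → ℝ), GSTBaseDomain.LocallyIsometricAt g r x E p := by
  obtain ⟨e, hx, he, hM⟩ := h
  have hf : ∀ p ∈ e.target, p 1 = r (e.symm p) ∧ profile n α M Λ (p 1) ≠ 0 := fun p hp => by
    have h1 := he (e.symm p) (e.map_target hp)
    rw [show e (e.symm p) = p from e.right_inv hp] at h1
    exact ⟨h1.1, h1.1 ▸ h1.2⟩
  have hfa : ∀ p ∈ e.target, AnalyticAt ℝ (fun q : Fin 2 → ℝ => profile n α M Λ (q 1)) p :=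
    fun p hp => (analyticAt_profile n α M Λ ((hf p hp).1 ▸ hr0 _)).comp
      ((ContinuousLinearMap.proj (R := ℝ) (φ := fun _ : Fin 2 => ℝ) 1).analyticAt p)
  refine _root_.exists_gSTBaseDomain hg hr0 hx (e.open_target.inter
    (isOpen_radius_sign (continuous_apply 1) (r x))) inter_subset_left
    ⟨e.map_source hx, ?_⟩ (fun p hp => hM p hp.1) (fun p hp => (hf p hp.1).1.symm)
    (fun i j p hp => ?_) (fun p _ => (ContinuousLinearMap.proj (R := ℝ)
      (φ := fun _ : Fin 2 => ℝ) 1).analyticAt p) fun O hO hOo hxO => ⟨O, fun p => p 0, Subset.rfl,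
      ⟨_, hxO⟩, IsStaticOn.congr (f := profile n α M Λ) ⟨hOo, (contDiff_apply ℝ ℝ 0).contDiffOn,
        (contDiff_apply ℝ ℝ 1).contDiffOn, fun q hq => (hf q (hO hq).1).2, fun q hq i j => ?_⟩
        fun q hq => gSTProfile_eq hM' (hO hq).2⟩
  · change 0 < e x 1 * r x
    rw [(he x hx).1]
    exact mul_self_pos.2 (hr0 x)
  · have ha := hfa p hp.1
    fin_cases i <;> fin_cases j
    · exact ha.neg
    · exact analyticAt_const
    · exact analyticAt_const
    · exact analyticAt_const.div ha (hf p hp.1).2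
  · rw [partialD_proj, partialD_proj, partialD_proj, partialD_proj]
    fin_cases i <;> fin_cases j <;> simp [schwarzschildMatrix]

/-- The Eddington-Finkelstein chart, a domain of the base that may meet the horizon: near every
point of it the profile has non-zeros, and there `t = v - ∫ dr / f` is a static time. -/
theorem HasEddingtonFinkelsteinForm.exists_gSTBaseDomain {m : ℕ} (hm : 2 ≤ m) (hM0 : M ≠ 0)
    (hg : g.IsLorentzian) (hr0 : ∀ b, r b ≠ 0)
    (h : HasEddingtonFinkelsteinForm (profile (2 + m) α M Λ) g r x)
    (hM' : M' = if r x < 0 ∧ Odd (2 + m) then -M else M) :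
    ∃ (E : GSTBaseDomain (2 + m) α M' Λ) (p : Fin 2 → ℝ),
      GSTBaseDomain.LocallyIsometricAt g r x E p := by
  obtain ⟨e, hx, he, hM⟩ := h
  have hr1 : ∀ p ∈ e.target, p 1 = r (e.symm p) := fun p hp => by
    have h1 := he (e.symm p) (e.map_target hp)
    rwa [show e (e.symm p) = p from e.right_inv hp] at h1
  have hfa : ∀ p ∈ e.target, AnalyticAt ℝ (fun q : Fin 2 → ℝ => profile (2 + m) α M Λ (q 1)) p :=
    fun p hp => (analyticAt_profile (2 + m) α M Λ (hr1 p hp ▸ hr0 _)).comp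
      ((ContinuousLinearMap.proj (R := ℝ) (φ := fun _ : Fin 2 => ℝ) 1).analyticAt p)
  refine _root_.exists_gSTBaseDomain hg hr0 hx (e.open_target.inter
    (isOpen_radius_sign (continuous_apply 1) (r x))) inter_subset_left
    ⟨e.map_source hx, ?_⟩ (fun p hp => hM p hp.1) (fun p hp => (hr1 p hp.1).symm)
    (fun i j p hp => ?_) (fun p _ => (ContinuousLinearMap.proj (R := ℝ)
      (φ := fun _ : Fin 2 => ℝ) 1).analyticAt p) fun O hO hOo hxO => ?_
  · change 0 < e x 1 * r x
    rw [he x hx]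
    exact mul_self_pos.2 (hr0 x)
  · have ha := hfa p hp.1
    fin_cases i <;> fin_cases j
    · exact ha.neg
    · exact analyticAt_const
    · exact analyticAt_const
    · exact analyticAt_const
  · have hE : IsEddingtonOn (profile (2 + m) α M Λ)
        (fun p => !![-profile (2 + m) α M Λ (p 1), 1; 1, 0]) (fun p => p 0) (fun p => p 1) O :=
      ⟨hOo, (contDiff_apply ℝ ℝ 0).contDiffOn, (contDiff_apply ℝ ℝ 1).contDiffOn, fun q hq i j => by
        rw [partialD_proj, partialD_proj, partialD_proj, partialD_proj]
        fin_cases i <;> fin_cases j <;> simp⟩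
    have hcont : Continuous fun s : ℝ => Function.update (e x) 1 s :=
      continuous_const.update 1 continuous_id
    have hev : ∀ᶠ s in 𝓝 (e x 1), Function.update (e x) 1 s ∈ O :=
      hcont.continuousAt.eventually (hOo.mem_nhds (by simpa using hxO))
    obtain ⟨s, hs0, hsO⟩ := ((frequently_profile_ne_zero hm α Λ hM0
      (he x hx ▸ hr0 x : e x 1 ≠ 0)).and_eventually hev).exists
    have hs1 : Function.update (e x) 1 s 1 = s := Function.update_self ..
    obtain ⟨V, t, hVO, hV, hS⟩ := hE.exists_isStaticOn hsO
      (analyticAt_profile (2 + m) α M Λ (hr1 _ (hO hsO).1 ▸ hr0 _)) (by rwa [hs1])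
    exact ⟨V, t, hVO, hV, hS.congr fun q hq => gSTProfile_eq hM' (hO (hVO hq)).2⟩

/-- The Israel form of the metric, in the coordinates `(X, Y)` themselves. -/
def israelMatrix (D : ℝ → ℝ) (r₀ κ : ℝ) (p : Fin 2 → ℝ) : Matrix (Fin 2) (Fin 2) ℝ :=
  !![-(p 1 ^ 2 / κ ^ 2 * D (r₀ + p 0 * p 1)), 1 / κ; 1 / κ, 0]

/-- The Israel chart, a domain of the base around a horizon bifurcation point. Near each of its
points there are points with `X ≠ 0`, where `v = log |X| / κ` gives the
Eddington-Finkelstein form. -/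
theorem IsIsraelOn.exists_gSTBaseDomain {E D : ℝ → ℝ} {κ δ : ℝ}
    (hz : IsSimpleZeroOn (profile n α M Λ) E D (r x) κ δ)
    (hg : g.IsLorentzian) (hr0 : ∀ b, r b ≠ 0) {e : LocalCoords (Fin 2) B}
    {X Y : (Fin 2 → ℝ) → ℝ} {O : Set (Fin 2 → ℝ)}
    (h : IsIsraelOn D (r x) κ (g.components e) X Y (r ∘ e.symm) O)
    (hρ : MapsTo (r ∘ e.symm) O (Metric.ball (r x) δ)) (hO : O ⊆ e.target)
    (hx : x ∈ e.source) (hxO : e x ∈ O) (hX0 : X (e x) = 0) (hY0 : Y (e x) = 0)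
    (hM' : M' = if r x < 0 ∧ Odd n then -M else M) :
    ∃ (E : GSTBaseDomain n α M' Λ) (p : Fin 2 → ℝ), GSTBaseDomain.LocallyIsometricAt g r x E p := by
  obtain ⟨e', hxe', hsrc, he', hM⟩ := exists_coords_of_components_eq g e hx h.isOpen hO hxO
    (ψ := ![X, Y]) (Mf := israelMatrix D (r x) κ)
    (by
      intro a
      fin_cases a
      exacts [h.smooth_left, h.smooth_right])
    (by
      intro q hq i j
      rw [h.eq q hq, h.radius_eq q hq]
      simp [Fin.sum_univ_two, israelMatrix]
      ring)
  have hx0 : e' x = 0 := by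
    rw [(he' x hxe').2]
    funext c
    fin_cases c
    exacts [hX0, hY0]
  set R : (Fin 2 → ℝ) → ℝ := fun p => r x + p 0 * p 1 with hRdef
  have hRc : ContDiff ℝ ω R :=
    contDiff_const.add ((contDiff_apply ℝ ℝ 0).mul (contDiff_apply ℝ ℝ 1))
  have hRa : ∀ p, AnalyticAt ℝ R p := fun p => hRc.contDiffAt.analyticAt
  have hR : ∀ p ∈ e'.target, r (e'.symm p) = R p ∧ R p ∈ Metric.ball (r x) δ := by
    intro p hp
    have hy : e'.symm p ∈ e'.source := e'.map_target hp
    obtain ⟨hyO, hye⟩ := he' _ hy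
    have hpe : p = fun c => (![X, Y] : Fin 2 → (Fin 2 → ℝ) → ℝ) c (e (e'.symm p)) :=
      (e'.right_inv hp).symm.trans hye
    have h0 : p 0 = X (e (e'.symm p)) := congrFun hpe 0
    have h1 : p 1 = Y (e (e'.symm p)) := congrFun hpe 1
    have hry : (r ∘ e.symm) (e (e'.symm p)) = r (e'.symm p) := congrArg r (e.left_inv (hsrc hy))
    have h2 : r (e'.symm p) = R p := by
      rw [← hry, h.radius_eq _ hyO, ← h0, ← h1]
    refine ⟨h2, ?_⟩
    rw [← h2, ← hry]
    exact hρ hyO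
  refine _root_.exists_gSTBaseDomain (R := R) hg hr0 hxe' (e'.open_target.inter
    (isOpen_radius_sign hRc.continuous (r x))) inter_subset_left
    ⟨e'.map_source hxe', ?_⟩ (fun p hp => hM p hp.1) (fun p hp => (hR p hp.1).1)
    (fun i j p hp => ?_) (fun p _ => hRa p) fun V hV hVo hxV => ?_
  · change 0 < R (e' x) * r x
    rw [hx0, hRdef]
    simpa using mul_self_pos.2 (hr0 x)
  · have ha : AnalyticAt ℝ (fun p : Fin 2 → ℝ => -(p 1 ^ 2 / κ ^ 2 * D (r x + p 0 * p 1))) p := by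
      have h1 : AnalyticAt ℝ (fun p : Fin 2 → ℝ => p 1 ^ 2 / κ ^ 2) p :=
        (((contDiff_apply ℝ ℝ (1 : Fin 2)).pow 2).div_const _).contDiffAt.analyticAt
      exact (h1.mul ((hz.analytic_right _ (hR p hp.1).2).comp (hRa p))).neg
    fin_cases i <;> fin_cases j
    · exact ha
    · exact analyticAt_const
    · exact analyticAt_const
    · exact analyticAt_const
  · have hI : IsIsraelOn D (r x) κ (israelMatrix D (r x) κ) (fun p => p 0) (fun p => p 1) R V :=
      ⟨hVo, (contDiff_apply ℝ ℝ 0).contDiffOn, (contDiff_apply ℝ ℝ 1).contDiffOn, fun _ _ => rfl,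
        fun q hq i j => by
          rw [partialD_proj, partialD_proj, partialD_proj, partialD_proj]
          fin_cases i <;> fin_cases j <;> simp [israelMatrix, hRdef]⟩
    have hV' : IsOpen (V ∩ {p | p 0 ≠ 0}) :=
      hVo.inter (isOpen_ne.preimage (continuous_apply (0 : Fin 2)))
    have hE := (hI.mono hV' inter_subset_left).isEddingtonOn hz (fun q hq => hq.2)
      fun q hq => (hR q (hV hq.1).1).2
    have hcont : Continuous fun s : ℝ => (fun _ => s : Fin 2 → ℝ) :=
      continuous_pi fun _ => continuous_id
    have hev : ∀ᶠ s in 𝓝 (0 : ℝ), (fun _ => s : Fin 2 → ℝ) ∈ V :=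
      hcont.continuousAt.eventually (hVo.mem_nhds (by
        rw [hx0] at hxV
        exact hxV))
    obtain ⟨s, hsV, hs0⟩ := ((hev.filter_mono nhdsWithin_le_nhds).and
      (self_mem_nhdsWithin : {0}ᶜ ∈ 𝓝[≠] (0 : ℝ))).exists
    have hsV' : (fun _ => s : Fin 2 → ℝ) ∈ V ∩ {p | p 0 ≠ 0} := ⟨hsV, hs0⟩
    have hRs := hR _ (hV hsV).1
    obtain ⟨V', t, hVO, hVne, hS⟩ := hE.exists_isStaticOn hsV'
      (analyticAt_profile n α M Λ (hRs.1 ▸ hr0 _)) (by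
        rw [hz.eq_mul _ hRs.2]
        refine mul_ne_zero ?_ (hz.left_ne_zero _ hRs.2)
        rw [hRdef, add_sub_cancel_left]
        exact mul_ne_zero hs0 hs0)
    exact ⟨V', t, hVO.trans inter_subset_left, hVne,
      hS.congr fun q hq => gSTProfile_eq hM' (hV (hVO hq).1).2⟩

end GST

/-! ### Vanishing mass -/

section ZeroMass

variable {m : ℕ} {Λ α : ℝ} {G : (Fin 2 → ℝ) → Matrix (Fin 2) (Fin 2) ℝ}
  {ρ : (Fin 2 → ℝ) → ℝ} {H : (Fin m → ℝ) → Matrix (Fin m) (Fin m) ℝ}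
  {U : Set (Fin 2 → ℝ)} {V : Set (Fin m → ℝ)} {p : Fin 2 → ℝ}

/-- The fibre is an Einstein manifold, so that it has constant curvature `α` if its dimension is at
most three or its curvature is known to be constant. -/
theorem IsWarpVacuum.fiber_constantCurvature (hm : 2 ≤ m) (hv : IsWarpVacuum Λ G ρ H U V)
    (h : IsWarpOn G ρ H U V) (hp : p ∈ U) (hα : fiberEinstein m Λ G ρ p = ((m : ℝ) - 1) * α)
    (hc : m ≤ 3 ∨ ∃ K, ∀ y ∈ V, ∀ k l i j,
      riemannDown H k l i j y = K * (H y k i * H y l j - H y k j * H y l i))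
    {y : Fin m → ℝ} (hy : y ∈ V) (k l i j : Fin m) :
    riemannDown H k l i j y = α * (H y k i * H y l j - H y k j * H y l i) := by
  have hric : ∀ a b, ricci H a b y = ((m : ℝ) - 1) * α * H y a b := fun a b => by
    rw [hv.ricci_fiber h hp hy, hα]
  rcases hc with hm3 | ⟨K, hK⟩
  · exact constantCurvature_of_einstein hm hm3 h.fiber hy hric k l i j
  · have hr := h.fiber.ricci_of_constantCurvature hy (hK y hy)
    have : Nonempty (Fin m) := ⟨⟨0, by omega⟩⟩
    obtain ⟨a, b, hab⟩ := h.fiber.exists_ne_zero hy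
    have hm1 : (m : ℝ) - 1 ≠ 0 := by
      have : (2 : ℝ) ≤ m := by exact_mod_cast hm
      linarith
    have h1 := mul_right_cancel₀ hab ((hr a b).symm.trans (hric a b))
    rw [Fintype.card_fin] at h1
    rw [hK y hy, mul_left_cancel₀ hm1 h1]

/-- With `M = 0` and a fibre of constant curvature `α`, the solution is of constant curvature. -/
theorem IsWarpVacuum.constantCurvature (hm : 2 ≤ m) (hv : IsWarpVacuum Λ G ρ H U V)
    (h : IsWarpOn G ρ H U V) (hB : IsBirkhoffBase (profile (2 + m) α 0 Λ) G ρ U)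
    (hc : ∀ y ∈ V, ∀ k l i j,
      riemannDown H k l i j y = α * (H y k i * H y l j - H y k j * H y l i))
    {q : Fin 2 ⊕ Fin m → ℝ} (hq : q ∈ sumSet U V) (k l i j : Fin 2 ⊕ Fin m) :
    riemannDown (warp G ρ H) k l i j q = 2 * Λ / (((m : ℝ) + 1) * m)
      * (warp G ρ H q k i * warp G ρ H q l j - warp G ρ H q k j * warp G ρ H q l i) := by
  have hm0 : (m : ℝ) ≠ 0 := Nat.cast_ne_zero.2 (by omega)
  have hm1 : (m : ℝ) + 1 ≠ 0 := by positivity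
  have hρ := h.ne_zero _ hq.1
  have hhess : ∀ i j, hessian G ρ i j (q ∘ Sum.inl)
      = -(2 * Λ / (((m : ℝ) + 1) * m) * ρ (q ∘ Sum.inl)) * G (q ∘ Sum.inl) i j := fun i j => by
    rw [hB.hessian_eq _ hq.1, (hasDerivAt_profile hm hρ).deriv]
    ring
  obtain ⟨φ, hφ, hR⟩ := hv.exists_hessian_eq (by omega) h hq.2 hq.1
  have hφ' : φ = -(2 * Λ / (((m : ℝ) + 1) * m) * ρ (q ∘ Sum.inl)) := by
    obtain ⟨a, b, hab⟩ := h.base.exists_ne_zero hq.1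
    exact mul_right_cancel₀ hab ((hφ a b).symm.trans (hhess a b))
  refine h.constantCurvature hq (α := α) (fun k l i j => ?_) (hc _ hq.2) hhess ?_ k l i j
  · rw [hR, hφ']
    congr 1
    field_simp
    ring
  · rw [hB.gradNormSq_eq _ hq.1, profile_two_add]
    ring

end ZeroMass

section WarpedProduct

variable {m : ℕ} {N B S : Type*} [TopologicalSpace N] [ChartedSpace (Fin 2 ⊕ Fin m → ℝ) N]
  [TopologicalSpace B] [ChartedSpace (Fin 2 → ℝ) B] [TopologicalSpace S]
  [ChartedSpace (Fin m → ℝ) S] {gbar : PseudoRiemannianMetric (Fin 2 ⊕ Fin m) N}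
  {g : PseudoRiemannianMetric (Fin 2) B} {Ω : PseudoRiemannianMetric (Fin m) S} {r : B → ℝ}
  {Λ : ℝ}

/-- The vacuum equations in product coordinates. -/
theorem PseudoRiemannianMetric.IsLambdaVacuum.isWarpVacuum (hvac : gbar.IsLambdaVacuum Λ)
    {e : LocalCoords (Fin 2 ⊕ Fin m) N} {G : (Fin 2 → ℝ) → Matrix (Fin 2) (Fin 2) ℝ}
    {ρ : (Fin 2 → ℝ) → ℝ} {H : (Fin m → ℝ) → Matrix (Fin m) (Fin m) ℝ} {U : Set (Fin 2 → ℝ)}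
    {V : Set (Fin m → ℝ)} (he : e.target = sumSet U V)
    (hG : ∀ p ∈ sumSet U V, gbar.components e p = warp G ρ H p) : IsWarpVacuum Λ G ρ H U V := by
  intro q hq i j
  have hq' : q ∈ e.target := he ▸ hq
  have hc := ricci_congr (he ▸ e.open_target) hG i j hq
  rw [← hc, hvac e q hq', hG q hq]
  simp

theorem isWarpOn_components (hr : ContMDiff 𝓘(ℝ, Fin 2 → ℝ) 𝓘(ℝ, ℝ) ∞ r) (hr0 : ∀ b, r b ≠ 0)
    (eB : LocalCoords (Fin 2) B) (eS : LocalCoords (Fin m) S) {U : Set (Fin 2 → ℝ)}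
    {V : Set (Fin m → ℝ)} (hU : IsOpen U) (hV : IsOpen V) (hUB : U ⊆ eB.target)
    (hVS : V ⊆ eS.target) :
    IsWarpOn (g.components eB) (r ∘ eB.symm) (Ω.components eS) U V :=
  ⟨(g.isMetricOn eB).mono hU hUB, (Ω.isMetricOn eS).mono hV hVS,
    (contDiffOn_comp_coords_symm eB hr).mono hUB, fun _ _ => hr0 _⟩

/-- If the mass vanishes, a fibre of dimension at most three or of constant curvature makes the
metric one of constant curvature. -/
theorem IsWarpedProductVia.locallyConstantCurvatureAt (hm : 2 ≤ m)
    {Φ : PartialDiffeomorph 𝓘(ℝ, Fin 2 ⊕ Fin m → ℝ)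
      (𝓘(ℝ, Fin 2 → ℝ).prod 𝓘(ℝ, Fin m → ℝ)) N (B × S) ∞}
    (hΦ : IsWarpedProductVia gbar g r Ω Φ) (hvac : gbar.IsLambdaVacuum Λ)
    (hr : ContMDiff 𝓘(ℝ, Fin 2 → ℝ) 𝓘(ℝ, ℝ) ∞ r) (hr0 : ∀ b, r b ≠ 0) {xbar : N}
    (hxbar : xbar ∈ Φ.source) {x : B} {y : S} (hxy : Φ xbar = (x, y)) {eB : LocalCoords (Fin 2) B}
    (hx : x ∈ eB.source) {eS : LocalCoords (Fin m) S} (hy : y ∈ eS.source) {U : Set (Fin 2 → ℝ)}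
    (hU : IsOpen U) (hxU : eB x ∈ U) {α : ℝ}
    (hB : IsBirkhoffBase (profile (2 + m) α 0 Λ) (g.components eB) (r ∘ eB.symm) U)
    (hα : ∀ p ∈ U, fiberEinstein m Λ (g.components eB) (r ∘ eB.symm) p = ((m : ℝ) - 1) * α)
    (hc : m ≤ 3 ∨ ∃ K, ∀ p ∈ eS.target, ∀ k l i j, riemannDown (Ω.components eS) k l i j p
      = K * (Ω.components eS p k i * Ω.components eS p l j
        - Ω.components eS p k j * Ω.components eS p l i)) :
    gbar.LocallyConstantCurvatureAt xbar := by
  obtain ⟨U₁, V, hU₁, hUB, hxU₁, hV, hVS, hyV, hcoord⟩ := hΦ.exists_coords hxbar hxy eB hx eS hy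
  have hU₂ : IsOpen (U₁ ∩ U) := hU₁.inter hU
  obtain ⟨e, hxe, het, heG⟩ := hcoord (U₁ ∩ U) inter_subset_left V Subset.rfl hU₂ hV ⟨hxU₁, hxU⟩ hyV
  have hv := hvac.isWarpVacuum het heG
  have h : IsWarpOn (g.components eB) (r ∘ eB.symm) (Ω.components eS) (U₁ ∩ U) V :=
    isWarpOn_components hr hr0 eB eS hU₂ hV (inter_subset_left.trans hUB) hVS
  have hc' := fun z hz => hv.fiber_constantCurvature hm h (y := z) ⟨hxU₁, hxU⟩ (hα _ hxU)
    (hc.imp id fun ⟨K, hK⟩ => ⟨K, fun z hz => hK z (hVS hz)⟩) hz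
  refine ⟨2 * Λ / (((m : ℝ) + 1) * m), e, hxe, fun q hq k l i j => ?_⟩
  rw [het] at hq
  rw [riemannDown_congr (het ▸ e.open_target) heG k l i j hq, heG q hq]
  exact hv.constantCurvature hm h (hB.mono hU₂ inter_subset_right) hc' hq k l i j

end WarpedProduct

/-! ### Birkhoff's theorem -/

theorem mainTheorem3
    (m : ℕ) (hm : 2 ≤ m) (Λ : ℝ)
    {N : Type*} [TopologicalSpace N] [ChartedSpace (Fin 2 ⊕ Fin m → ℝ) N]
    [IsManifold 𝓘(ℝ, Fin 2 ⊕ Fin m → ℝ) ∞ N]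
    {B : Type*} [TopologicalSpace B] [ChartedSpace (Fin 2 → ℝ) B]
    [IsManifold 𝓘(ℝ, Fin 2 → ℝ) ∞ B]
    {S : Type*} [TopologicalSpace S] [ChartedSpace (Fin m → ℝ) S]
    [IsManifold 𝓘(ℝ, Fin m → ℝ) ∞ S]
    (gbar : PseudoRiemannianMetric (Fin 2 ⊕ Fin m) N) (g : PseudoRiemannianMetric (Fin 2) B)
    (Ω : PseudoRiemannianMetric (Fin m) S) (r : B → ℝ)
    (hr : ContMDiff 𝓘(ℝ, Fin 2 → ℝ) 𝓘(ℝ, ℝ) ∞ r) (hr0 : ∀ b, r b ≠ 0)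
    (hg : g.IsLorentzian)
    (Φ : PartialDiffeomorph 𝓘(ℝ, Fin 2 ⊕ Fin m → ℝ)
      (𝓘(ℝ, Fin 2 → ℝ).prod 𝓘(ℝ, Fin m → ℝ)) N (B × S) ∞)
    (hΦ : IsWarpedProductVia gbar g r Ω Φ)
    (xbar : N) (hxbar : xbar ∈ Φ.source) (x : B) (y : S) (hxy : Φ xbar = (x, y))
    (hrx : ¬ ∀ᶠ b in 𝓝 x, r b = r x)
    (hvac : gbar.IsLambdaVacuum Λ)
    (hcurv : ¬ gbar.LocallyConstantCurvatureAt xbar) :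
    ∃ α M : ℝ,
      (m ≤ 3 ∨ Ω.LocallyConstantCurvatureAt y → M ≠ 0) ∧
      (mfderiv 𝓘(ℝ, Fin 2 → ℝ) 𝓘(ℝ, ℝ) r x ≠ 0 → g.gradSq r x ≠ 0 →
        HasSchwarzschildForm (profile (2 + m) α M Λ) g r x) ∧
      (mfderiv 𝓘(ℝ, Fin 2 → ℝ) 𝓘(ℝ, ℝ) r x ≠ 0 → g.gradSq r x = 0 →
        profile (2 + m) α M Λ (r x) = 0 ∧
        HasEddingtonFinkelsteinForm (profile (2 + m) α M Λ) g r x) ∧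
      (mfderiv 𝓘(ℝ, Fin 2 → ℝ) 𝓘(ℝ, ℝ) r x = 0 →
        profile (2 + m) α M Λ (r x) = 0 ∧ deriv (profile (2 + m) α M Λ) (r x) ≠ 0 ∧
        HasKruskalForm (profile (2 + m) α M Λ) g r x) ∧
      (M ≠ 0 → ∃ M' : ℝ, (M' = M ∨ M' = -M) ∧
        ∃ (E : GSTBaseDomain (2 + m) α M' Λ) (p : Fin 2 → ℝ),
          GSTBaseDomain.LocallyIsometricAt g r x E p ∧
          ((mfderiv 𝓘(ℝ, Fin 2 → ℝ) 𝓘(ℝ, ℝ) r x ≠ 0 ∧ g.gradSq r x ≠ 0 ∧ E.IsGeneric p) ∨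
           (mfderiv 𝓘(ℝ, Fin 2 → ℝ) 𝓘(ℝ, ℝ) r x ≠ 0 ∧ g.gradSq r x = 0 ∧ E.IsHorizon p) ∨
           (mfderiv 𝓘(ℝ, Fin 2 → ℝ) 𝓘(ℝ, ℝ) r x = 0 ∧ E.IsBifurcation p))) := by
  obtain ⟨eB, hx⟩ := exists_localCoords (ι := Fin 2) x
  obtain ⟨eS, hy⟩ := exists_localCoords (ι := Fin m) y
  obtain ⟨U₁, V, hU₁, hUB, hxU₁, hV, hVS, hyV, hcoord⟩ := hΦ.exists_coords hxbar hxy eB hx eS hy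
  obtain ⟨ε, hε, hball⟩ := Metric.isOpen_iff.1 hU₁ _ hxU₁
  set U := Metric.ball (eB x) ε
  have hxU : eB x ∈ U := Metric.mem_ball_self hε
  have hU : IsOpen U := Metric.isOpen_ball
  have hUt : U ⊆ eB.target := hball.trans hUB
  obtain ⟨e, -, het, heG⟩ := hcoord U hball V Subset.rfl hU hV hxU hyV
  obtain ⟨α, M, hB, hα⟩ := (hvac.isWarpVacuum het heG).exists_profile hm
    (isWarpOn_components hr hr0 eB eS hU hV hUt hVS) (convex_ball _ _).isPreconnected hyV hxU
  set f := profile (2 + m) α M Λ with hf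
  set ρ := r ∘ eB.symm
  have hρx : ρ (eB x) = r x := congrArg r (eB.left_inv hx)
  have hdet : ∀ q ∈ U, (g.components eB q).det < 0 := fun q hq => hg.det_components_neg eB (hUt hq)
  have hfa : AnalyticAt ℝ f (r x) := analyticAt_profile _ _ _ _ (hr0 x)
  have hgrad : g.gradSq r x = f (r x) := by
    rw [gradSq_eq_gradNormSq eB hr g hx, hB.gradNormSq_eq _ hxU, hρx]
  have hdiff := mfderiv_eq_zero_iff_fderiv_coords eB hr hx
  -- regular points of `r`
  have hreg : mfderiv 𝓘(ℝ, Fin 2 → ℝ) 𝓘(ℝ, ℝ) r x ≠ 0 →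
      ∃ V v, V ⊆ U ∧ eB x ∈ V ∧ IsEddingtonOn f (g.components eB) v ρ V := fun hd =>
    hB.exists_isEddingtonOn hxU hdet (hdiff.not.1 hd)
  have ha : mfderiv 𝓘(ℝ, Fin 2 → ℝ) 𝓘(ℝ, ℝ) r x ≠ 0 → g.gradSq r x ≠ 0 →
      HasSchwarzschildForm f g r x := fun hd h0 => by
    obtain ⟨V, v, hVU, hxV, h⟩ := hreg hd
    exact h.hasSchwarzschildForm (hVU.trans hUt) hx hxV hfa (hgrad ▸ h0)
  have hb : mfderiv 𝓘(ℝ, Fin 2 → ℝ) 𝓘(ℝ, ℝ) r x ≠ 0 → HasEddingtonFinkelsteinForm f g r x :=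
    fun hd => by
    obtain ⟨V, v, hVU, hxV, h⟩ := hreg hd
    exact h.hasEddingtonFinkelsteinForm (hVU.trans hUt) hx hxV
  -- critical points of `r`
  have hcrit : mfderiv 𝓘(ℝ, Fin 2 → ℝ) 𝓘(ℝ, ℝ) r x = 0 →
      ∃ (E D : ℝ → ℝ) (κ δ : ℝ) (V : Set (Fin 2 → ℝ)) (X Y : (Fin 2 → ℝ) → ℝ),
        IsSimpleZeroOn f E D (r x) κ δ ∧ V ⊆ U ∧ eB x ∈ V ∧
        MapsTo ρ V (Metric.ball (r x) δ) ∧ X (eB x) = 0 ∧ Y (eB x) = 0 ∧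
        IsIsraelOn D (r x) κ (g.components eB) X Y ρ V := fun hd => by
    have hd' := hdiff.1 hd
    have hf0 := hB.eq_zero_of_fderiv_eq_zero hxU hd'
    have hne : ¬ ∀ᶠ q in 𝓝 (eB x), ρ q = ρ (eB x) := fun hev => by
      refine hrx ?_
      have hc : ContinuousAt eB x :=
        eB.contMDiffOn_toFun.continuousOn.continuousAt (eB.open_source.mem_nhds hx)
      filter_upwards [hc.eventually hev, eB.open_source.mem_nhds hx] with b hb hbs
      rw [← hρx, ← hb]
      exact (congrArg r (eB.left_inv hbs)).symm
    have hf1 := hB.deriv_ne_zero hxU hdet hd' hne (by rwa [hρx])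
    rw [hρx] at hf0 hf1
    obtain ⟨E, D, κ, δ, hz, -⟩ := exists_isSimpleZeroOn hfa hf0 hf1 univ_mem
    have hz' := hz
    rw [← hρx] at hz'
    obtain ⟨V, X, Y, hVU, hxV, hm, hX, hY, hI⟩ := hB.exists_isIsraelOn hxU hdet hd' hz'
    rw [hρx] at hm hI
    exact ⟨E, D, κ, δ, V, X, Y, hz, hVU, hxV, hm, hX, hY, hI⟩
  refine ⟨α, M, fun hc hM => hcurv ?_, ha, fun hd h0 => ⟨hgrad.symm.trans h0, hb hd⟩, fun hd => ?_,
    fun hM => ?_⟩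
  · rw [hf, hM] at hB
    rcases hc with hm3 | ⟨K, e', hye', hK⟩
    · exact hΦ.locallyConstantCurvatureAt hm hvac hr hr0 hxbar hxy hx hy hU hxU hB hα (.inl hm3)
    · exact hΦ.locallyConstantCurvatureAt hm hvac hr hr0 hxbar hxy hx hye' hU hxU hB hα
        (.inr ⟨K, hK⟩)
  · obtain ⟨E, D, κ, δ, V, X, Y, hz, hVU, hxV, hmaps, hX, hY, hI⟩ := hcrit hd
    exact ⟨hz.zero_eq, hz.deriv_ne_zero _ (Metric.mem_ball_self hz.radius_pos),
      hI.hasKruskalForm hz (hr0 x) hmaps (hVU.trans hUt) hx hxV hX hY⟩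
  · set M' : ℝ := if r x < 0 ∧ Odd (2 + m) then -M else M with hM'
    refine ⟨M', (ite_eq_or_eq _ _ _).symm, ?_⟩
    by_cases hd : mfderiv 𝓘(ℝ, Fin 2 → ℝ) 𝓘(ℝ, ℝ) r x = 0
    · obtain ⟨E, D, κ, δ, V, X, Y, hz, hVU, hxV, hmaps, hX, hY, hI⟩ := hcrit hd
      obtain ⟨E, p, hE⟩ :=
        hI.exists_gSTBaseDomain hz hg hr0 hmaps (hVU.trans hUt) hx hxV hX hY hM'
      exact ⟨E, p, hE, .inr (.inr ⟨hd, (hE.gradSq_eq hr).2.2 hd⟩)⟩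
    · by_cases h0 : g.gradSq r x = 0
      · obtain ⟨E, p, hE⟩ := (hb hd).exists_gSTBaseDomain hm hM hg hr0 hM'
        exact ⟨E, p, hE, .inr (.inl ⟨hd, h0, (hE.gradSq_eq hr).2.not.2 hd,
          (hE.gradSq_eq hr).1.trans h0⟩)⟩
      · obtain ⟨E, p, hE⟩ := (ha hd h0).exists_gSTBaseDomain hg hr0 hM'
        exact ⟨E, p, hE, .inl ⟨hd, h0, (hE.gradSq_eq hr).1.trans_ne h0⟩⟩

end
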